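/- Let $n>2$, let $M$ be a smooth $n$-manifold, and let $g$ be a smooth pseudo-Riemannian metric of signature $(p,q)$ on $M$ that is locally conformally flat: near every point there is a smooth function $f$ such that $e^{2f}g$ has vanishing Riemann tensor. Let $P_{ij}=\frac1{n-2}\bigl(R_{ij}-\frac{R}{2(n-1)}g_{ij}\bigr)$ be the Schouten tensor, and let $\sigma_k(P)$ be the $k$-th elementary symmetric function of the (complex) eigenvalues, with multiplicity, of the endomorphism $P_i{}^j$. On an open set $U\subseteq M$ contained in a coordinate chart, consider metrics $g_+=x^{-2}(dx^2+g_x)$ on $U\times(0,a)$, $a>0$, where $g_x$, $x\in[0,a)$, is a smooth one-parameter family of metrics on $U$ (smooth up to $x=0$) with $g_0=g$. Call $g_+$ *hyperbolic* if it has constant sectional curvature $-1$. For even $n$, call $g_+$ a *Poincaré metric* if $\operatorname{Ric}(g_+)+ng_+=O(x^{n-2})$ and $\operatorname{tr}_{g_+}(\operatorname{Ric}(g_+)+ng_+)=O(x^{n+2})$ as $x\to0$. Let $v^{(j)}$ be the coefficient of $x^j$ in the Taylor expansion at $x=0$ of $(\det g_x/\det g)^{1/2}$, that is, of $dv_{g_x}/dv_g$.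 (A $g_+$ of this kind on all of $M\times(0,a)$ restricts to every such $U$.) Then: 1. Every point of $M$ has a neighbourhood $U$ on which a hyperbolic $g_+$ exists. 2. For every hyperbolic $g_+$, at every point of $U$ and for all $k\ge0$, $$v^{(2k)}=\begin{cases}(-2)^{-k}\sigma_k(P), & 0\le k\le n,\\ 0, & k>n.\end{cases}$$ 3. If $n$ is even, then for every Poincaré metric $g_+$, at every point of $U$ and for all $0\le k\le n/2$, $v^{(2k)}=(-2)^{-k}\sigma_k(P)$. 4. If $n$ is even, define the Pfaffian by $$2^n(n/2)!\operatorname{Pff}=(-1)^q\mu^{i_1\ldots i_n}\mu^{j_1\ldots j_n}R_{i_1i_2j_1j_2}\cdots R_{i_{n-1}i_nj_{n-1}j_n},$$ where $\mu_{i_1\ldots i_n}=\sqrt{|\det g|}\,\epsilon_{i_1\ldots i_n}$ and the sign of $R_{ijkl}$ is such that $R_{ijkl}=g_{ik}g_{jl}-g_{il}g_{jk}$ on the unit sphere. Then $\operatorname{Pff}=(n/2)!\,\sigma_{n/2}(P)$, and for every $g_+$ that is Poincaré or hyperbolic, $$v^{(n)}=(-2)^{-n/2}\,(n/2)!^{-1}\operatorname{Pff}.$$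 -/

import Mathlib

open Set Filter Topology Asymptotics
open scoped Manifold ContDiff Matrix

noncomputable section

namespace ConformallyFlatVolume

/-! ### Curvature of a metric given by its components in coordinates -/

section Coordinates

variable {ι E : Type*} [Fintype ι] [DecidableEq ι] [NormedAddCommGroup E] [NormedSpace ℝ E]

/-- The coordinate derivative `∂_i f` at `y`, where `e i` is the `i`-th coordinate vector. -/
def partialD (e : ι → E) (f : E → ℝ) (i : ι) (y : E) : ℝ := fderiv ℝ f y (e i)

/-- `Γ^k_{ij} = ½ g^{kl} (∂_i g_{jl} + ∂_j g_{il} - ∂_l g_{ij})`. -/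
def christoffel (e : ι → E) (G : E → Matrix ι ι ℝ) (k i j : ι) (y : E) : ℝ :=
  (1 / 2) * ∑ l, (G y)⁻¹ k l *
    (partialD e (fun z => G z j l) i y + partialD e (fun z => G z i l) j y
      - partialD e (fun z => G z i j) l y)

/-- `R^i_{jkl} = ∂_k Γ^i_{lj} - ∂_l Γ^i_{kj} + Γ^i_{km} Γ^m_{lj} - Γ^i_{lm} Γ^m_{kj}`. -/
def riemannUp (e : ι → E) (G : E → Matrix ι ι ℝ) (i j k l : ι) (y : E) : ℝ :=
  partialD e (christoffel e G i l j) k y - partialD e (christoffel e G i k j) l y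
    + ∑ m, (christoffel e G i k m y * christoffel e G m l j y
      - christoffel e G i l m y * christoffel e G m k j y)

/-- `R_{ijkl} = g_{im} R^m_{jkl}`; for the round unit sphere this is
`g_{ik} g_{jl} - g_{il} g_{jk}`. -/
def riemann (e : ι → E) (G : E → Matrix ι ι ℝ) (i j k l : ι) (y : E) : ℝ :=
  ∑ m, G y i m * riemannUp e G m j k l y

/-- The Ricci tensor `R_{jl} = R^i_{jil}`. -/
def ricci (e : ι → E) (G : E → Matrix ι ι ℝ) (y : E) : Matrix ι ι ℝ :=
  Matrix.of fun j l => ∑ i, riemannUp e G i j i l y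

/-- The trace `g^{ij} T_{ij}`. -/
def metricTrace (g T : Matrix ι ι ℝ) : ℝ := ∑ i, ∑ j, g⁻¹ i j * T i j

/-- The scalar curvature. -/
def scalarCurv (e : ι → E) (G : E → Matrix ι ι ℝ) (y : E) : ℝ :=
  metricTrace (G y) (ricci e G y)

end Coordinates

/-- The model space `ℝⁿ`. -/
abbrev Eu (n : ℕ) : Type := EuclideanSpace ℝ (Fin n)

/-- The standard coordinate vectors of `ℝⁿ`. -/
def stdVec (n : ℕ) (i : Fin n) : Eu n := EuclideanSpace.single i 1

section Schouten

variable {n : ℕ}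

/-- The Schouten tensor `P_{ij} = (n-2)⁻¹ (R_{ij} - R / (2(n-1)) g_{ij})`. -/
def schouten (G : Eu n → Matrix (Fin n) (Fin n) ℝ) (y : Eu n) : Matrix (Fin n) (Fin n) ℝ :=
  (1 / ((n : ℝ) - 2)) • (ricci (stdVec n) G y
    - (scalarCurv (stdVec n) G y / (2 * ((n : ℝ) - 1))) • G y)

/-- The matrix of the Schouten endomorphism `g⁻¹ P`. -/
def schoutenEnd (G : Eu n → Matrix (Fin n) (Fin n) ℝ) (y : Eu n) : Matrix (Fin n) (Fin n) ℝ :=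
  (G y)⁻¹ * schouten G y

/-- The `k`-th elementary symmetric function of the eigenvalues of a real matrix. The eigenvalues
are the complex ones, listed with algebraic multiplicity (for an indefinite metric the Schouten
endomorphism need not have real eigenvalues). -/
def sigmaEig (k : ℕ) (A : Matrix (Fin n) (Fin n) ℝ) : ℂ :=
  (A.map (algebraMap ℝ ℂ)).charpoly.roots.esymm k

open Classical in
/-- The sign `ε_{i_1 … i_n}`: the sign of the permutation `a ↦ i_a`, and `0` if `i` is not a
permutation. -/
def epsSymbol (i : Fin n → Fin n) : ℝ :=
  if h : Function.Bijective i then ((Equiv.Perm.sign (Equiv.ofBijective i h) : ℤ) : ℝ) else 0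

/-- The volume form `μ_{i_1 … i_n} = √|det g| ε_{i_1 … i_n}`. -/
def volForm (g : Matrix (Fin n) (Fin n) ℝ) (i : Fin n → Fin n) : ℝ :=
  √|g.det| * epsSymbol i

/-- The volume form with all its indices raised, `μ^{i_1 … i_n}`. -/
def volFormUp (g : Matrix (Fin n) (Fin n) ℝ) (i : Fin n → Fin n) : ℝ :=
  ∑ k : Fin n → Fin n, (∏ a, g⁻¹ (i a) (k a)) * volForm g k

/-- The Pfaffian of a metric with `q` negative directions in even dimension `n`:
`2ⁿ (n/2)! Pff = (-1)^q μ^{i_1 … i_n} μ^{j_1 … j_n} R_{i_1 i_2 j_1 j_2} ⋯ R_{i_{n-1} i_n j_{n-1} j_n}`.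
-/
def pfaffian (q : ℕ) (G : Eu n → Matrix (Fin n) (Fin n) ℝ) (y : Eu n) : ℝ :=
  (-1) ^ q / (2 ^ n * (Nat.factorial (n / 2) : ℝ)) *
    ∑ i : Fin n → Fin n, ∑ j : Fin n → Fin n, volFormUp (G y) i * volFormUp (G y) j *
      ∏ l : Fin (n / 2),
        riemann (stdVec n) G
          (i ⟨2 * l, by omega⟩) (i ⟨2 * l + 1, by omega⟩)
          (j ⟨2 * l, by omega⟩) (j ⟨2 * l + 1, by omega⟩) y

end Schouten

/-! ### The metric `g₊ = x⁻² (dx² + g_x)` in coordinates `(y, x)` -/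

section GPlus

variable {n : ℕ}

/-- The coordinate vectors of `ℝⁿ × ℝ`; the index `Sum.inr ()` is that of the coordinate `x`. -/
def stdVecPlus (n : ℕ) : Fin n ⊕ Unit → Eu n × ℝ :=
  Sum.elim (fun i => (stdVec n i, 0)) (fun _ => (0, 1))

/-- The components of `g₊ = x⁻² (dx² + g_x)` at the point `z = (y, x)`, where `h x y` are the
components of `g_x` at `y`. -/
def gPlus (h : ℝ → Eu n → Matrix (Fin n) (Fin n) ℝ) (z : Eu n × ℝ) :
    Matrix (Fin n ⊕ Unit) (Fin n ⊕ Unit) ℝ :=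
  (z.2 ^ 2)⁻¹ • Matrix.fromBlocks (h z.2 z.1) 0 0 1

/-- The components of `Ric(g₊) + n g₊`. -/
def einsteinDefect (h : ℝ → Eu n → Matrix (Fin n) (Fin n) ℝ) (z : Eu n × ℝ) :
    Matrix (Fin n ⊕ Unit) (Fin n ⊕ Unit) ℝ :=
  ricci (stdVecPlus n) (gPlus h) z + (n : ℝ) • gPlus h z

/-- The coefficient of `x^j` in the Taylor expansion at `x = 0` of
`dv_{g_x} / dv_g = (det g_x / det g)^{1/2}` at the point `y`. -/
def volCoeff (G : Eu n → Matrix (Fin n) (Fin n) ℝ) (h : ℝ → Eu n → Matrix (Fin n) (Fin n) ℝ)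
    (j : ℕ) (y : Eu n) : ℝ :=
  iteratedDerivWithin j (fun x => √((h x y).det / (G y).det)) (Ici 0) 0 / (Nat.factorial j : ℝ)

end GPlus

/-! ### Metrics on manifolds -/

section Manifold

variable {n : ℕ} {M : Type*} [TopologicalSpace M] [ChartedSpace (Eu n) M]

/-- A field of bilinear forms on the tangent spaces of `M`. -/
abbrev BilinField (n : ℕ) (M : Type*) [TopologicalSpace M] [ChartedSpace (Eu n) M] : Type _ :=
  (m : M) → TangentSpace (𝓡 n) m →L[ℝ] TangentSpace (𝓡 n) m →L[ℝ] ℝ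

/-- The components `b(∂_i, ∂_j)` of `b` in the chart `φ`, as functions on the target of `φ`. -/
def comps (φ : OpenPartialHomeomorph M (Eu n)) (b : BilinField n M) (y : Eu n) :
    Matrix (Fin n) (Fin n) ℝ :=
  Matrix.of fun i j => b (φ.symm y)
    (mfderiv (𝓡 n) (𝓡 n) φ.symm y (stdVec n i)) (mfderiv (𝓡 n) (𝓡 n) φ.symm y (stdVec n j))

variable (n M) in
/-- A smooth pseudo-Riemannian metric on `M`. -/
structure PseudoMetric where
  val : BilinField n M
  symm : ∀ m v w, val m v w = val m w v
  nondegenerate : ∀ m v, (∀ w, val m v w = 0) → v = 0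
  smooth : ∀ φ ∈ IsManifold.maximalAtlas (𝓡 n) ∞ M, ∀ i j,
    ContDiffOn ℝ ∞ (fun y => comps φ val y i j) φ.target

/-- `g` has signature `(p, q)`: every tangent space has a basis that is orthonormal for `g`, with
`p` vectors of square `1` and `q` vectors of square `-1`. -/
def PseudoMetric.HasSignature (g : PseudoMetric n M) (p q : ℕ) : Prop :=
  ∀ m : M, ∃ b : Module.Basis (Fin p ⊕ Fin q) ℝ (TangentSpace (𝓡 n) m),
    ∀ s t, g.val m (b s) (b t) =
      if s = t then Sum.elim (fun _ => (1 : ℝ)) (fun _ => (-1 : ℝ)) s else 0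

/-- `g` is locally conformally flat: near every point there is a smooth function `f` such that the
Riemann tensor of `e^{2f} g` vanishes. -/
def PseudoMetric.IsConformallyFlat (g : PseudoMetric n M) : Prop :=
  ∀ m : M, ∃ V : Set M, IsOpen V ∧ m ∈ V ∧ ∃ f : M → ℝ, ContMDiffOn (𝓡 n) 𝓘(ℝ) ∞ f V ∧
    ∀ φ ∈ IsManifold.maximalAtlas (𝓡 n) ∞ M, ∀ y ∈ φ.target, φ.symm y ∈ V → ∀ i j k l,
      riemann (stdVec n) (fun z => Real.exp (2 * f (φ.symm z)) • comps φ g.val z) i j k l y = 0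

/-- `gx` is a smooth one-parameter family of metrics `g_x`, `x ∈ [0, a)`, on the open subset `U`
of the domain of the chart `φ`, with `g_0 = g`; smoothness is joint smoothness of the components,
up to and including `x = 0`. -/
structure IsMetricFamily (g : PseudoMetric n M) (φ : OpenPartialHomeomorph M (Eu n)) (U : Set M)
    (a : ℝ) (gx : ℝ → BilinField n M) : Prop where
  chart_mem : φ ∈ IsManifold.maximalAtlas (𝓡 n) ∞ M
  isOpen : IsOpen U
  subset : U ⊆ φ.source
  pos : 0 < a
  symm : ∀ x ∈ Ico 0 a, ∀ m ∈ U, ∀ v w, gx x m v w = gx x m w v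
  nondegenerate : ∀ x ∈ Ico 0 a, ∀ m ∈ U, ∀ v, (∀ w, gx x m v w = 0) → v = 0
  smooth : ∀ i j, ContDiffOn ℝ ∞ (fun z : Eu n × ℝ => comps φ (gx z.2) z.1 i j)
    ((φ '' U) ×ˢ Ico 0 a)
  initial : ∀ m ∈ U, gx 0 m = g.val m

/-- `g₊ = x⁻² (dx² + g_x)` is a Poincaré metric for `(U, g)`: `Ric(g₊) + n g₊ = O(x^{n-2})` and
`tr_{g₊}(Ric(g₊) + n g₊) = O(x^{n+2})` as `x → 0`. Being tensorial, the conditions are read off in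
the single chart `φ`, whose domain contains `U`; a Poincaré metric for all of `M` restricts to one
for every such `U`. The estimates are only required at each point of `U` separately. -/
structure IsPoincareMetric (g : PseudoMetric n M) (φ : OpenPartialHomeomorph M (Eu n)) (U : Set M)
    (a : ℝ) (gx : ℝ → BilinField n M) : Prop extends IsMetricFamily g φ U a gx where
  einstein : ∀ m ∈ U, ∀ A B,
    (fun x : ℝ => einsteinDefect (fun x => comps φ (gx x)) (φ m, x) A B)
      =O[𝓝[>] 0] fun x => x ^ (n - 2)
  trace : ∀ m ∈ U,
    (fun x : ℝ => metricTrace (gPlus (fun x => comps φ (gx x)) (φ m, x))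
        (einsteinDefect (fun x => comps φ (gx x)) (φ m, x)))
      =O[𝓝[>] 0] fun x => x ^ (n + 2)

/-- `g₊ = x⁻² (dx² + g_x)` is hyperbolic on `U × (0, a)`, that is, of constant sectional curvature
`-1`. -/
structure IsHyperbolicMetric (g : PseudoMetric n M) (φ : OpenPartialHomeomorph M (Eu n))
    (U : Set M) (a : ℝ) (gx : ℝ → BilinField n M) : Prop extends IsMetricFamily g φ U a gx where
  curvature : ∀ m ∈ U, ∀ x ∈ Ioo 0 a, ∀ A B C D,
    riemann (stdVecPlus n) (gPlus fun x => comps φ (gx x)) A B C D (φ m, x) =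
      -(gPlus (fun x => comps φ (gx x)) (φ m, x) A C * gPlus (fun x => comps φ (gx x)) (φ m, x) B D
        - gPlus (fun x => comps φ (gx x)) (φ m, x) A D
          * gPlus (fun x => comps φ (gx x)) (φ m, x) B C)

end Manifold

end ConformallyFlatVolume

end

/-!
The coefficients of the volume form are computed for one explicit hyperbolic metric, and the
Einstein equation shows that every other hyperbolic metric has the same ones, and every Poincaré
metric the same ones up to order `n`.

*The explicit metric.* If `e^{2f} g` is flat, the transformation law of the curvature under a
conformal change expresses the curvature of `g` as the Kulkarni–Nomizu product of `g` with the
symmetric form `g a`, where `a = ∇ grad f - grad f ⊗ df + ½ |df|²`, and the Ricci identity for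
`grad f` is the Codazzi equation for `a` (`isSchouten_confSchouten`). Contracting once gives
`a = P` as `n > 2`. These two facts are the structure equations saying that
`x⁻² (dx² + g (1 - x² P / 2)²)` has constant curvature `-1`. In the coframe with coefficient matrix
`x⁻¹ ((1 - x² P / 2) ⊕ 1)` the metric is `g ⊕ 1`, independent of `x`, and the connection is
explicit, so that the curvature can be read off (`hyp_riemann`). The volume ratio of this family is
`det (1 - x² P / 2)`, a reversed characteristic polynomial: its Taylor coefficient of order `2k` is
`(-2)^{-k} σ_k(P)` (`iteratedDerivWithin_det_hypA`).

*Uniqueness.* With `θ = x ∂_x`, the Einstein tensor of `x⁻² (dx² + g_x)`, multiplied by `-2 x²`, is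
polynomial in `g`, `g⁻¹`, `θ g`, `θ² g` and `x² Ric(g_x)`. On functions vanishing to order `m` at
`x = 0`, `θ` acts as multiplication by `m` up to terms of higher order (`euler_mem_ordIdeal`). If
two families differ by `δ` of order `m`, the tangential components of these expressions
therefore differ by `m (m - n) δ - m (tr δ) g` up to order `m + 1`, and this operator is injective
for `0 < m < n` (`AgreeTo.succ_of_einTan`). Hence a Poincaré metric agrees with the explicit one up
to order `n - 1`; in order `n` the trace of the Einstein tensor still determines `tr δ`
(`AgreeTo.trace_mem_of_einstein_trace`), which is all that enters `det g_x` in that order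
(`AgreeTo.det_sub_det_mem_succ`). For a hyperbolic metric the radial curvature equation has the
leading part `m (m - 2) δ`, so that it determines all orders except `m = 2`
(`AgreeTo.succ_of_radialDefect`); this one is covered by the Einstein equation, as `n > 2`.

*The Pfaffian.* Inserting the Kulkarni–Nomizu form of the curvature and expanding the two
Levi-Civita symbols, the contraction becomes a mixed discriminant of `n / 2` copies of `g` and
`n / 2` copies of `g P` (`sum_sign_prod_kulkarni_nomizu`). Up to a binomial coefficient this is the
coefficient of `t^{n/2}` in `det (g + t g P) = det g · det (1 + t P)` (`choose_mul_mixedDisc`), that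
is, `det g · σ_{n/2}(P)`. The sign of `det g` is `(-1)^q` by the signature (`det_comps_sign`).

All computations with curvature take place over a commutative `ℝ`-algebra with commuting
derivations. They are applied to the algebra `smoothAlg S` of smooth functions on `S`, where `S`
may be an open set or a collar `Y × [0, a)`, on which one-sided derivatives at `x = 0` are
available.
-/

noncomputable section

namespace ConformallyFlatVolume

/-! ### Connections and curvature over a commutative ring with derivations -/

section Connections

variable {R S ι κ ν : Type*} [CommRing R] [Algebra ℝ R] [CommRing S] [Algebra ℝ S]

/-- The entrywise derivative of a matrix. -/
def matD (d : Derivation ℝ R R) (A : Matrix ι κ R) : Matrix ι κ R := A.map d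

@[simp] lemma matD_apply (d : Derivation ℝ R R) (A : Matrix ι κ R) (i : ι) (j : κ) :
    matD d A i j = d (A i j) := rfl

lemma matD_add (d : Derivation ℝ R R) (A B : Matrix ι κ R) :
    matD d (A + B) = matD d A + matD d B := by ext; simp

lemma matD_sub (d : Derivation ℝ R R) (A B : Matrix ι κ R) :
    matD d (A - B) = matD d A - matD d B := by ext; simp

lemma matD_transpose (d : Derivation ℝ R R) (A : Matrix ι κ R) :
    matD d Aᵀ = (matD d A)ᵀ := by ext; simp

@[simp] lemma matD_zero (d : Derivation ℝ R R) : matD d (0 : Matrix ι κ R) = 0 := by ext; simp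

@[simp] lemma matD_one [DecidableEq ι] (d : Derivation ℝ R R) :
    matD d (1 : Matrix ι ι R) = 0 := by
  ext i j
  by_cases h : i = j <;> simp [h]

lemma matD_smul (d : Derivation ℝ R R) (r : R) (A : Matrix ι κ R) :
    matD d (r • A) = d r • A + r • matD d A := by
  ext; simp; ring

lemma matD_mul [Fintype κ] (d : Derivation ℝ R R) (A : Matrix ι κ R) (B : Matrix κ ν R) :
    matD d (A * B) = matD d A * B + A * matD d B := by
  ext i j
  simp only [matD_apply, Matrix.mul_apply, Matrix.add_apply, map_sum, Derivation.leibniz,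
    smul_eq_mul, ← Finset.sum_add_distrib]
  exact Finset.sum_congr rfl fun k _ => by ring

lemma matD_fromBlocks {ι' κ' : Type*} (d : Derivation ℝ R R) (A : Matrix ι κ R) (B : Matrix ι κ' R)
    (C : Matrix ι' κ R) (E : Matrix ι' κ' R) :
    matD d (Matrix.fromBlocks A B C E)
      = Matrix.fromBlocks (matD d A) (matD d B) (matD d C) (matD d E) := by
  simp [matD, Matrix.fromBlocks_map]

lemma matD_map (d : Derivation ℝ R R) (d' : Derivation ℝ S S) (ρ : R →ₐ[ℝ] S)
    (h : ∀ r, ρ (d r) = d' (ρ r)) (A : Matrix ι κ R) :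
    (matD d A).map ρ = matD d' (A.map ρ) := by
  ext; simp [h]

variable [Fintype ι]

/-- The derivative of an inverse matrix. -/
lemma matD_inv [DecidableEq ι] (d : Derivation ℝ R R) {A : Matrix ι ι R} (hA : IsUnit A.det) :
    matD d A⁻¹ = -(A⁻¹ * matD d A * A⁻¹) := by
  have h : matD d (A * A⁻¹) = 0 := by rw [Matrix.mul_nonsing_inv A hA, matD_one]
  rw [matD_mul] at h
  calc matD d A⁻¹ = A⁻¹ * (matD d A * A⁻¹ + A * matD d A⁻¹) - A⁻¹ * matD d A * A⁻¹ := by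
        rw [Matrix.mul_add, ← Matrix.mul_assoc, ← Matrix.mul_assoc A⁻¹ A,
          Matrix.nonsing_inv_mul A hA, Matrix.one_mul]
        abel
    _ = _ := by rw [h]; simp

/-- The curvature `D_k Γ_l - D_l Γ_k + [Γ_k, Γ_l]` of the connection with matrices
`(Γ_k)_{ij} = Γ^i_{kj}`. -/
def curv {μ : Type*} (D : μ → Derivation ℝ R R) (Γ : μ → Matrix ι ι R) (k l : μ) :
    Matrix ι ι R :=
  matD (D k) (Γ l) - matD (D l) (Γ k) + (Γ k * Γ l - Γ l * Γ k)

lemma curv_swap {μ : Type*} (D : μ → Derivation ℝ R R) (Γ : μ → Matrix ι ι R) (k l : μ) :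
    curv D Γ k l = -curv D Γ l k := by
  simp only [curv]; abel

lemma curv_self {μ : Type*} (D : μ → Derivation ℝ R R) (Γ : μ → Matrix ι ι R) (k : μ) :
    curv D Γ k k = 0 := by
  simp [curv]

/-- `Γ` is the Levi-Civita connection of the symmetric matrix `G`: it is torsion-free and `G` is
parallel. -/
structure IsLC (D : ι → Derivation ℝ R R) (G : Matrix ι ι R) (Γ : ι → Matrix ι ι R) : Prop where
  torsion : ∀ i j k, Γ k i j = Γ j i k
  compat : ∀ k, matD (D k) G = G * Γ k + (G * Γ k)ᵀ

lemma curv_map {μ : Type*} {D : μ → Derivation ℝ R R} {D' : μ → Derivation ℝ S S} (ρ : R →ₐ[ℝ] S)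
    (h : ∀ i r, ρ (D i r) = D' i (ρ r)) (Γ : μ → Matrix ι ι R) (k l : μ) :
    (curv D Γ k l).map ρ = curv D' (fun i => (Γ i).map ρ) k l := by
  simp only [curv, ← matD_map _ _ ρ (h _)]
  ext i j
  simp [Matrix.mul_apply]

/-- The Ricci tensor of the connection `Γ`. -/
def ric (D : ι → Derivation ℝ R R) (Γ : ι → Matrix ι ι R) : Matrix ι ι R :=
  Matrix.of fun j l => ∑ i, curv D Γ i l i j

lemma ric_map {D : ι → Derivation ℝ R R} {D' : ι → Derivation ℝ S S} (ρ : R →ₐ[ℝ] S)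
    (h : ∀ i r, ρ (D i r) = D' i (ρ r)) (Γ : ι → Matrix ι ι R) :
    (ric D Γ).map ρ = ric D' (fun i => (Γ i).map ρ) := by
  ext j l
  simp only [ric, Matrix.map_apply, Matrix.of_apply, map_sum, ← curv_map ρ h]

variable [DecidableEq ι]

/-- The Christoffel symbols of `G`, as the matrices `(Γ_k)_{ij} = Γ^i_{kj}`. -/
def chr (D : ι → Derivation ℝ R R) (G : Matrix ι ι R) (k : ι) : Matrix ι ι R :=
  Matrix.of fun i j => (1 / 2 : ℝ) • ∑ l, G⁻¹ i l * (D k (G j l) + D j (G k l) - D l (G k j))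

lemma mul_chr_apply (D : ι → Derivation ℝ R R) {G : Matrix ι ι R} (hG : IsUnit G.det)
    (k i j : ι) :
    (G * chr D G k) i j = (1 / 2 : ℝ) • (D k (G j i) + D j (G k i) - D i (G k j)) := by
  have h : chr D G k = G⁻¹ * Matrix.of fun i j =>
      (1 / 2 : ℝ) • (D k (G j i) + D j (G k i) - D i (G k j)) := by
    ext i j
    simp [chr, Matrix.mul_apply, Finset.smul_sum]
  rw [h, ← Matrix.mul_assoc, Matrix.mul_nonsing_inv _ hG, Matrix.one_mul]
  rfl

lemma chr_isLC (D : ι → Derivation ℝ R R) {G : Matrix ι ι R} (hG : IsUnit G.det)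
    (hs : Gᵀ = G) : IsLC D G (chr D G) := by
  have hs' : ∀ i j, G i j = G j i := fun i j => congrFun (congrFun hs j) i
  refine ⟨fun i j k => ?_, fun k => ?_⟩
  · simp only [chr, Matrix.of_apply]
    congr 1
    refine Finset.sum_congr rfl fun l _ => ?_
    rw [hs' k j]; ring
  · ext i j
    rw [Matrix.add_apply, Matrix.transpose_apply, mul_chr_apply D hG, mul_chr_apply D hG,
      ← smul_add, hs' j i]
    have : D k (G i j) + D j (G k i) - D i (G k j) + (D k (G i j) + D i (G k j) - D j (G k i))
        = (2 : ℝ) • D k (G i j) := by rw [two_smul]; ring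
    rw [this, smul_smul]; norm_num

lemma IsLC.eq_chr {D : ι → Derivation ℝ R R} {G : Matrix ι ι R} {Γ : ι → Matrix ι ι R}
    (h : IsLC D G Γ) (hG : IsUnit G.det) : Γ = chr D G := by
  have key : ∀ k, G * Γ k = G * chr D G k := by
    intro k
    ext i j
    rw [mul_chr_apply D hG]
    have hc : ∀ k i j, D k (G i j) = (G * Γ k) i j + (G * Γ k) j i := fun k i j =>
      congrFun (congrFun (h.compat k) i) j
    have ht : ∀ k i j, (G * Γ k) i j = (G * Γ j) i k := fun k i j => by
      simp only [Matrix.mul_apply]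
      exact Finset.sum_congr rfl fun m _ => by rw [h.torsion]
    rw [hc, hc, hc, ht k j i, ht j k i, ht j i k]
    have : (G * Γ i) j k + (G * Γ k) i j + ((G * Γ i) k j + (G * Γ k) i j)
        - ((G * Γ i) k j + (G * Γ i) j k) = (2 : ℝ) • (G * Γ k) i j := by
      rw [two_smul]; ring
    rw [this, smul_smul]; norm_num
  funext k
  calc Γ k = G⁻¹ * (G * Γ k) := by
        rw [← Matrix.mul_assoc, Matrix.nonsing_inv_mul _ hG, Matrix.one_mul]
    _ = chr D G k := by
        rw [key, ← Matrix.mul_assoc, Matrix.nonsing_inv_mul _ hG, Matrix.one_mul]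

lemma map_inv_of_isUnit (ρ : R →ₐ[ℝ] S) {A : Matrix ι ι R} (hA : IsUnit A.det) :
    (A⁻¹).map ρ = (A.map ρ)⁻¹ := by
  symm
  apply Matrix.inv_eq_right_inv
  have := congrArg (fun B : Matrix ι ι R => B.map ρ) (Matrix.mul_nonsing_inv A hA)
  simpa [Matrix.map_mul] using this

lemma chr_map {D : ι → Derivation ℝ R R} {D' : ι → Derivation ℝ S S} (ρ : R →ₐ[ℝ] S)
    (h : ∀ i r, ρ (D i r) = D' i (ρ r)) {G : Matrix ι ι R} (hG : IsUnit G.det) (k : ι) :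
    (chr D G k).map ρ = chr D' (G.map ρ) k := by
  ext i j
  simp only [chr, Matrix.map_apply, Matrix.of_apply, map_smul, map_sum, map_mul, map_add, map_sub,
    h, ← map_inv_of_isUnit ρ hG]

/-- Curvature is conjugated by a change of frame. -/
lemma curv_gauge {μ : Type*} {D : μ → Derivation ℝ R R}
    (hD : ∀ i j r, D i (D j r) = D j (D i r)) {A : Matrix ι ι R} (hA : IsUnit A.det)
    (w : μ → Matrix ι ι R) (k l : μ) :
    curv D (fun i => A⁻¹ * (w i * A + matD (D i) A)) k l = A⁻¹ * curv D w k l * A := by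
  have h1 : A * A⁻¹ = 1 := Matrix.mul_nonsing_inv A hA
  have hDD : matD (D k) (matD (D l) A) = matD (D l) (matD (D k) A) := by
    ext; simp [hD k l]
  have h2 : ∀ X Y : Matrix ι ι R, X * A * (A⁻¹ * Y) = X * Y := fun X Y => by
    rw [Matrix.mul_assoc, ← Matrix.mul_assoc A, h1, Matrix.one_mul]
  have h3 : ∀ X : Matrix ι ι R, A * (A⁻¹ * X) = X := fun X => by
    rw [← Matrix.mul_assoc A, h1, Matrix.one_mul]
  simp only [curv, matD_mul, matD_add, matD_inv _ hA, hDD, Matrix.mul_add, Matrix.add_mul,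
    Matrix.mul_sub, Matrix.sub_mul, Matrix.neg_mul, Matrix.mul_assoc, h3]
  abel

/-- A metric connection `w` in a frame `E` that is torsion-free in the coordinate frame gives the
Levi-Civita connection of `Eᵀ η E`. -/
lemma isLC_of_frame {D : ι → Derivation ℝ R R} {E η : Matrix ι ι R} (hE : IsUnit E.det)
    {w : ι → Matrix ι ι R} (hs : ηᵀ = η) (hc : ∀ k, matD (D k) η = η * w k + (η * w k)ᵀ)
    (ht : ∀ i j k, (w k * E + matD (D k) E) i j = (w j * E + matD (D j) E) i k) :
    IsLC D (Eᵀ * η * E) (fun k => E⁻¹ * (w k * E + matD (D k) E)) := by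
  have h3 : ∀ X : Matrix ι ι R, E * (E⁻¹ * X) = X := fun X => by
    rw [← Matrix.mul_assoc E, Matrix.mul_nonsing_inv E hE, Matrix.one_mul]
  refine ⟨fun i j k => ?_, fun k => ?_⟩
  · rw [Matrix.mul_apply, Matrix.mul_apply]
    exact Finset.sum_congr rfl fun m _ => by rw [ht]
  · simp only [matD_mul, matD_transpose, hc, Matrix.mul_assoc, h3, Matrix.mul_add,
      Matrix.transpose_add, Matrix.transpose_mul, Matrix.add_mul, hs, Matrix.transpose_transpose]
    abel

end Connections

/-! ### Conformally flat metrics -/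

section ConformallyFlat

variable {R ι : Type*} [CommRing R] [Algebra ℝ R] [Fintype ι]

/-- The covariant derivative `∇_k u^i` of a vector field. -/
def covV (D : ι → Derivation ℝ R R) (Γ : ι → Matrix ι ι R) (u : ι → R) (i k : ι) : R :=
  D k (u i) + ∑ m, Γ k i m * u m

/-- The Ricci identity for the second covariant derivatives of a vector field. -/
lemma ricci_identity {D : ι → Derivation ℝ R R}
    (hD : ∀ i j r, D i (D j r) = D j (D i r)) (Γ : ι → Matrix ι ι R)
    (u : ι → R) (i k l : ι) :
    (D k (covV D Γ u i l) + ∑ m, Γ k i m * covV D Γ u m l)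
      - (D l (covV D Γ u i k) + ∑ m, Γ l i m * covV D Γ u m k)
      = ∑ m, curv D Γ k l i m * u m := by
  have e : ∀ k l : ι, ∑ m, (Γ k * Γ l) i m * u m = ∑ m, Γ k i m * ∑ p, Γ l m p * u p := by
    intro k l
    have : ((Γ k * Γ l) *ᵥ u) i = (Γ k *ᵥ (Γ l *ᵥ u)) i := by rw [Matrix.mulVec_mulVec]
    exact this
  simp only [curv, Matrix.add_apply, Matrix.sub_apply, matD_apply, add_mul, sub_mul,
    Finset.sum_add_distrib, Finset.sum_sub_distrib, e, covV, mul_add, map_add, map_sum,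
    Derivation.leibniz, smul_eq_mul, hD l k]
  have c : ∀ k l : ι, ∑ m, u m * D k (Γ l i m) = ∑ m, D k (Γ l i m) * u m := fun k l =>
    Finset.sum_congr rfl fun m _ => mul_comm _ _
  rw [c, c]
  ring

variable [DecidableEq ι]

/-- The structure equations of a conformally flat metric `G` with Levi-Civita connection `Γ` and
Schouten endomorphism `a`: the form `G a` is symmetric, the curvature is its Kulkarni-Nomizu product
with `G` (so the Weyl tensor vanishes), and `a` is a Codazzi tensor (so the Cotton tensor
vanishes). -/
structure IsSchouten (D : ι → Derivation ℝ R R) (G : Matrix ι ι R) (Γ : ι → Matrix ι ι R)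
    (a : Matrix ι ι R) : Prop where
  symm : (G * a)ᵀ = G * a
  curvature : ∀ k l i j, curv D Γ k l i j =
    (1 : Matrix ι ι R) i k * (G * a) j l - (1 : Matrix ι ι R) i l * (G * a) j k
      + a i k * G l j - a i l * G k j
  codazzi : ∀ i k l, D k (a i l) + (Γ k * a) i l = D l (a i k) + (Γ l * a) i k

/-- The gradient `u = G⁻¹ df` of `f`. -/
def gradV (D : ι → Derivation ℝ R R) (G : Matrix ι ι R) (f : R) (i : ι) : R :=
  ∑ m, G⁻¹ i m * D m f

/-- The difference of the Levi-Civita connections of `e^{2f} G` and `G`. -/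
def confDiff (D : ι → Derivation ℝ R R) (G : Matrix ι ι R) (f : R) (k : ι) : Matrix ι ι R :=
  D k f • (1 : Matrix ι ι R) + Matrix.vecMulVec (fun i => (1 : Matrix ι ι R) i k) (fun j => D j f)
    - Matrix.vecMulVec (gradV D G f) (fun j => G k j)

/-- The endomorphism `∇ grad f - grad f ⊗ df + ½ |df|²`, which is the Schouten endomorphism of `G`
when `e^{2f} G` is flat. -/
def confSchouten (D : ι → Derivation ℝ R R) (G : Matrix ι ι R) (f : R) : Matrix ι ι R :=
  Matrix.of fun i l => covV D (chr D G) (gradV D G f) i l - gradV D G f i * D l f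
    + (1 / 2 : ℝ) • (∑ m, D m f * gradV D G f m) * (1 : Matrix ι ι R) i l

variable {D : ι → Derivation ℝ R R} {G : Matrix ι ι R} {f : R}

lemma mul_gradV (hG : IsUnit G.det) (j : ι) : ∑ m, G j m * gradV D G f m = D j f := by
  have : G *ᵥ (G⁻¹ *ᵥ fun m => D m f) = fun m => D m f := by
    rw [Matrix.mulVec_mulVec, Matrix.mul_nonsing_inv _ hG, Matrix.one_mulVec]
  exact congrFun this j

lemma confDiff_apply (k i j : ι) : confDiff D G f k i j =
    D k f * (1 : Matrix ι ι R) i j + (1 : Matrix ι ι R) i k * D j f - gradV D G f i * G k j := by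
  simp [confDiff, Matrix.vecMulVec_apply]

lemma confDiff_isLC (hG : IsUnit G.det) (hs : Gᵀ = G) {w : R}
    (hw : ∀ k, D k w = w * D k f + w * D k f) :
    IsLC D (w • G) (fun k => chr D G k + confDiff D G f k) := by
  have hs' : ∀ i j, G i j = G j i := fun i j => congrFun (congrFun hs j) i
  have hLC := chr_isLC D hG hs
  refine ⟨fun i j k => ?_, fun k => ?_⟩
  · simp only [Matrix.add_apply, confDiff_apply, hLC.torsion i j k, hs' k j]
    ring
  · have h1 : ∀ i j, (G * confDiff D G f k) i j
        = G i j * D k f + G i k * D j f - D i f * G k j := by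
      intro i j
      rw [Matrix.mul_apply]
      simp only [confDiff_apply, mul_sub, mul_add, Finset.sum_add_distrib, Finset.sum_sub_distrib,
        ← mul_gradV (D := D) (f := f) hG i, Finset.sum_mul]
      simp [Matrix.one_apply, mul_assoc]
    ext i j
    have h2 := congrFun (congrFun (hLC.compat k) i) j
    simp only [matD_apply, Matrix.add_apply, Matrix.transpose_apply] at h2
    rw [matD_smul, hw]
    simp only [Matrix.add_apply, Matrix.smul_apply, Matrix.transpose_apply, Matrix.smul_mul,
      Matrix.mul_add, h1, matD_apply, h2, smul_eq_mul, hs' j i, hs' j k, hs' k i]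
    ring

/-- The covariant Hessian of `f` is obtained from `∇ grad f` by lowering an index. -/
lemma hess_eq (hG : IsUnit G.det) (hs : Gᵀ = G) (j k : ι) :
    D k (D j f) - ∑ m, D m f * chr D G k m j
      = ∑ m, G j m * covV D (chr D G) (gradV D G f) m k := by
  have hLC := chr_isLC D hG hs
  have h2 : ∀ m, D k (G j m) = ∑ p, G j p * chr D G k p m + ∑ p, G m p * chr D G k p j := by
    intro m
    have := congrFun (congrFun (hLC.compat k) j) m
    simpa only [matD_apply, Matrix.add_apply, Matrix.transpose_apply, Matrix.mul_apply] using this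
  have h3 : D k (D j f) = ∑ m, (D k (G j m) * gradV D G f m + G j m * D k (gradV D G f m)) := by
    rw [← mul_gradV (f := f) hG j, map_sum]
    refine Finset.sum_congr rfl fun m _ => ?_
    simp only [Derivation.leibniz, smul_eq_mul]; ring
  have hs' : ∀ i j, G i j = G j i := fun i j => congrFun (congrFun hs j) i
  have h4 : ∑ m, D m f * chr D G k m j
      = ∑ m, (∑ p, G m p * chr D G k p j) * gradV D G f m := by
    simp only [← mul_gradV (f := f) hG, Finset.sum_mul]
    rw [Finset.sum_comm]
    refine Finset.sum_congr rfl fun m _ => Finset.sum_congr rfl fun p _ => ?_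
    rw [hs' p m]; ring
  have h5 : ∑ m, G j m * ∑ p, chr D G k m p * gradV D G f p
      = ∑ m, (∑ p, G j p * chr D G k p m) * gradV D G f m := by
    simp only [Finset.sum_mul, Finset.mul_sum]
    rw [Finset.sum_comm]
    refine Finset.sum_congr rfl fun m _ => Finset.sum_congr rfl fun p _ => ?_
    ring
  simp only [covV, mul_add, Finset.sum_add_distrib]
  rw [h3, h4, h5]
  simp only [h2, add_mul, Finset.sum_add_distrib]
  ring

lemma hess_symm (hD : ∀ i j r, D i (D j r) = D j (D i r)) (hG : IsUnit G.det) (hs : Gᵀ = G)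
    (j k : ι) : ∑ m, G j m * covV D (chr D G) (gradV D G f) m k
      = ∑ m, G k m * covV D (chr D G) (gradV D G f) m j := by
  rw [← hess_eq hG hs, ← hess_eq hG hs, hD]
  simp only [(chr_isLC D hG hs).torsion _ j k]

lemma mul_confSchouten_apply (hG : IsUnit G.det) (j l : ι) :
    (G * confSchouten D G f) j l = ∑ m, G j m * covV D (chr D G) (gradV D G f) m l
      - D j f * D l f + (1 / 2 : ℝ) • (∑ m, D m f * gradV D G f m) * G j l := by
  rw [← mul_gradV (D := D) (f := f) hG j, Matrix.mul_apply]
  simp only [confSchouten, Matrix.of_apply, mul_add, mul_sub, Finset.sum_add_distrib,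
    Finset.sum_sub_distrib, Finset.sum_mul]
  congr 1
  · congr 1
    exact Finset.sum_congr rfl fun m _ => by ring
  · simp [Matrix.one_apply]; ring

lemma confDiff_mul (hG : IsUnit G.det) (k l i j : ι) :
    (confDiff D G f k * confDiff D G f l) i j =
      D k f * confDiff D G f l i j + D l f * (confDiff D G f k i j - D k f * (1 : Matrix ι ι R) i j)
      + D l f * (1 : Matrix ι ι R) i k * D j f
      - (∑ m, D m f * gradV D G f m) * (1 : Matrix ι ι R) i k * G l j
      - gradV D G f i * G k l * D j f + gradV D G f i * D k f * G l j := by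
  have h1 := mul_gradV (D := D) (f := f) hG k
  have h2 : ∀ m, confDiff D G f k i m * confDiff D G f l m j =
      D k f * ((1 : Matrix ι ι R) i m * confDiff D G f l m j)
      + (1 : Matrix ι ι R) i k * D m f * confDiff D G f l m j
      - gradV D G f i * G k m * confDiff D G f l m j := fun m => by
    rw [confDiff_apply k i m]; ring
  rw [Matrix.mul_apply]
  simp only [h2, Finset.sum_add_distrib, Finset.sum_sub_distrib]
  have e1 : ∑ m, D k f * ((1 : Matrix ι ι R) i m * confDiff D G f l m j)
      = D k f * confDiff D G f l i j := by simp [Matrix.one_apply]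
  have e2 : ∑ m, (1 : Matrix ι ι R) i k * D m f * confDiff D G f l m j
      = (1 : Matrix ι ι R) i k * (D j f * D l f + D l f * D j f
          - (∑ m, D m f * gradV D G f m) * G l j) := by
    have : ∀ m, (1 : Matrix ι ι R) i k * D m f * confDiff D G f l m j
        = (1 : Matrix ι ι R) i k * (D m f * D l f * (1 : Matrix ι ι R) m j
          + (1 : Matrix ι ι R) m l * (D m f * D j f) - (D m f * gradV D G f m) * G l j) :=
      fun m => by rw [confDiff_apply]; ring
    simp only [this, ← Finset.mul_sum, Finset.sum_add_distrib, Finset.sum_sub_distrib,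
      ← Finset.sum_mul]
    simp [Matrix.one_apply]
  have e3 : ∑ m, gradV D G f i * G k m * confDiff D G f l m j
      = gradV D G f i * (G k j * D l f + G k l * D j f - D k f * G l j) := by
    have : ∀ m, gradV D G f i * G k m * confDiff D G f l m j
        = gradV D G f i * (G k m * D l f * (1 : Matrix ι ι R) m j
          + (1 : Matrix ι ι R) m l * (G k m * D j f) - (G k m * gradV D G f m) * G l j) :=
      fun m => by rw [confDiff_apply]; ring
    simp only [this, ← Finset.mul_sum, Finset.sum_add_distrib, Finset.sum_sub_distrib,
      ← Finset.sum_mul, h1]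
    simp [Matrix.one_apply]
  rw [e1, e2, e3]
  simp only [confDiff_apply]
  ring

lemma cov_confDiff (hG : IsUnit G.det) (hs : Gᵀ = G) (k l i j : ι) :
    (matD (D k) (confDiff D G f l) + chr D G k * confDiff D G f l
        - confDiff D G f l * chr D G k) i j =
      D k (D l f) * (1 : Matrix ι ι R) i j
      + (1 : Matrix ι ι R) i l * ∑ m, G j m * covV D (chr D G) (gradV D G f) m k
      - covV D (chr D G) (gradV D G f) i k * G l j + chr D G k i l * D j f
      - gradV D G f i * ∑ m, G j m * chr D G k m l := by
  have hLC := chr_isLC D hG hs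
  have h2 : D k (G l j) = ∑ p, G l p * chr D G k p j + ∑ p, G j p * chr D G k p l := by
    have := congrFun (congrFun (hLC.compat k) l) j
    simpa only [matD_apply, Matrix.add_apply, Matrix.transpose_apply, Matrix.mul_apply] using this
  have hone : ∀ p q, D k ((1 : Matrix ι ι R) p q) = 0 := fun p q =>
    congrFun (congrFun (matD_one (D k)) p) q
  have e1 : (chr D G k * confDiff D G f l) i j = D l f * chr D G k i j + chr D G k i l * D j f
      - (∑ m, chr D G k i m * gradV D G f m) * G l j := by
    have : ∀ m, chr D G k i m * confDiff D G f l m j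
        = D l f * (chr D G k i m * (1 : Matrix ι ι R) m j)
          + (1 : Matrix ι ι R) m l * (chr D G k i m * D j f)
          - (chr D G k i m * gradV D G f m) * G l j := fun m => by rw [confDiff_apply]; ring
    rw [Matrix.mul_apply]
    simp only [this, ← Finset.mul_sum, Finset.sum_add_distrib, Finset.sum_sub_distrib,
      ← Finset.sum_mul]
    simp [Matrix.one_apply]
  have e2 : (confDiff D G f l * chr D G k) i j = D l f * chr D G k i j
      + (1 : Matrix ι ι R) i l * ∑ m, D m f * chr D G k m j
      - gradV D G f i * ∑ m, G l m * chr D G k m j := by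
    have : ∀ m, confDiff D G f l i m * chr D G k m j
        = D l f * ((1 : Matrix ι ι R) i m * chr D G k m j)
          + (1 : Matrix ι ι R) i l * (D m f * chr D G k m j)
          - gradV D G f i * (G l m * chr D G k m j) := fun m => by rw [confDiff_apply]; ring
    rw [Matrix.mul_apply]
    simp only [this, ← Finset.mul_sum, Finset.sum_add_distrib, Finset.sum_sub_distrib]
    simp [Matrix.one_apply]
  rw [← hess_eq hG hs, Matrix.sub_apply, Matrix.add_apply, e1, e2, matD_apply, confDiff_apply]
  simp only [map_sub, map_add, Derivation.leibniz, smul_eq_mul, hone, h2, covV]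
  ring

/-- If `e^{2f} G` is flat then the curvature of `G` is the Kulkarni-Nomizu product of `G` with
`∇ df - df ⊗ df + ½ |df|² G`. -/
lemma curv_of_conf_flat (hD : ∀ i j r, D i (D j r) = D j (D i r)) (hG : IsUnit G.det)
    (hs : Gᵀ = G) {w : R} (hwu : IsUnit w) (hw : ∀ k, D k w = w * D k f + w * D k f)
    (hflat : ∀ k l, curv D (chr D (w • G)) k l = 0) (k l i j : ι) :
    curv D (chr D G) k l i j =
      (1 : Matrix ι ι R) i k * (G * confSchouten D G f) j l
      - (1 : Matrix ι ι R) i l * (G * confSchouten D G f) j k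
      + confSchouten D G f i k * G l j - confSchouten D G f i l * G k j := by
  have hs' : ∀ i j, G i j = G j i := fun i j => congrFun (congrFun hs j) i
  have hwG : IsUnit (w • G).det := by
    rw [Matrix.det_smul]; exact (hwu.pow _).mul hG
  have h0 : curv D (fun k => chr D G k + confDiff D G f k) k l i j = 0 := by
    rw [(confDiff_isLC hG hs hw).eq_chr hwG, hflat]; rfl
  have hsplit : curv D (fun k => chr D G k + confDiff D G f k) k l
      = curv D (chr D G) k l
        + (matD (D k) (confDiff D G f l) + chr D G k * confDiff D G f l
          - confDiff D G f l * chr D G k)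
        - (matD (D l) (confDiff D G f k) + chr D G l * confDiff D G f k
          - confDiff D G f k * chr D G l)
        + confDiff D G f k * confDiff D G f l - confDiff D G f l * confDiff D G f k := by
    simp only [curv, matD_add, Matrix.add_mul, Matrix.mul_add]; abel
  rw [hsplit] at h0
  have ht := (chr_isLC D hG hs).torsion
  simp only [Matrix.sub_apply _ _ i j, Matrix.add_apply _ _ i j] at h0
  have c1 := cov_confDiff (D := D) (f := f) hG hs k l i j
  have c2 := cov_confDiff (D := D) (f := f) hG hs l k i j
  simp only [Matrix.sub_apply _ _ i j, Matrix.add_apply _ _ i j] at c1 c2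
  rw [c1, c2, confDiff_mul hG, confDiff_mul hG] at h0
  simp only [confDiff_apply, ht _ l k, hD l k, hs' l k] at h0
  rw [mul_confSchouten_apply hG, mul_confSchouten_apply hG]
  simp only [confSchouten, Matrix.of_apply]
  have hhalf : ∀ r : R, (1 / 2 : ℝ) • r + (1 / 2 : ℝ) • r = r := fun r => by
    rw [← add_smul]; norm_num
  have hN := hhalf (∑ m, D m f * gradV D G f m)
  rw [hs' l j, hs' k j] at h0 ⊢
  set N := ∑ m, D m f * gradV D G f m
  set N2 := (1 / 2 : ℝ) • N
  rw [← hN] at h0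
  linear_combination h0

lemma deriv_normSq_grad (hG : IsUnit G.det)
    (hs : Gᵀ = G) (k : ι) : D k (∑ m, D m f * gradV D G f m) =
      ∑ m, D m f * covV D (chr D G) (gradV D G f) m k
      + ∑ m, D m f * covV D (chr D G) (gradV D G f) m k := by
  have hs' : ∀ i j, G i j = G j i := fun i j => congrFun (congrFun hs j) i
  set u := gradV D G f
  have h1 : ∑ m, u m * D k (D m f) = ∑ m, u m * ∑ p, G m p * covV D (chr D G) u p k
      + ∑ m, u m * ∑ p, D p f * chr D G k p m := by
    rw [← Finset.sum_add_distrib]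
    refine Finset.sum_congr rfl fun m _ => ?_
    rw [← hess_eq hG hs]; ring
  have h2 : ∑ m, u m * ∑ p, G m p * covV D (chr D G) u p k
      = ∑ m, D m f * covV D (chr D G) u m k := by
    simp only [← mul_gradV (D := D) (f := f) hG, Finset.mul_sum, Finset.sum_mul]
    rw [Finset.sum_comm]
    refine Finset.sum_congr rfl fun m _ => Finset.sum_congr rfl fun p _ => ?_
    rw [hs' p m]; ring
  have h3 : ∑ m, D m f * ∑ p, chr D G k m p * u p = ∑ m, u m * ∑ p, D p f * chr D G k p m := by
    simp only [Finset.mul_sum]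
    rw [Finset.sum_comm]
    exact Finset.sum_congr rfl fun m _ => Finset.sum_congr rfl fun p _ => by ring
  simp only [map_sum, Derivation.leibniz, smul_eq_mul, Finset.sum_add_distrib]
  have h4 : ∑ m, D m f * covV D (chr D G) u m k = ∑ m, D m f * D k (u m)
      + ∑ m, D m f * ∑ p, chr D G k m p * u p := by
    simp only [covV, mul_add, Finset.sum_add_distrib]
  rw [h1, h2, ← h3]
  linear_combination -h4

/-- A metric conformal to a flat one satisfies the structure equations of a conformally flat
metric, in every dimension. -/
theorem isSchouten_confSchouten (hD : ∀ i j r, D i (D j r) = D j (D i r)) (hG : IsUnit G.det)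
    (hs : Gᵀ = G) {w : R} (hwu : IsUnit w) (hw : ∀ k, D k w = w * D k f + w * D k f)
    (hflat : ∀ k l, curv D (chr D (w • G)) k l = 0) :
    IsSchouten D G (chr D G) (confSchouten D G f) := by
  have hs' : ∀ i j, G i j = G j i := fun i j => congrFun (congrFun hs j) i
  have hcurv := curv_of_conf_flat hD hG hs hwu hw hflat
  refine ⟨?_, hcurv, fun i k l => ?_⟩
  · ext j l
    rw [Matrix.transpose_apply, mul_confSchouten_apply hG, mul_confSchouten_apply hG,
      hess_symm hD hG hs, hs' l j]
    ring
    -- The Codazzi equation: skew-symmetrize the derivative of `∇ grad f` by the Ricci identity for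
    -- `grad f`, and insert the curvature just found.
  · have hR := ricci_identity hD (chr D G) (gradV D G f) i k l
    have hone : ∀ p q, D k ((1 : Matrix ι ι R) p q) = 0 := fun p q =>
      congrFun (congrFun (matD_one (D k)) p) q
    have hone' : ∀ p q, D l ((1 : Matrix ι ι R) p q) = 0 := fun p q =>
      congrFun (congrFun (matD_one (D l)) p) q
    have hGa : ∀ l, ∑ m, (G * confSchouten D G f) m l * gradV D G f m
        = ∑ m, D m f * covV D (chr D G) (gradV D G f) m l
          - (∑ m, D m f * gradV D G f m) * D l f
          + (1 / 2 : ℝ) • (∑ m, D m f * gradV D G f m) * D l f := by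
      intro l
      have h1 : ∑ m, (G * confSchouten D G f) m l * gradV D G f m
          = ∑ p, D p f * confSchouten D G f p l := by
        simp only [← mul_gradV (D := D) (f := f) hG, Finset.sum_mul, Matrix.mul_apply]
        rw [Finset.sum_comm]
        refine Finset.sum_congr rfl fun m _ => Finset.sum_congr rfl fun p _ => ?_
        rw [hs' p m]; ring
      rw [h1]
      simp only [confSchouten, Matrix.of_apply, mul_add, mul_sub, Finset.sum_add_distrib,
        Finset.sum_sub_distrib, Finset.sum_mul]
      congr 1
      · congr 1
        exact Finset.sum_congr rfl fun m _ => by ring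
      · simp [Matrix.one_apply]; ring
    have hGu : ∀ l, ∑ m, G l m * gradV D G f m = D l f := fun l => mul_gradV hG l
    have hF : ∑ m, curv D (chr D G) k l i m * gradV D G f m =
        (1 : Matrix ι ι R) i k * (∑ m, (G * confSchouten D G f) m l * gradV D G f m)
        - (1 : Matrix ι ι R) i l * (∑ m, (G * confSchouten D G f) m k * gradV D G f m)
        + confSchouten D G f i k * D l f - confSchouten D G f i l * D k f := by
      rw [← hGu l, ← hGu k]
      simp only [hcurv, Finset.mul_sum, ← Finset.sum_add_distrib, ← Finset.sum_sub_distrib]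
      exact Finset.sum_congr rfl fun m _ => by ring
    rw [hF, hGa, hGa] at hR
    have hΓ : ∀ k l, (chr D G k * confSchouten D G f) i l
        = ∑ m, chr D G k i m * covV D (chr D G) (gradV D G f) m l
          - (∑ m, chr D G k i m * gradV D G f m) * D l f
          + (1 / 2 : ℝ) • (∑ m, D m f * gradV D G f m) * chr D G k i l := by
      intro k l
      rw [Matrix.mul_apply]
      simp only [confSchouten, Matrix.of_apply, mul_add, mul_sub, Finset.sum_add_distrib,
        Finset.sum_sub_distrib, Finset.sum_mul]
      congr 1
      · congr 1
        exact Finset.sum_congr rfl fun m _ => by ring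
      · simp [Matrix.one_apply]; ring
    have hv : ∀ k, covV D (chr D G) (gradV D G f) i k
        = D k (gradV D G f i) + ∑ m, chr D G k i m * gradV D G f m := fun k => rfl
    have hvk := hv k
    have hvl := hv l
    rw [hΓ, hΓ]
    simp only [confSchouten, Matrix.of_apply] at hR ⊢
    simp only [map_add, map_sub, Derivation.leibniz, smul_eq_mul, Derivation.map_smul, hone, hone',
      deriv_normSq_grad hG hs, hD l k, (chr_isLC D hG hs).torsion i l k] at hR ⊢
    have hhalf : ∀ r : R, (1 / 2 : ℝ) • (r + r) = r := fun r => by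
      rw [smul_add, ← add_smul]; norm_num
    have hN : (1 / 2 : ℝ) • (∑ m, D m f * gradV D G f m)
        + (1 / 2 : ℝ) • (∑ m, D m f * gradV D G f m) = ∑ m, D m f * gradV D G f m := by
      rw [← add_smul]; norm_num
    simp only [hhalf]
    set N := ∑ m, D m f * gradV D G f m
    set N2 := (1 / 2 : ℝ) • N
    rw [← hN] at hR
    linear_combination hR + D l f * hvk - D k f * hvl

lemma IsSchouten.ric_eq {Γ : ι → Matrix ι ι R} {a : Matrix ι ι R} (h : IsSchouten D G Γ a)
    (hs : Gᵀ = G) : ric D Γ = ((Fintype.card ι : R) - 2) • (G * a) + a.trace • G := by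
  have hs' : ∀ i j, G i j = G j i := fun i j => congrFun (congrFun hs j) i
  have hsa : ∀ i j, (G * a) i j = (G * a) j i := fun i j => congrFun (congrFun h.symm j) i
  ext j l
  have e1 : ∑ i, a i l * G i j = (G * a) j l := by
    rw [Matrix.mul_apply]
    exact Finset.sum_congr rfl fun i _ => by rw [hs' i j]; ring
  have e2 : ∑ i, (1 : Matrix ι ι R) i l * (G * a) j i = (G * a) j l := by simp [Matrix.one_apply]
  simp only [ric, Matrix.of_apply, h.curvature, Finset.sum_add_distrib, Finset.sum_sub_distrib, e1,
    e2, ← Finset.sum_mul, Matrix.one_apply_eq]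
  simp [Matrix.trace, hs' l j]
  ring

end ConformallyFlat

/-! ### The hyperbolic metric over a conformally flat metric -/

section Hyperbolic

variable {R ι : Type*} [CommRing R] [Algebra ℝ R] [DecidableEq ι]

/-- The endomorphism `1 - x² a / 2`. -/
def hypA (x : R) (a : Matrix ι ι R) : Matrix ι ι R :=
  1 - (algebraMap ℝ R (1 / 2) * x * x) • a

/-- The endomorphism `-x⁻¹ - x a / 2`, where `xi` stands for `x⁻¹`. It equals
`x ∂_x (x⁻¹ (1 - x² a / 2))`, which makes `hypOmega` torsion-free. -/
def hypB (x xi : R) (a : Matrix ι ι R) : Matrix ι ι R :=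
  -(xi • 1) - (algebraMap ℝ R (1 / 2) * x) • a

lemma derivation_one_apply (d : Derivation ℝ R R) (i j : ι) : d ((1 : Matrix ι ι R) i j) = 0 :=
  congrFun (congrFun (matD_one d) i) j

lemma hypA_apply {x : R} {a : Matrix ι ι R} (i j : ι) :
    hypA x a i j = (1 : Matrix ι ι R) i j - algebraMap ℝ R (1 / 2) * x * x * a i j := by
  simp [hypA]

lemma hypB_apply {x xi : R} {a : Matrix ι ι R} (i j : ι) :
    hypB x xi a i j = -(xi * (1 : Matrix ι ι R) i j) - algebraMap ℝ R (1 / 2) * x * a i j := by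
  simp [hypB]

lemma algebraMap_half_add : algebraMap ℝ R (1 / 2) + algebraMap ℝ R (1 / 2) = 1 := by
  rw [← map_add, ← map_one (algebraMap ℝ R)]; norm_num

lemma deriv_xinv {x xi : R} (d : Derivation ℝ R R) (hx : x * xi = 1) : d xi = -(xi * xi * d x) := by
  have h : d (x * xi) = 0 := by rw [hx]; simp
  rw [Derivation.leibniz, smul_eq_mul, smul_eq_mul] at h
  linear_combination xi * h - d xi * hx

lemma deriv_hypA {x : R} {a : Matrix ι ι R} (d : Derivation ℝ R R) (i j : ι) :
    d (hypA x a i j) = -(x * d x * a i j) - algebraMap ℝ R (1 / 2) * x * x * d (a i j) := by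
  rw [hypA_apply]
  simp only [map_sub, derivation_one_apply, Derivation.leibniz, smul_eq_mul,
    Derivation.map_algebraMap]
  linear_combination -(x * d x * a i j) * algebraMap_half_add (R := R)

lemma deriv_hypB {x xi : R} {a : Matrix ι ι R} (d : Derivation ℝ R R) (hx : x * xi = 1) (i j : ι) :
    d (hypB x xi a i j) = xi * xi * d x * (1 : Matrix ι ι R) i j
      - algebraMap ℝ R (1 / 2) * d x * a i j - algebraMap ℝ R (1 / 2) * x * d (a i j) := by
  rw [hypB_apply]
  simp only [map_sub, map_neg, derivation_one_apply, Derivation.leibniz, smul_eq_mul,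
    Derivation.map_algebraMap, deriv_xinv d hx]
  ring

/-- The frame `x⁻¹ (A ⊕ dx)` with `A = 1 - x² a / 2`. -/
def hypE (x xi : R) (a : Matrix ι ι R) : Matrix (ι ⊕ Unit) (ι ⊕ Unit) R :=
  xi • Matrix.fromBlocks (hypA x a) 0 0 1

/-- The components `G ⊕ 1` of the hyperbolic metric in the frame `hypE`. -/
def hypEta (G : Matrix ι ι R) : Matrix (ι ⊕ Unit) (ι ⊕ Unit) R := Matrix.fromBlocks G 0 0 1

variable [Fintype ι]

/-- The connection matrices of the hyperbolic metric in the frame `hypE`. -/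
def hypOmega (x xi : R) (G : Matrix ι ι R) (Γ : ι → Matrix ι ι R) (a : Matrix ι ι R) :
    ι ⊕ Unit → Matrix (ι ⊕ Unit) (ι ⊕ Unit) R :=
  Sum.elim (fun k => Matrix.fromBlocks (Γ k) (Matrix.of fun i _ => hypB x xi a i k)
    (Matrix.of fun _ j => -(G * hypB x xi a) j k) 0) (fun _ => 0)

variable {Dp : ι ⊕ Unit → Derivation ℝ R R} {x xi : R} {G : Matrix ι ι R} {Γ : ι → Matrix ι ι R}
  {a : Matrix ι ι R}

lemma mul_hypA_apply (M : Matrix ι ι R) (i j : ι) :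
    (M * hypA x a) i j = M i j - algebraMap ℝ R (1 / 2) * x * x * (M * a) i j := by
  simp [hypA, Matrix.mul_sub]

lemma mul_hypB_apply (M : Matrix ι ι R) (i j : ι) :
    (M * hypB x xi a) i j = -(xi * M i j) - algebraMap ℝ R (1 / 2) * x * (M * a) i j := by
  simp [hypB, Matrix.mul_sub]

lemma transpose_hypA_mul (h : (G * a)ᵀ = G * a) (hs : Gᵀ = G) :
    (hypA x a)ᵀ * G = G * hypA x a := by
  rw [Matrix.transpose_mul, hs] at h
  simp only [hypA, Matrix.transpose_sub, Matrix.transpose_smul, Matrix.transpose_one,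
    Matrix.sub_mul, Matrix.mul_sub, Matrix.smul_mul, Matrix.mul_smul, h, Matrix.one_mul,
    Matrix.mul_one]

lemma transpose_hypB_mul (h : (G * a)ᵀ = G * a) (hs : Gᵀ = G) :
    (hypB x xi a)ᵀ * G = G * hypB x xi a := by
  rw [Matrix.transpose_mul, hs] at h
  simp only [hypB, Matrix.transpose_sub, Matrix.transpose_smul, Matrix.transpose_one,
    Matrix.sub_mul, Matrix.mul_sub, Matrix.smul_mul, Matrix.mul_smul, h, Matrix.one_mul,
    Matrix.mul_one, Matrix.transpose_neg, Matrix.neg_mul, Matrix.mul_neg]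

lemma hypA_comm_hypB : hypA x a * hypB x xi a = hypB x xi a * hypA x a := by
  simp only [hypA, hypB, Matrix.sub_mul, Matrix.mul_sub, Matrix.smul_mul, Matrix.mul_smul,
    Matrix.one_mul, Matrix.mul_one, Matrix.neg_mul, Matrix.mul_neg, smul_sub, smul_neg, smul_smul]
  ext i j
  simp
  ring

lemma hypE_gram (h : (G * a)ᵀ = G * a) (hs : Gᵀ = G) :
    (hypE x xi a)ᵀ * hypEta G * hypE x xi a
      = (xi * xi) • Matrix.fromBlocks (G * hypA x a * hypA x a) 0 0 1 := by
  simp only [hypE, hypEta, Matrix.transpose_smul, Matrix.fromBlocks_transpose, Matrix.smul_mul,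
    Matrix.mul_smul, Matrix.fromBlocks_multiply, Matrix.transpose_zero, Matrix.transpose_one,
    Matrix.mul_zero, Matrix.zero_mul, Matrix.mul_one, add_zero, zero_add, smul_smul,
    transpose_hypA_mul h hs]

/-- The connection matrices preserve the metric. -/
lemma hypOmega_compat (hLC : IsLC (fun i => Dp (Sum.inl i)) G Γ)
    (hGx : matD (Dp (Sum.inr ())) G = 0) (k : ι ⊕ Unit) :
    matD (Dp k) (hypEta G)
      = hypEta G * hypOmega x xi G Γ a k + (hypEta G * hypOmega x xi G Γ a k)ᵀ := by
  rcases k with k | ⟨⟩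
  · simp only [hypEta, matD_fromBlocks, hLC.compat k, hypOmega, Sum.elim_inl,
      Matrix.fromBlocks_multiply, Matrix.fromBlocks_transpose, Matrix.fromBlocks_add, matD_zero,
      matD_one, Matrix.zero_mul, Matrix.mul_zero, add_zero, zero_add, Matrix.one_mul]
    congr 1
    · ext i j
      simp [Matrix.mul_apply]
    · ext i j
      simp [Matrix.mul_apply, mul_comm]
  · simp [hypEta, hypOmega, matD_fromBlocks, hGx]

lemma hypOmega_torsion (hx : x * xi = 1) (hxx : Dp (Sum.inr ()) x = 1)
    (hxi : ∀ i, Dp (Sum.inl i) x = 0) (hs : Gᵀ = G)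
    (hLC : IsLC (fun i => Dp (Sum.inl i)) G Γ) (ha : IsSchouten (fun i => Dp (Sum.inl i)) G Γ a)
    (hax : matD (Dp (Sum.inr ())) a = 0) (i j k : ι ⊕ Unit) :
    (hypOmega x xi G Γ a k * hypE x xi a + matD (Dp k) (hypE x xi a)) i j
      = (hypOmega x xi G Γ a j * hypE x xi a + matD (Dp j) (hypE x xi a)) i k := by
  have hax' : ∀ i j, Dp (Sum.inr ()) (a i j) = 0 := fun i j => congrFun (congrFun hax i) j
  have hxik : ∀ k, Dp (Sum.inl k) xi = 0 := fun k => by rw [deriv_xinv _ hx, hxi]; simp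
  have hxix : Dp (Sum.inr ()) xi = -(xi * xi) := by rw [deriv_xinv _ hx, hxx]; simp
  -- the only case with `j` and `k` of different kinds
  have key : ∀ (i : ι ⊕ Unit) (k : ι),
      (hypOmega x xi G Γ a (Sum.inl k) * hypE x xi a
        + matD (Dp (Sum.inl k)) (hypE x xi a)) i (Sum.inr ())
      = (hypOmega x xi G Γ a (Sum.inr ()) * hypE x xi a
        + matD (Dp (Sum.inr ())) (hypE x xi a)) i (Sum.inl k) := by
    intro i k
    rcases i with i | ⟨⟩
    · simp only [hypE, hypOmega, Sum.elim_inl, Sum.elim_inr, Matrix.mul_smul,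
        Matrix.fromBlocks_multiply, Matrix.add_apply, Matrix.smul_apply, Matrix.fromBlocks_apply₁₂,
        matD_apply, Matrix.zero_mul, Matrix.fromBlocks_apply₁₁, smul_eq_mul, Matrix.mul_zero,
        Matrix.mul_one, Matrix.of_apply, Matrix.zero_apply, Derivation.leibniz, hxix, deriv_hypA,
        hax', hxx, map_zero, mul_zero, zero_add, add_zero]
      have h2 := algebraMap_half_add (R := R)
      rw [hypA_apply, hypB_apply]
      linear_combination -(a i k * algebraMap ℝ R (1 / 2) * x * xi) * hx - a i k * x * xi * h2
    · simp [hypE, hypOmega, Matrix.fromBlocks_multiply, hxik]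
  rcases j with j | ⟨⟩ <;> rcases k with k | ⟨⟩
  · rcases i with i | ⟨⟩
    · simp only [hypE, hypOmega, Sum.elim_inl, Matrix.mul_smul,
        Matrix.fromBlocks_multiply, Matrix.add_apply, Matrix.smul_apply,
        matD_apply, Matrix.fromBlocks_apply₁₁, smul_eq_mul, Matrix.mul_zero,
        Derivation.leibniz, hxik, deriv_hypA, mul_hypA_apply,
        hxi, mul_zero, add_zero]
      have h1 := ha.codazzi i k j
      have h2 := hLC.torsion i j k
      linear_combination xi * h2 - xi * (algebraMap ℝ R (1 / 2) * x * x) * h1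
    · have h1 : ∀ j k, ((Matrix.of fun (_ : Unit) j => -(G * hypB x xi a) j k) * hypA x a) () j
          = -(G * hypB x xi a * hypA x a) k j := by
        intro j k
        rw [← transpose_hypB_mul ha.symm hs, Matrix.mul_apply, Matrix.mul_apply,
          ← Finset.sum_neg_distrib]
        refine Finset.sum_congr rfl fun m _ => ?_
        rw [Matrix.of_apply, ← Matrix.transpose_apply (_ * G), Matrix.transpose_mul, hs,
          Matrix.transpose_transpose, transpose_hypB_mul ha.symm hs, neg_mul]
      have h2 : (G * hypB x xi a * hypA x a)ᵀ = G * hypB x xi a * hypA x a := by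
        rw [Matrix.transpose_mul, Matrix.transpose_mul, hs, transpose_hypB_mul ha.symm hs,
          ← Matrix.mul_assoc, transpose_hypA_mul ha.symm hs, Matrix.mul_assoc, hypA_comm_hypB,
          ← Matrix.mul_assoc]
      simp only [hypE, hypOmega, Sum.elim_inl, Matrix.mul_smul,
        Matrix.fromBlocks_multiply, Matrix.add_apply, Matrix.smul_apply,
        matD_apply, Matrix.fromBlocks_apply₂₁, smul_eq_mul, Matrix.mul_zero,
        Matrix.zero_apply, mul_zero, map_zero, add_zero, h1]
      rw [← h2, Matrix.transpose_apply, h2]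
  · exact (key i j).symm
  · exact key i k
  · rfl

/-- In the frame `hypE` the curvature is that of constant sectional curvature `-1`. -/
lemma hypOmega_curv (hx : x * xi = 1) (hxx : Dp (Sum.inr ()) x = 1)
    (hxi : ∀ i, Dp (Sum.inl i) x = 0) (hs : Gᵀ = G)
    (hLC : IsLC (fun i => Dp (Sum.inl i)) G Γ) (ha : IsSchouten (fun i => Dp (Sum.inl i)) G Γ a)
    (hax : matD (Dp (Sum.inr ())) a = 0) (hGx : matD (Dp (Sum.inr ())) G = 0)
    (hΓx : ∀ k, matD (Dp (Sum.inr ())) (Γ k) = 0) (C F P Q : ι ⊕ Unit) :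
    curv Dp (hypOmega x xi G Γ a) C F P Q
      = -(hypE x xi a P C * (hypEta G * hypE x xi a) Q F
        - hypE x xi a P F * (hypEta G * hypE x xi a) Q C) := by
  have hs' : ∀ i j, G i j = G j i := fun i j => congrFun (congrFun hs j) i
  have hax' : ∀ i j, Dp (Sum.inr ()) (a i j) = 0 := fun i j => congrFun (congrFun hax i) j
  have hGx' : ∀ i j, Dp (Sum.inr ()) (G i j) = 0 := fun i j => congrFun (congrFun hGx i) j
  have hΓx' : ∀ k i j, Dp (Sum.inr ()) (Γ k i j) = 0 := fun k i j =>
    congrFun (congrFun (hΓx k) i) j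
  have h2 := algebraMap_half_add (R := R)
  have hE : hypEta G * hypE x xi a = xi • Matrix.fromBlocks (G * hypA x a) 0 0 1 := by
    simp [hypE, hypEta, Matrix.fromBlocks_multiply]
  -- the Codazzi equation for `hypB`
  have hBC : ∀ i k l, Dp (Sum.inl k) (hypB x xi a i l) + (Γ k * hypB x xi a) i l
      = Dp (Sum.inl l) (hypB x xi a i k) + (Γ l * hypB x xi a) i k := by
    intro i k l
    rw [deriv_hypB _ hx, deriv_hypB _ hx, mul_hypB_apply, mul_hypB_apply, hxi, hxi]
    linear_combination -xi * hLC.torsion i l k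
      - algebraMap ℝ R (1 / 2) * x * ha.codazzi i k l
  rw [hE]
  have key : ∀ (P Q : ι ⊕ Unit) (l : ι), curv Dp (hypOmega x xi G Γ a) (Sum.inr ()) (Sum.inl l) P Q
      = -(hypE x xi a P (Sum.inr ())
            * (xi • Matrix.fromBlocks (G * hypA x a) 0 0 1 : Matrix (ι ⊕ Unit) (ι ⊕ Unit) R)
              Q (Sum.inl l)
        - hypE x xi a P (Sum.inl l)
            * (xi • Matrix.fromBlocks (G * hypA x a) 0 0 1 : Matrix (ι ⊕ Unit) (ι ⊕ Unit) R)
              Q (Sum.inr ())) := by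
    intro P Q l
    have hc : curv Dp (hypOmega x xi G Γ a) (Sum.inr ()) (Sum.inl l)
        = matD (Dp (Sum.inr ())) (hypOmega x xi G Γ a (Sum.inl l)) := by
      simp [curv, hypOmega]
    rw [hc, matD_apply]
    rcases P with i | ⟨⟩ <;> rcases Q with j | ⟨⟩
    · simp [hypOmega, hypE, hΓx']
    · simp only [hypOmega, Sum.elim_inl, Matrix.fromBlocks_apply₁₂, Matrix.of_apply, hypE,
        Matrix.smul_apply, Matrix.fromBlocks_apply₁₁, Matrix.fromBlocks_apply₂₂, smul_eq_mul,
        Matrix.zero_apply, Matrix.fromBlocks_apply₂₁, Matrix.one_apply_eq]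
      rw [deriv_hypB _ hx, hxx, hax', hypA_apply]
      linear_combination (a i l) * (algebraMap ℝ R (1 / 2)) * (x * xi + 1) * hx
    · simp only [hypOmega, Sum.elim_inl, Matrix.fromBlocks_apply₂₁, Matrix.of_apply, hypE,
        Matrix.smul_apply, Matrix.fromBlocks_apply₁₁, Matrix.fromBlocks_apply₂₂, smul_eq_mul,
        Matrix.zero_apply, Matrix.one_apply_eq]
      have h3 : Dp (Sum.inr ()) ((G * hypB x xi a) j l)
          = xi * xi * G j l - algebraMap ℝ R (1 / 2) * (G * a) j l := by
        rw [Matrix.mul_apply, map_sum]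
        simp only [Derivation.leibniz, hGx', deriv_hypB _ hx, hxx, hax', smul_eq_mul, mul_zero,
          mul_one, add_zero, sub_zero, mul_sub, Finset.sum_sub_distrib]
        rw [Matrix.mul_apply, Finset.mul_sum]
        congr 1
        · simp [Matrix.one_apply]; ring
        · exact Finset.sum_congr rfl fun m _ => by ring
      rw [map_neg, h3, mul_hypA_apply]
      linear_combination -((G * a) j l) * (algebraMap ℝ R (1 / 2)) * (x * xi + 1) * hx
    · simp [hypOmega, hypE]
  rcases C with k | ⟨⟩ <;> rcases F with l | ⟨⟩
  · rcases P with i | ⟨⟩ <;> rcases Q with j | ⟨⟩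
    · have h3 : curv Dp (hypOmega x xi G Γ a) (Sum.inl k) (Sum.inl l) (Sum.inl i) (Sum.inl j)
          = curv (fun i => Dp (Sum.inl i)) Γ k l i j
            - hypB x xi a i k * (G * hypB x xi a) j l
            + hypB x xi a i l * (G * hypB x xi a) j k := by
        simp [curv, hypOmega, Matrix.fromBlocks_multiply, matD_fromBlocks,
          Matrix.mul_apply (N := (Matrix.of fun (_ : Unit) _ => _))]
        ring
      rw [h3, ha.curvature]
      simp only [hypE, Matrix.smul_apply, Matrix.fromBlocks_apply₁₁, smul_eq_mul]
      rw [mul_hypB_apply, mul_hypB_apply, mul_hypA_apply, mul_hypA_apply, hypA_apply, hypA_apply,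
        hypB_apply, hypB_apply, hs' l j, hs' k j]
      set c := algebraMap ℝ R (1 / 2)
      linear_combination
        (c * c * x * x * (x * xi + 1) * (a i k * (G * a) j l - a i l * (G * a) j k)
          - c * (x * xi + 2) * ((1 : Matrix ι ι R) i k * (G * a) j l + a i k * G j l
            - (1 : Matrix ι ι R) i l * (G * a) j k - a i l * G j k)) * hx
        - ((1 : Matrix ι ι R) i k * (G * a) j l + a i k * G j l
            - (1 : Matrix ι ι R) i l * (G * a) j k - a i l * G j k) * h2
    · have h3 : curv Dp (hypOmega x xi G Γ a) (Sum.inl k) (Sum.inl l) (Sum.inl i) (Sum.inr ())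
          = (Dp (Sum.inl k) (hypB x xi a i l) + (Γ k * hypB x xi a) i l)
            - (Dp (Sum.inl l) (hypB x xi a i k) + (Γ l * hypB x xi a) i k) := by
        simp [curv, hypOmega, Matrix.fromBlocks_multiply, matD_fromBlocks, Matrix.mul_apply]
        ring
      rw [h3, hBC]
      simp [hypE]
    · have h3 : curv Dp (hypOmega x xi G Γ a) (Sum.inl k) (Sum.inl l) (Sum.inr ()) (Sum.inl j)
          = (-Dp (Sum.inl k) ((G * hypB x xi a) j l) + ∑ m, (G * hypB x xi a) m l * Γ k m j)
            - (-Dp (Sum.inl l) ((G * hypB x xi a) j k)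
              + ∑ m, (G * hypB x xi a) m k * Γ l m j) := by
        simp [curv, hypOmega, Matrix.fromBlocks_multiply, matD_fromBlocks,
          Matrix.mul_apply (M := (Matrix.of fun (_ : Unit) _ => _))]
        ring
      have h4 : ∀ k l, Dp (Sum.inl k) ((G * hypB x xi a) j l)
          = (G * (matD (Dp (Sum.inl k)) (hypB x xi a) + Γ k * hypB x xi a)) j l
            + ∑ m, (G * hypB x xi a) m l * Γ k m j := by
        intro k l
        have e1 : Dp (Sum.inl k) ((G * hypB x xi a) j l)
            = matD (Dp (Sum.inl k)) (G * hypB x xi a) j l := rfl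
        have e2 : ∑ m, (G * hypB x xi a) m l * Γ k m j
            = ((Γ k)ᵀ * (G * hypB x xi a)) j l := by
          rw [Matrix.mul_apply]
          exact Finset.sum_congr rfl fun m _ => by rw [Matrix.transpose_apply, mul_comm]
        have e3 : matD (Dp (Sum.inl k)) (G * hypB x xi a)
            = G * (matD (Dp (Sum.inl k)) (hypB x xi a) + Γ k * hypB x xi a)
              + (Γ k)ᵀ * (G * hypB x xi a) := by
          rw [matD_mul, hLC.compat]
          simp only [Matrix.transpose_mul, hs, Matrix.add_mul, Matrix.mul_add, Matrix.mul_assoc]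
          abel
        rw [e1, e2, e3, Matrix.add_apply]
      have h5 : (G * (matD (Dp (Sum.inl k)) (hypB x xi a) + Γ k * hypB x xi a)) j l
          = (G * (matD (Dp (Sum.inl l)) (hypB x xi a) + Γ l * hypB x xi a)) j k := by
        rw [Matrix.mul_apply, Matrix.mul_apply]
        refine Finset.sum_congr rfl fun m _ => ?_
        rw [Matrix.add_apply, Matrix.add_apply, matD_apply, matD_apply, hBC]
      rw [h3, h4, h4, h5]
      simp [hypE]
    · have h3 : curv Dp (hypOmega x xi G Γ a) (Sum.inl k) (Sum.inl l) (Sum.inr ()) (Sum.inr ())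
          = -∑ m, (G * hypB x xi a) m k * hypB x xi a m l
            + ∑ m, (G * hypB x xi a) m l * hypB x xi a m k := by
        simp [curv, hypOmega, Matrix.fromBlocks_multiply, matD_fromBlocks, Matrix.mul_apply]
      have h4 : ∀ k l, ∑ m, (G * hypB x xi a) m k * hypB x xi a m l
          = ((hypB x xi a)ᵀ * G * hypB x xi a) k l := by
        intro k l
        rw [Matrix.mul_apply]
        refine Finset.sum_congr rfl fun m _ => ?_
        rw [← transpose_hypB_mul ha.symm hs, ← Matrix.transpose_apply (_ * G),
          Matrix.transpose_mul, hs, Matrix.transpose_transpose, transpose_hypB_mul ha.symm hs]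
      have h5 : ((hypB x xi a)ᵀ * G * hypB x xi a)ᵀ = (hypB x xi a)ᵀ * G * hypB x xi a := by
        rw [Matrix.transpose_mul, Matrix.transpose_mul, Matrix.transpose_transpose, hs,
          ← Matrix.mul_assoc]
      rw [h3, h4, h4, ← h5, Matrix.transpose_apply, h5]
      simp [hypE]
  · rw [curv_swap, Matrix.neg_apply, key]; ring
  · exact key P Q l
  · rw [curv_self, Matrix.zero_apply]; ring

/-- The hyperbolic metric over a conformally flat metric: for
`g_x = G (1 - x² a / 2)²`, the metric `x⁻² (dx² + g_x)` has constant sectional curvature `-1`. Its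
curvature is computed in the frame `hypE`, whose connection matrices are `hypOmega`. -/
theorem hyp_riemann (hD : ∀ i j r, Dp i (Dp j r) = Dp j (Dp i r))
    (hx : x * xi = 1) (hxx : Dp (Sum.inr ()) x = 1)
    (hxi : ∀ i, Dp (Sum.inl i) x = 0) (hG : IsUnit G.det) (hs : Gᵀ = G)
    (hLC : IsLC (fun i => Dp (Sum.inl i)) G Γ) (ha : IsSchouten (fun i => Dp (Sum.inl i)) G Γ a)
    (hax : matD (Dp (Sum.inr ())) a = 0) (hGx : matD (Dp (Sum.inr ())) G = 0)
    (hΓx : ∀ k, matD (Dp (Sum.inr ())) (Γ k) = 0) (hA : IsUnit (hypA x a).det)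
    {gp : Matrix (ι ⊕ Unit) (ι ⊕ Unit) R}
    (hgp : gp = (xi * xi) • Matrix.fromBlocks (G * hypA x a * hypA x a) 0 0 1)
    (P Q C F : ι ⊕ Unit) :
    (gp * curv Dp (chr Dp gp) C F) P Q = -(gp P C * gp Q F - gp P F * gp Q C) := by
  have hxiu : IsUnit xi := IsUnit.of_mul_eq_one x (by rw [mul_comm, hx])
  have hE : IsUnit (hypE x xi a).det := by
    rw [hypE, Matrix.det_smul, Matrix.det_fromBlocks_zero₂₁, Matrix.det_one, mul_one]
    exact (hxiu.pow _).mul hA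
  have hη : (hypEta G)ᵀ = hypEta G := by simp [hypEta, Matrix.fromBlocks_transpose, hs]
  have hgp' : gp = (hypE x xi a)ᵀ * hypEta G * hypE x xi a := by
    rw [hgp, hypE_gram ha.symm hs]
  have hgpu : IsUnit gp.det := by
    rw [hgp', Matrix.det_mul, Matrix.det_mul, Matrix.det_transpose, hypEta,
      Matrix.det_fromBlocks_zero₂₁, Matrix.det_one, mul_one]
    exact (hE.mul hG).mul hE
  have hlc := isLC_of_frame hE hη (hypOmega_compat (a := a) (x := x) (xi := xi) hLC hGx)
    (hypOmega_torsion hx hxx hxi hs hLC ha hax)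
  rw [← hgp'] at hlc
  rw [← hlc.eq_chr hgpu, curv_gauge hD hE, hgp']
  have h1 : ∀ X, (hypE x xi a)ᵀ * hypEta G * hypE x xi a * ((hypE x xi a)⁻¹ * X * hypE x xi a)
      = (hypEta G * hypE x xi a)ᵀ * X * hypE x xi a := by
    intro X
    rw [Matrix.transpose_mul, hη]
    simp only [Matrix.mul_assoc]
    rw [← Matrix.mul_assoc (hypE x xi a) (hypE x xi a)⁻¹, Matrix.mul_nonsing_inv _ hE,
      Matrix.one_mul]
  have h2 : ∀ P C, ((hypE x xi a)ᵀ * hypEta G * hypE x xi a) P C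
      = ∑ m, (hypEta G * hypE x xi a) m P * hypE x xi a m C := by
    intro P C
    rw [← hη, ← Matrix.transpose_mul, hη]; rfl
  have h2' : ∀ P C, ((hypE x xi a)ᵀ * hypEta G * hypE x xi a) P C
      = ∑ m, (hypEta G * hypE x xi a) m C * hypE x xi a m P := by
    intro P C
    rw [Matrix.mul_assoc, Matrix.mul_apply]
    exact Finset.sum_congr rfl fun m _ => by rw [Matrix.transpose_apply, mul_comm]
  rw [h1, h2 P C, h2 P F, h2' Q C, h2' Q F, Matrix.mul_apply]
  simp only [Matrix.mul_apply (M := (hypEta G * hypE x xi a)ᵀ), Matrix.transpose_apply,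
    hypOmega_curv hx hxx hxi hs hLC ha hax hGx hΓx, Finset.sum_mul, Finset.mul_sum]
  rw [← Finset.sum_sub_distrib, ← Finset.sum_neg_distrib]
  refine Finset.sum_congr rfl fun m _ => ?_
  rw [← Finset.sum_sub_distrib, ← Finset.sum_neg_distrib]
  exact Finset.sum_congr rfl fun m' _ => by ring

end Hyperbolic

/-! ### The Einstein tensor of `x⁻² (dx² + g_x)` -/

section NormalForm

variable {R ι : Type*} [CommRing R] [Algebra ℝ R]

/-- The Euler operator `θ = x ∂_x`, entrywise on matrices. -/
def theta (x : R) (d : Derivation ℝ R R) (M : Matrix ι ι R) : Matrix ι ι R := x • matD d M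

lemma theta_theta {x : R} (d : Derivation ℝ R R) (hd : d x = 1) (M : Matrix ι ι R) :
    theta x d (theta x d M) = theta x d M + (x * x) • matD d (matD d M) := by
  simp only [theta, matD_smul, hd, one_smul, smul_add, smul_smul]

variable [Fintype ι] [DecidableEq ι]

/-- The tangential components of `-2 x² (Ric(g₊) + n g₊)`, where `g₊ = x⁻² (dx² + g)` and `ρ` is
the Ricci tensor of the slices. -/
def einTan (x : R) (d : Derivation ℝ R R) (g ρ : Matrix ι ι R) : Matrix ι ι R :=
  theta x d (theta x d g) - (Fintype.card ι : R) • theta x d g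
    - (g⁻¹ * theta x d g).trace • g - theta x d g * (g⁻¹ * theta x d g)
    + (algebraMap ℝ R (1 / 2) * (g⁻¹ * theta x d g).trace) • theta x d g - (2 * x * x) • ρ

/-- The `dx²` component of `-2 x² (Ric(g₊) + n g₊)`, where `g₊ = x⁻² (dx² + g)`. -/
def einNor (x : R) (d : Derivation ℝ R R) (g : Matrix ι ι R) : R :=
  (g⁻¹ * theta x d (theta x d g)).trace
    - algebraMap ℝ R (1 / 2) * (g⁻¹ * theta x d g * (g⁻¹ * theta x d g)).trace
    - 2 * (g⁻¹ * theta x d g).trace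

/-- The components `-2 x² (R^x_{jxl} + g₊_{jl})` of the deviation of `g₊ = x⁻² (dx² + g)` from
constant sectional curvature `-1`. -/
def radialDefect (x : R) (d : Derivation ℝ R R) (g : Matrix ι ι R) : Matrix ι ι R :=
  theta x d (theta x d g) - (2 : R) • theta x d g
    - algebraMap ℝ R (1 / 2) • (theta x d g * (g⁻¹ * theta x d g))

/-- The mixed components `½ g⁻¹ ∂_x g - x⁻¹` of the connection of `x⁻² (dx² + g)`. -/
def normalBeta (xi : R) (d : Derivation ℝ R R) (g : Matrix ι ι R) : Matrix ι ι R :=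
  algebraMap ℝ R (1 / 2) • (g⁻¹ * matD d g) - xi • 1

/-- The Levi-Civita connection of `x⁻² (dx² + g)`, where `Γ` is that of the slices. -/
def normalConn (xi : R) (d : Derivation ℝ R R) (g : Matrix ι ι R) (Γ : ι → Matrix ι ι R) :
    ι ⊕ Unit → Matrix (ι ⊕ Unit) (ι ⊕ Unit) R :=
  Sum.elim (fun k => Matrix.fromBlocks (Γ k) (Matrix.of fun i _ => normalBeta xi d g i k)
    (Matrix.of fun _ j => -(g * normalBeta xi d g) j k) 0)
    (fun _ => Matrix.fromBlocks (normalBeta xi d g) 0 0 (-(xi • 1)))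

variable {Dp : ι ⊕ Unit → Derivation ℝ R R} {x xi : R} {g : Matrix ι ι R} {Γ : ι → Matrix ι ι R}

lemma mul_normalBeta (d : Derivation ℝ R R) (hg : IsUnit g.det) :
    g * normalBeta xi d g = algebraMap ℝ R (1 / 2) • matD d g - xi • g := by
  rw [normalBeta, Matrix.mul_sub, Matrix.mul_smul, ← Matrix.mul_assoc, Matrix.mul_nonsing_inv _ hg,
    Matrix.one_mul, Matrix.mul_smul, Matrix.mul_one]

lemma mul_normalBeta_symm (d : Derivation ℝ R R) (hg : IsUnit g.det) (hs : gᵀ = g) :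
    (g * normalBeta xi d g)ᵀ = g * normalBeta xi d g := by
  rw [mul_normalBeta d hg, Matrix.transpose_sub, Matrix.transpose_smul, Matrix.transpose_smul, hs,
    ← matD_transpose, hs]

lemma normalConn_isLC (hx : x * xi = 1) (hxx : Dp (Sum.inr ()) x = 1)
    (hxi : ∀ i, Dp (Sum.inl i) x = 0) (hg : IsUnit g.det) (hs : gᵀ = g)
    (hLC : IsLC (fun i => Dp (Sum.inl i)) g Γ) :
    IsLC Dp ((xi * xi) • Matrix.fromBlocks g 0 0 1)
      (normalConn xi (Dp (Sum.inr ())) g Γ) := by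
  have hsB := mul_normalBeta_symm (xi := xi) (Dp (Sum.inr ())) hg hs
  have hsB' : ∀ i j, (g * normalBeta xi (Dp (Sum.inr ())) g) i j
      = (g * normalBeta xi (Dp (Sum.inr ())) g) j i := fun i j => congrFun (congrFun hsB j) i
  have hxik : ∀ k, Dp (Sum.inl k) xi = 0 := fun k => by rw [deriv_xinv _ hx, hxi]; simp
  have hxix : Dp (Sum.inr ()) xi = -(xi * xi) := by rw [deriv_xinv _ hx, hxx]; simp
  refine ⟨?_, ?_⟩
  · rintro (i | ⟨⟩) (j | ⟨⟩) (k | ⟨⟩)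
    · exact hLC.torsion i j k
    · simp [normalConn]
    · simp [normalConn]
    · simp [normalConn]
    · simp [normalConn, hsB' j k]
    · simp [normalConn]
    · simp [normalConn]
    · simp [normalConn]
  · rintro (k | ⟨⟩)
    · simp only [matD_smul, normalConn, Sum.elim_inl, Derivation.leibniz, hxik, matD_fromBlocks,
        hLC.compat k, matD_zero, matD_one, Matrix.smul_mul, Matrix.fromBlocks_multiply,
        Matrix.transpose_smul, Matrix.fromBlocks_transpose, ← smul_add, Matrix.fromBlocks_add,
        smul_zero, add_zero, zero_smul, zero_add, Matrix.zero_mul, Matrix.mul_zero, Matrix.one_mul]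
      congr 2
      · ext i j
        simp [Matrix.mul_apply]
      · ext i j
        simp [Matrix.mul_apply, mul_comm]
    · have h1 := mul_normalBeta (xi := xi) (Dp (Sum.inr ())) hg
      have h2 : g * normalBeta xi (Dp (Sum.inr ())) g
          + (g * normalBeta xi (Dp (Sum.inr ())) g)ᵀ = matD (Dp (Sum.inr ())) g
            - (xi + xi) • g := by
        rw [hsB, h1]
        ext i j
        simp only [Matrix.add_apply, Matrix.sub_apply, Matrix.smul_apply, smul_eq_mul]
        linear_combination (matD (Dp (Sum.inr ())) g i j) * algebraMap_half_add (R := R)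
      simp only [matD_smul, normalConn, Sum.elim_inr, Derivation.leibniz, hxix, matD_fromBlocks,
        matD_zero, matD_one, Matrix.smul_mul, Matrix.fromBlocks_multiply,
        Matrix.transpose_smul, Matrix.fromBlocks_transpose, ← smul_add, Matrix.fromBlocks_add,
        add_zero, zero_add, Matrix.zero_mul, Matrix.mul_zero, Matrix.one_mul,
        Matrix.transpose_zero, h2, Matrix.fromBlocks_smul, smul_zero]
      congr 1
      · ext i j
        simp only [Matrix.add_apply, Matrix.sub_apply, Matrix.smul_apply, smul_eq_mul]
        ring
      · ext i j
        simp
        ring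

lemma smul_mul_normalBeta (d : Derivation ℝ R R) (hx : x * xi = 1) (hg : IsUnit g.det) :
    x • (g * normalBeta xi d g) = algebraMap ℝ R (1 / 2) • theta x d g - g := by
  rw [mul_normalBeta d hg, smul_sub, smul_smul, smul_smul, hx, one_smul, theta, smul_smul,
    mul_comm x]

lemma smul_normalBeta (d : Derivation ℝ R R) (hx : x * xi = 1) :
    x • normalBeta xi d g = algebraMap ℝ R (1 / 2) • (g⁻¹ * theta x d g) - 1 := by
  rw [normalBeta, smul_sub, smul_smul, smul_smul, hx, one_smul, theta, Matrix.mul_smul, smul_smul,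
    mul_comm x]

/-- The product of `gβ` and `β`, cleared of denominators. -/
lemma smul_mul_normalBeta_sq (d : Derivation ℝ R R) (hx : x * xi = 1) (hg : IsUnit g.det) :
    (x * x) • (g * normalBeta xi d g * normalBeta xi d g)
      = (algebraMap ℝ R (1 / 2) * algebraMap ℝ R (1 / 2)) • (theta x d g * (g⁻¹ * theta x d g))
        - theta x d g + g := by
  have h1 : (x * x) • (g * normalBeta xi d g * normalBeta xi d g)
      = (x • (g * normalBeta xi d g)) * (x • normalBeta xi d g) := by
    rw [Matrix.smul_mul, Matrix.mul_smul, smul_smul]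
  have h2 : g * (g⁻¹ * theta x d g) = theta x d g := by
    rw [← Matrix.mul_assoc, Matrix.mul_nonsing_inv _ hg, Matrix.one_mul]
  rw [h1, smul_mul_normalBeta d hx hg, smul_normalBeta d hx]
  simp only [Matrix.sub_mul, Matrix.mul_sub, Matrix.smul_mul, Matrix.mul_smul, h2, Matrix.mul_one]
  ext i j
  simp only [Matrix.add_apply, Matrix.sub_apply, Matrix.smul_apply, smul_eq_mul]
  linear_combination -(theta x d g i j) * algebraMap_half_add (R := R)

lemma smul_deriv_mul_normalBeta (d : Derivation ℝ R R) (hd : d x = 1) (hx : x * xi = 1)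
    (hg : IsUnit g.det) (i j : ι) :
    x * x * d ((g * normalBeta xi d g) i j) = algebraMap ℝ R (1 / 2) * theta x d (theta x d g) i j
      - algebraMap ℝ R (1 / 2) * theta x d g i j - theta x d g i j + g i j := by
  have h0 : theta x d g i j = x * d (g i j) := rfl
  rw [theta_theta d hd, Matrix.add_apply, h0, mul_normalBeta d hg]
  simp only [Matrix.sub_apply, Matrix.smul_apply, smul_eq_mul, map_sub, Derivation.leibniz,
    Derivation.map_algebraMap, deriv_xinv d hx, hd, matD_apply]
  linear_combination (-x * d (g i j) + g i j * (x * xi + 1)) * hx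

/-- The component `R^x_{jxl}` of the curvature of `g₊`. -/
lemma normalConn_radial (hx : x * xi = 1) (hxx : Dp (Sum.inr ()) x = 1) (hg : IsUnit g.det)
    (hs : gᵀ = g) (j l : ι) :
    -(2 * x * x) * (curv Dp (normalConn xi (Dp (Sum.inr ())) g Γ) (Sum.inr ()) (Sum.inl l)
        (Sum.inr ()) (Sum.inl j) + xi * xi * g j l)
      = radialDefect x (Dp (Sum.inr ())) g j l := by
  have hsB := mul_normalBeta_symm (xi := xi) (Dp (Sum.inr ())) hg hs
  have hsB' : ∀ i j, (g * normalBeta xi (Dp (Sum.inr ())) g) i j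
      = (g * normalBeta xi (Dp (Sum.inr ())) g) j i :=
    fun i j => congrFun (congrFun hsB j) i
  have hs' : ∀ i j, g i j = g j i := fun i j => congrFun (congrFun hs j) i
  have hsT : (theta x (Dp (Sum.inr ())) g)ᵀ = theta x (Dp (Sum.inr ())) g := by
    rw [theta, Matrix.transpose_smul, ← matD_transpose, hs]
  have hsV : (theta x (Dp (Sum.inr ())) g * (g⁻¹ * theta x (Dp (Sum.inr ())) g)) l j
      = (theta x (Dp (Sum.inr ())) g * (g⁻¹ * theta x (Dp (Sum.inr ())) g)) j l := by
    rw [← Matrix.transpose_apply (theta x (Dp (Sum.inr ())) g * _), Matrix.transpose_mul,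
      Matrix.transpose_mul,
      hsT, Matrix.transpose_nonsing_inv, hs, Matrix.mul_assoc]
  have h1 : curv Dp (normalConn xi (Dp (Sum.inr ())) g Γ) (Sum.inr ()) (Sum.inl l) (Sum.inr ())
        (Sum.inl j)
      = -(Dp (Sum.inr ())) ((g * normalBeta xi (Dp (Sum.inr ())) g) j l)
        + xi * (g * normalBeta xi (Dp (Sum.inr ())) g) j l
        + (g * normalBeta xi (Dp (Sum.inr ())) g * normalBeta xi (Dp (Sum.inr ())) g) l j := by
    rw [Matrix.mul_apply (M := g * _)]
    simp only [hsB' l]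
    simp [curv, normalConn, Matrix.fromBlocks_multiply, matD_fromBlocks,
      Matrix.mul_apply (M := (Matrix.of fun (_ : Unit) _ => _))]
    ring
  have h2 := congrFun (congrFun (smul_mul_normalBeta_sq (xi := xi) (Dp (Sum.inr ())) hx hg) l) j
  have h3 := congrFun (congrFun (smul_mul_normalBeta (xi := xi) (Dp (Sum.inr ())) hx hg) j) l
  have h4 := smul_deriv_mul_normalBeta (xi := xi) (Dp (Sum.inr ())) hxx hx hg j l
  have hsT' : theta x (Dp (Sum.inr ())) g l j = theta x (Dp (Sum.inr ())) g j l :=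
    congrFun (congrFun hsT j) l
  simp only [Matrix.add_apply, Matrix.sub_apply, Matrix.smul_apply, smul_eq_mul, hsV, hsT',
    hs' l j] at h2 h3
  rw [h1, radialDefect]
  simp only [Matrix.sub_apply, Matrix.smul_apply, smul_eq_mul]
  have hc := algebraMap_half_add (R := R)
  linear_combination 2 * h4 - 2 * h3 - 2 * h2
    - 2 * (x * (g * normalBeta xi (Dp (Sum.inr ())) g) j l + g j l * (x * xi + 1)) * hx
    + (theta x (Dp (Sum.inr ())) (theta x (Dp (Sum.inr ())) g) j l
      - 2 * theta x (Dp (Sum.inr ())) g j l - algebraMap ℝ R (1 / 2)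
        * (theta x (Dp (Sum.inr ())) g * (g⁻¹ * theta x (Dp (Sum.inr ())) g)) j l) * hc

lemma smul_trace_normalBeta (d : Derivation ℝ R R) (hx : x * xi = 1) :
    x * (normalBeta xi d g).trace
      = algebraMap ℝ R (1 / 2) * (g⁻¹ * theta x d g).trace - (Fintype.card ι : R) := by
  have := congrArg Matrix.trace (smul_normalBeta (g := g) d hx)
  simpa only [Matrix.trace_sub, Matrix.trace_smul, Matrix.trace_one, smul_eq_mul] using this

/-- The tangential components of the Einstein tensor of `g₊`. -/
lemma normalConn_ric_tan (hx : x * xi = 1) (hxx : Dp (Sum.inr ()) x = 1) (hg : IsUnit g.det)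
    (hs : gᵀ = g) (j l : ι) :
    -(2 * x * x) * (ric Dp (normalConn xi (Dp (Sum.inr ())) g Γ) (Sum.inl j) (Sum.inl l)
        + (Fintype.card ι : R) * (xi * xi * g j l))
      = einTan x (Dp (Sum.inr ())) g (ric (fun i => Dp (Sum.inl i)) Γ) j l := by
  have h0 := normalConn_radial (Γ := Γ) hx hxx hg hs j l
  have hsB := mul_normalBeta_symm (xi := xi) (Dp (Sum.inr ())) hg hs
  have hsB' : ∀ i j, (g * normalBeta xi (Dp (Sum.inr ())) g) i j
      = (g * normalBeta xi (Dp (Sum.inr ())) g) j i := fun i j => congrFun (congrFun hsB j) i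
  have h1 : ∀ i, curv Dp (normalConn xi (Dp (Sum.inr ())) g Γ) (Sum.inl i) (Sum.inl l)
        (Sum.inl i) (Sum.inl j) = curv (fun i => Dp (Sum.inl i)) Γ i l i j
      - normalBeta xi (Dp (Sum.inr ())) g i i * (g * normalBeta xi (Dp (Sum.inr ())) g) j l
      + (g * normalBeta xi (Dp (Sum.inr ())) g) j i * normalBeta xi (Dp (Sum.inr ())) g i l := by
    intro i
    simp [curv, normalConn, Matrix.fromBlocks_multiply, matD_fromBlocks,
      Matrix.mul_apply (N := (Matrix.of fun (_ : Unit) _ => _))]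
    ring
  have h2 := congrFun (congrFun (smul_mul_normalBeta_sq (xi := xi) (Dp (Sum.inr ())) hx hg) j) l
  have h3 := congrFun (congrFun (smul_mul_normalBeta (xi := xi) (Dp (Sum.inr ())) hx hg) j) l
  have h4 := smul_trace_normalBeta (g := g) (Dp (Sum.inr ())) hx
  have h5 : ric Dp (normalConn xi (Dp (Sum.inr ())) g Γ) (Sum.inl j) (Sum.inl l)
      = ric (fun i => Dp (Sum.inl i)) Γ j l
        - (normalBeta xi (Dp (Sum.inr ())) g).trace
          * (g * normalBeta xi (Dp (Sum.inr ())) g) j l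
        + (g * normalBeta xi (Dp (Sum.inr ())) g * normalBeta xi (Dp (Sum.inr ())) g) j l
        + curv Dp (normalConn xi (Dp (Sum.inr ())) g Γ) (Sum.inr ()) (Sum.inl l)
          (Sum.inr ()) (Sum.inl j) := by
    rw [Matrix.mul_apply (M := g * _), Matrix.trace, Finset.sum_mul]
    simp only [ric, Matrix.of_apply, Fintype.sum_sum_type, h1, Finset.sum_add_distrib,
      Finset.sum_sub_distrib, Matrix.diag_apply, Finset.univ_unique, Finset.sum_singleton]
  rw [radialDefect] at h0
  rw [h5, einTan]
  simp only [Matrix.add_apply, Matrix.sub_apply, Matrix.smul_apply, smul_eq_mul] at h0 h2 h3 ⊢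
  have hc := algebraMap_half_add (R := R)
  set c := algebraMap ℝ R (1 / 2)
  set K := (g * normalBeta xi (Dp (Sum.inr ())) g) j l
  set tb := (normalBeta xi (Dp (Sum.inr ())) g).trace
  set T := theta x (Dp (Sum.inr ())) g
  set tV := (g⁻¹ * T).trace
  set n := (Fintype.card ι : R)
  linear_combination h0 - 2 * h2 + 2 * x * tb * h3 + 2 * (c * T j l - g j l) * h4
    + (-2 * (n - 1) * g j l * (x * xi + 1)) * hx
    + (c * tV * T j l - tV * g j l - n * T j l - (T * (g⁻¹ * T)) j l * (c + 1)) * hc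

/-- The `dx²` component of the Einstein tensor of `g₊`. -/
lemma normalConn_ric_nor (hx : x * xi = 1) (hxx : Dp (Sum.inr ()) x = 1) (hg : IsUnit g.det) :
    -(2 * x * x) * (ric Dp (normalConn xi (Dp (Sum.inr ())) g Γ) (Sum.inr ()) (Sum.inr ())
        + (Fintype.card ι : R) * (xi * xi))
      = einNor x (Dp (Sum.inr ())) g := by
  have h1 : ∀ i, curv Dp (normalConn xi (Dp (Sum.inr ())) g Γ) (Sum.inl i) (Sum.inr ())
        (Sum.inl i) (Sum.inr ()) = -(matD (Dp (Sum.inr ())) (normalBeta xi (Dp (Sum.inr ())) g)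
          + normalBeta xi (Dp (Sum.inr ())) g * normalBeta xi (Dp (Sum.inr ())) g
          + xi • normalBeta xi (Dp (Sum.inr ())) g) i i := by
    intro i
    simp [curv, normalConn, Matrix.fromBlocks_multiply, matD_fromBlocks, Matrix.mul_apply]
    ring
  have h2 : curv Dp (normalConn xi (Dp (Sum.inr ())) g Γ) (Sum.inr ()) (Sum.inr ())
      (Sum.inr ()) (Sum.inr ()) = 0 := by rw [curv_self]; rfl
  have h3 : ric Dp (normalConn xi (Dp (Sum.inr ())) g Γ) (Sum.inr ()) (Sum.inr ())
      = -((matD (Dp (Sum.inr ())) (normalBeta xi (Dp (Sum.inr ())) g)).trace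
        + (normalBeta xi (Dp (Sum.inr ())) g * normalBeta xi (Dp (Sum.inr ())) g).trace
        + xi * (normalBeta xi (Dp (Sum.inr ())) g).trace) := by
    simp only [ric, Matrix.of_apply, Fintype.sum_sum_type, Finset.univ_unique,
      Finset.sum_singleton, h1]
    rw [show (default : Unit) = () from rfl, h2, add_zero, Finset.sum_neg_distrib,
      ← smul_eq_mul xi, ← Matrix.trace_smul, ← Matrix.trace_add, ← Matrix.trace_add]
    rfl
  have h4 := smul_trace_normalBeta (g := g) (Dp (Sum.inr ())) hx
  have h5 : x * x * (normalBeta xi (Dp (Sum.inr ())) g * normalBeta xi (Dp (Sum.inr ())) g).trace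
      = algebraMap ℝ R (1 / 2) * algebraMap ℝ R (1 / 2)
          * (g⁻¹ * theta x (Dp (Sum.inr ())) g * (g⁻¹ * theta x (Dp (Sum.inr ())) g)).trace
        - (g⁻¹ * theta x (Dp (Sum.inr ())) g).trace + (Fintype.card ι : R) := by
    have e : (x * x) • (normalBeta xi (Dp (Sum.inr ())) g * normalBeta xi (Dp (Sum.inr ())) g)
        = (x • normalBeta xi (Dp (Sum.inr ())) g) * (x • normalBeta xi (Dp (Sum.inr ())) g) := by
      rw [Matrix.smul_mul, Matrix.mul_smul, smul_smul]
    have := congrArg Matrix.trace e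
    rw [smul_normalBeta _ hx] at this
    simp only [Matrix.sub_mul, Matrix.mul_sub, Matrix.smul_mul, Matrix.mul_smul, Matrix.mul_one,
      Matrix.one_mul, Matrix.trace_sub, Matrix.trace_smul, Matrix.trace_one, smul_eq_mul] at this
    linear_combination this
      - (g⁻¹ * theta x (Dp (Sum.inr ())) g).trace * algebraMap_half_add (R := R)
  have h6 : x * x * (matD (Dp (Sum.inr ())) (normalBeta xi (Dp (Sum.inr ())) g)).trace
      = algebraMap ℝ R (1 / 2) * ((g⁻¹ * theta x (Dp (Sum.inr ()))
            (theta x (Dp (Sum.inr ())) g)).trace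
          - (g⁻¹ * theta x (Dp (Sum.inr ())) g).trace
          - (g⁻¹ * theta x (Dp (Sum.inr ())) g * (g⁻¹ * theta x (Dp (Sum.inr ())) g)).trace)
        + (Fintype.card ι : R) := by
    have e : (x * x) • matD (Dp (Sum.inr ())) (normalBeta xi (Dp (Sum.inr ())) g)
        = algebraMap ℝ R (1 / 2) • (g⁻¹ * theta x (Dp (Sum.inr ())) (theta x (Dp (Sum.inr ())) g)
          - g⁻¹ * theta x (Dp (Sum.inr ())) g
          - g⁻¹ * theta x (Dp (Sum.inr ())) g * (g⁻¹ * theta x (Dp (Sum.inr ())) g)) + 1 := by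
      rw [theta_theta _ hxx, normalBeta, matD_sub, matD_smul, matD_smul, matD_mul, matD_inv _ hg,
        deriv_xinv _ hx, hxx, Derivation.map_algebraMap, matD_one]
      have e1 : (x * x) • -(xi * xi * 1) • (1 : Matrix ι ι R) = -1 := by
        rw [smul_smul, show x * x * -(xi * xi * 1) = -((x * xi) * (x * xi)) by ring, hx]
        simp
      simp only [theta, smul_sub, smul_add, zero_smul, zero_add, smul_zero, add_zero, e1,
        Matrix.mul_add, Matrix.mul_smul, Matrix.smul_mul, Matrix.neg_mul, smul_neg, smul_smul,
        Matrix.mul_assoc]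
      rw [mul_comm (x * x)]
      abel
    have := congrArg Matrix.trace e
    simpa only [Matrix.trace_add, Matrix.trace_sub, Matrix.trace_smul, Matrix.trace_one,
      smul_eq_mul] using this
  rw [h3, einNor]
  have hc := algebraMap_half_add (R := R)
  set c := algebraMap ℝ R (1 / 2)
  set tb := (normalBeta xi (Dp (Sum.inr ())) g).trace
  set T := theta x (Dp (Sum.inr ())) g
  set tV := (g⁻¹ * T).trace
  set n := (Fintype.card ι : R)
  linear_combination 2 * h6 + 2 * h5 + 2 * h4
    + (2 * x * tb - 2 * n * (x * xi + 1)) * hx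
    + ((g⁻¹ * theta x (Dp (Sum.inr ())) T).trace + c * (g⁻¹ * T * (g⁻¹ * T)).trace) * hc

end NormalForm

/-! ### The filtration by order of vanishing at `x = 0` -/

section Filtration

variable {R ι : Type*} [CommRing R] [Algebra ℝ R]

/-- `F` vanishes to order `m` at `x = 0`, where `d` is `∂_x` and `J` is the ideal of the functions
that vanish at `x = 0`. -/
def OrdGE (d : Derivation ℝ R R) (J : Ideal R) : ℕ → R → Prop
  | 0, _ => True
  | m + 1, F => F ∈ J ∧ OrdGE d J m (d F)

variable {d : Derivation ℝ R R} {J : Ideal R}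

lemma OrdGE.of_succ {m : ℕ} {F : R} (h : OrdGE d J (m + 1) F) : OrdGE d J m F := by
  induction m generalizing F with
  | zero => trivial
  | succ m ih => exact ⟨h.1, ih h.2⟩

lemma OrdGE.mono {m k : ℕ} (hk : k ≤ m) {F : R} (h : OrdGE d J m F) : OrdGE d J k F := by
  induction hk with
  | refl => exact h
  | step _ ih => exact ih h.of_succ

lemma OrdGE.add {m : ℕ} {F K : R} (hF : OrdGE d J m F) (hK : OrdGE d J m K) :
    OrdGE d J m (F + K) := by
  induction m generalizing F K with
  | zero => trivial
  | succ m ih => exact ⟨J.add_mem hF.1 hK.1, by rw [map_add]; exact ih hF.2 hK.2⟩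

lemma OrdGE.mul_left {m : ℕ} {F : R} (hF : OrdGE d J m F) (r : R) : OrdGE d J m (r * F) := by
  induction m generalizing F r with
  | zero => trivial
  | succ m ih =>
    refine ⟨J.mul_mem_left r hF.1, ?_⟩
    rw [Derivation.leibniz, smul_eq_mul, smul_eq_mul, mul_comm F]
    exact (ih hF.2 r).add (ih hF.of_succ _)

lemma OrdGE.zero (m : ℕ) : OrdGE d J m 0 := by
  induction m with
  | zero => trivial
  | succ m ih => exact ⟨J.zero_mem, by rwa [map_zero]⟩

lemma OrdGE.mul {a b : ℕ} {F K : R} (hF : OrdGE d J a F) (hK : OrdGE d J b K) :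
    OrdGE d J (a + b) (F * K) := by
  induction hn : a + b generalizing a b F K with
  | zero => trivial
  | succ n ih =>
    rcases a with _ | a
    · rw [← hn, zero_add]; exact hK.mul_left F
    rcases b with _ | b
    · rw [← hn, add_zero, mul_comm]; exact hF.mul_left K
    refine ⟨J.mul_mem_right _ hF.1, ?_⟩
    rw [Derivation.leibniz, smul_eq_mul, smul_eq_mul]
    exact (ih hF hK.2 (by omega)).add (ih hK hF.2 (by omega))

/-- The ideal of the elements that vanish to order `m` at `x = 0`. -/
def ordIdeal (d : Derivation ℝ R R) (J : Ideal R) (m : ℕ) : Ideal R where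
  carrier := {F | OrdGE d J m F}
  add_mem' := OrdGE.add
  zero_mem' := OrdGE.zero m
  smul_mem' r _ h := h.mul_left r

lemma mem_ordIdeal_succ {m : ℕ} {F : R} :
    F ∈ ordIdeal d J (m + 1) ↔ F ∈ J ∧ d F ∈ ordIdeal d J m := Iff.rfl

lemma mem_ordIdeal_zero (F : R) : F ∈ ordIdeal d J 0 := trivial

lemma ordIdeal_mono {m k : ℕ} (hk : k ≤ m) : ordIdeal d J m ≤ ordIdeal d J k :=
  fun _ h => OrdGE.mono hk h

lemma mul_mem_ordIdeal {a b m : ℕ} {F K : R} (hF : F ∈ ordIdeal d J a)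
    (hK : K ∈ ordIdeal d J b) (hm : m ≤ a + b) : F * K ∈ ordIdeal d J m :=
  ordIdeal_mono hm (OrdGE.mul hF hK)

lemma mem_ordIdeal_iff {m : ℕ} {F : R} :
    F ∈ ordIdeal d J m ↔ ∀ j < m, (d^[j]) F ∈ J := by
  induction m generalizing F with
  | zero => simp [mem_ordIdeal_zero]
  | succ m ih =>
    rw [mem_ordIdeal_succ, ih]
    constructor
    · rintro ⟨h0, h1⟩ (_ | j) hj
      · exact h0
      · exact h1 j (by omega)
    · exact fun h => ⟨h 0 (by omega), fun j hj => h (j + 1) (by omega)⟩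

/-- A derivation that preserves `J` and commutes with `d` preserves the order of vanishing. -/
lemma derivation_mem_ordIdeal {d' : Derivation ℝ R R} (hJ : ∀ F ∈ J, d' F ∈ J)
    (hc : ∀ F, d (d' F) = d' (d F)) {m : ℕ} {F : R} (hF : F ∈ ordIdeal d J m) :
    d' F ∈ ordIdeal d J m := by
  induction m generalizing F with
  | zero => trivial
  | succ m ih => exact ⟨hJ F hF.1, by rw [hc]; exact ih hF.2⟩

variable {x : R}

/-- The Euler operator `x ∂_x` acts on the elements of order `m` as multiplication by `m`, up to
elements of order `m + 1`. -/
lemma euler_mem_ordIdeal (hd : d x = 1) (hx : x ∈ J) {m : ℕ} {F : R}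
    (hF : F ∈ ordIdeal d J m) : x * d F - m * F ∈ ordIdeal d J (m + 1) := by
  induction m generalizing F with
  | zero => exact ⟨by simpa using J.mul_mem_right _ hx, trivial⟩
  | succ m ih =>
    refine ⟨J.sub_mem (J.mul_mem_right _ hx) (J.mul_mem_left _ hF.1), ?_⟩
    have h := ih hF.2
    have e : d (x * d F - ((m + 1 : ℕ) : R) * F) = x * d (d F) - m * d F := by
      rw [map_sub, Derivation.leibniz, Derivation.leibniz, hd]
      simp only [smul_eq_mul, Derivation.map_natCast]
      push_cast
      ring
    rw [e]
    exact h

lemma theta_mem_ordIdeal (hd : d x = 1) (hx : x ∈ J) {m : ℕ} {F : R}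
    (hF : F ∈ ordIdeal d J m) : x * d F ∈ ordIdeal d J m := by
  have := (ordIdeal d J m).add_mem (ordIdeal_mono (Nat.le_succ m) (euler_mem_ordIdeal hd hx hF))
    ((ordIdeal d J m).mul_mem_left m hF)
  simpa using this

lemma x_mul_mem_ordIdeal_one (hx : x ∈ J) (F : R) : x * F ∈ ordIdeal d J 1 :=
  ⟨J.mul_mem_right _ hx, trivial⟩

lemma mem_of_real_mul_mem {I : Ideal R} {c : ℝ} (hc : c ≠ 0) {F : R}
    (h : algebraMap ℝ R c * F ∈ I) : F ∈ I := by
  have := I.mul_mem_left (algebraMap ℝ R c⁻¹) h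
  rwa [← mul_assoc, ← map_mul, inv_mul_cancel₀ hc, map_one, one_mul] at this

end Filtration

section EntriesIn

variable {R ι : Type*} [CommRing R]

/-- All the entries of the matrix `M` lie in the ideal `I`. -/
def EntriesIn (I : Ideal R) (M : Matrix ι ι R) : Prop := ∀ i j, M i j ∈ I

variable {I : Ideal R} {M N : Matrix ι ι R}

lemma EntriesIn.add (hM : EntriesIn I M) (hN : EntriesIn I N) : EntriesIn I (M + N) :=
  fun i j => I.add_mem (hM i j) (hN i j)

lemma EntriesIn.sub (hM : EntriesIn I M) (hN : EntriesIn I N) : EntriesIn I (M - N) :=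
  fun i j => I.sub_mem (hM i j) (hN i j)

lemma EntriesIn.neg (hM : EntriesIn I M) : EntriesIn I (-M) :=
  fun i j => I.neg_mem (hM i j)

lemma EntriesIn.smul (hM : EntriesIn I M) (r : R) : EntriesIn I (r • M) :=
  fun i j => I.mul_mem_left r (hM i j)

lemma EntriesIn.smul_of_mem {r : R} (hr : r ∈ I) (M : Matrix ι ι R) : EntriesIn I (r • M) :=
  fun i j => I.mul_mem_right (M i j) hr

lemma EntriesIn.mono {I' : Ideal R} (h : I ≤ I') (hM : EntriesIn I M) : EntriesIn I' M :=
  fun i j => h (hM i j)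

variable [Fintype ι]

lemma EntriesIn.mul_left (hM : EntriesIn I M) (N : Matrix ι ι R) : EntriesIn I (N * M) :=
  fun i j => by
    rw [Matrix.mul_apply]; exact I.sum_mem fun k _ => I.mul_mem_left _ (hM k j)

lemma EntriesIn.mul_right (hM : EntriesIn I M) (N : Matrix ι ι R) : EntriesIn I (M * N) :=
  fun i j => by
    rw [Matrix.mul_apply]; exact I.sum_mem fun k _ => I.mul_mem_right _ (hM i k)

lemma EntriesIn.trace_mem (hM : EntriesIn I M) : M.trace ∈ I := I.sum_mem fun i _ => hM i i

variable [DecidableEq ι]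

lemma EntriesIn.inv_sub_inv {g h : Matrix ι ι R} (hg : IsUnit g.det) (hh : IsUnit h.det)
    (hgh : EntriesIn I (g - h)) : EntriesIn I (g⁻¹ - h⁻¹) := by
  have : g⁻¹ - h⁻¹ = -(g⁻¹ * (g - h) * h⁻¹) := by
    rw [Matrix.mul_sub, Matrix.sub_mul, Matrix.nonsing_inv_mul _ hg, Matrix.mul_assoc,
      Matrix.mul_nonsing_inv _ hh, Matrix.one_mul, Matrix.mul_one, neg_sub]
  rw [this]
  exact ((hgh.mul_left _).mul_right _).neg

lemma det_sub_det_mem {g h : Matrix ι ι R} (hgh : EntriesIn I (g - h)) : g.det - h.det ∈ I := by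
  rw [← Ideal.Quotient.eq, RingHom.map_det, RingHom.map_det]
  congr 1
  ext i j
  exact Ideal.Quotient.eq.2 (hgh i j)

/-- `det (1 + X) = 1 + tr X` up to products of two entries of `X`. -/
lemma det_one_add_sub_mem {X : Matrix ι ι R} (hX : ∀ i j k l, X i j * X k l ∈ I) :
    (1 + X).det - (1 + X.trace) ∈ I := by
  classical
  have hdiag : ∀ s : Finset ι, ∏ i ∈ s, (1 + X i i) - (1 + ∑ i ∈ s, X i i) ∈ I := by
    intro s
    induction s using Finset.induction_on with
    | empty => simp
    | insert a s ha ih =>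
      rw [Finset.prod_insert ha, Finset.sum_insert ha]
      have h2 : X a a * ∑ i ∈ s, X i i ∈ I := by
        rw [Finset.mul_sum]; exact I.sum_mem fun i _ => hX _ _ _ _
      have := I.add_mem (I.mul_mem_left (1 + X a a) ih) h2
      convert this using 1
      ring
  rw [Matrix.det_apply, ← Finset.add_sum_erase _ _ (Finset.mem_univ (1 : Equiv.Perm ι))]
  have h1 : ∑ σ ∈ Finset.univ.erase (1 : Equiv.Perm ι),
      Equiv.Perm.sign σ • ∏ i, (1 + X) (σ i) i ∈ I := by
    refine I.sum_mem fun σ hσ => ?_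
    rw [Units.smul_def, zsmul_eq_mul]
    refine I.mul_mem_left _ ?_
    obtain ⟨i, hi⟩ : ∃ i, σ i ≠ i := by
      by_contra hcon
      push Not at hcon
      exact (Finset.ne_of_mem_erase hσ) (Equiv.ext hcon)
    -- the factors at `i` and at `σ i` are both off the diagonal
    have hi' : σ (σ i) ≠ σ i := fun h => hi (σ.injective h)
    rw [← Finset.mul_prod_erase _ _ (Finset.mem_univ i),
      ← Finset.mul_prod_erase _ _ (Finset.mem_erase.2 ⟨hi, Finset.mem_univ (σ i)⟩), ← mul_assoc]
    refine I.mul_mem_right _ ?_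
    simpa [Matrix.one_apply, hi, hi'] using hX (σ i) i (σ (σ i)) (σ i)
  have h2 := hdiag Finset.univ
  have h3 := I.add_mem h2 h1
  convert h3 using 1
  simp [Matrix.trace]
  ring

end EntriesIn

section EntriesOrd

variable {R ι : Type*} [CommRing R] [Algebra ℝ R] {d : Derivation ℝ R R} {J : Ideal R} {x : R}

lemma EntriesIn.smul_mem {a b k : ℕ} {r : R} {N : Matrix ι ι R} (hr : r ∈ ordIdeal d J a)
    (hN : EntriesIn (ordIdeal d J b) N) (hk : k ≤ a + b) :
    EntriesIn (ordIdeal d J k) (r • N) := fun i j => mul_mem_ordIdeal hr (hN i j) hk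

lemma entriesIn_theta (hx : x ∈ J) (M : Matrix ι ι R) :
    EntriesIn (ordIdeal d J 1) (theta x d M) := fun _ _ => x_mul_mem_ordIdeal_one hx _

lemma theta_sub (M N : Matrix ι ι R) : theta x d (M - N) = theta x d M - theta x d N := by
  simp [theta, matD_sub, smul_sub]

lemma EntriesIn.mul [Fintype ι] {a b k : ℕ} {M N : Matrix ι ι R} (hM : EntriesIn (ordIdeal d J a) M)
    (hN : EntriesIn (ordIdeal d J b) N) (hk : k ≤ a + b) :
    EntriesIn (ordIdeal d J k) (M * N) := fun i j => by
  rw [Matrix.mul_apply]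
  exact (ordIdeal d J k).sum_mem fun l _ => mul_mem_ordIdeal (hM i l) (hN l j) hk

/-- The leading part of `θ g - θ h` when `g` and `h` agree to order `m`. -/
lemma theta_leading {g h : Matrix ι ι R} {m : ℕ} (hd : d x = 1) (hx : x ∈ J)
    (hgh : EntriesIn (ordIdeal d J m) (g - h)) :
    EntriesIn (ordIdeal d J (m + 1)) (theta x d g - theta x d h - (m : R) • (g - h)) := by
  rw [← theta_sub]
  exact fun i j => euler_mem_ordIdeal hd hx (hgh i j)

lemma theta_theta_leading {g h : Matrix ι ι R} {m : ℕ} (hd : d x = 1) (hx : x ∈ J)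
    (hgh : EntriesIn (ordIdeal d J m) (g - h)) :
    EntriesIn (ordIdeal d J (m + 1)) (theta x d (theta x d g) - theta x d (theta x d h)
      - ((m : R) * m) • (g - h)) := by
  have h1 : EntriesIn (ordIdeal d J m) (theta x d g - theta x d h) := by
    rw [← theta_sub]; exact fun i j => theta_mem_ordIdeal hd hx (hgh i j)
  have h2 := (theta_leading hd hx h1).add ((theta_leading hd hx hgh).smul (m : R))
  convert h2 using 1
  ext i j
  simp only [Matrix.add_apply, Matrix.sub_apply, Matrix.smul_apply, smul_eq_mul]
  ring

end EntriesOrd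

section Uniqueness

variable {R ι : Type*} [CommRing R] [Algebra ℝ R] [Fintype ι] [DecidableEq ι]

/-- Congruent metrics have congruent Christoffel symbols, modulo an ideal that is stable under the
derivations. -/
lemma chr_sub_chr_mem {D : ι → Derivation ℝ R R} {I : Ideal R} (hI : ∀ i, ∀ F ∈ I, D i F ∈ I)
    {g h : Matrix ι ι R} (hg : IsUnit g.det) (hh : IsUnit h.det) (hgh : EntriesIn I (g - h))
    (k : ι) : EntriesIn I (chr D g k - chr D h k) := by
  intro i j
  have h1 : ∀ i k l, D i (g k l) - D i (h k l) ∈ I := fun i k l => by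
    rw [← map_sub]; exact hI i _ (hgh k l)
  have h2 := EntriesIn.inv_sub_inv hg hh hgh
  simp only [Matrix.sub_apply, chr, Matrix.of_apply, ← smul_sub, ← Finset.sum_sub_distrib]
  rw [Algebra.smul_def]
  refine I.mul_mem_left _ (I.sum_mem fun l _ => ?_)
  have e : g⁻¹ i l * (D k (g j l) + D j (g k l) - D l (g k j))
      - h⁻¹ i l * (D k (h j l) + D j (h k l) - D l (h k j))
      = (g⁻¹ i l - h⁻¹ i l) * (D k (g j l) + D j (g k l) - D l (g k j))
        + h⁻¹ i l * ((D k (g j l) - D k (h j l)) + (D j (g k l) - D j (h k l))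
          - (D l (g k j) - D l (h k j))) := by ring
  rw [e]
  exact I.add_mem (I.mul_mem_right _ (h2 i l))
    (I.mul_mem_left _ (I.sub_mem (I.add_mem (h1 _ _ _) (h1 _ _ _)) (h1 _ _ _)))

lemma ric_sub_ric_mem {D : ι → Derivation ℝ R R} {I : Ideal R} (hI : ∀ i, ∀ F ∈ I, D i F ∈ I)
    {g h : Matrix ι ι R} (hg : IsUnit g.det) (hh : IsUnit h.det) (hgh : EntriesIn I (g - h)) :
    EntriesIn I (ric D (chr D g) - ric D (chr D h)) := by
  have hc := chr_sub_chr_mem hI hg hh hgh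
  have hcD : ∀ k l, EntriesIn I (matD (D k) (chr D g l) - matD (D k) (chr D h l)) :=
    fun k l i j => by
      rw [← matD_sub]; exact hI k _ (hc l i j)
  have hcm : ∀ k l, EntriesIn I (chr D g k * chr D g l - chr D h k * chr D h l) := fun k l => by
    have e : chr D g k * chr D g l - chr D h k * chr D h l
        = (chr D g k - chr D h k) * chr D g l + chr D h k * (chr D g l - chr D h l) := by
      rw [Matrix.sub_mul, Matrix.mul_sub]; abel
    rw [e]
    exact ((hc k).mul_right _).add ((hc l).mul_left _)
  have hcurv : ∀ k l, EntriesIn I (curv D (chr D g) k l - curv D (chr D h) k l) := fun k l => by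
    have e : curv D (chr D g) k l - curv D (chr D h) k l
        = (matD (D k) (chr D g l) - matD (D k) (chr D h l))
          - (matD (D l) (chr D g k) - matD (D l) (chr D h k))
          + ((chr D g k * chr D g l - chr D h k * chr D h l)
            - (chr D g l * chr D g k - chr D h l * chr D h k)) := by
      simp only [curv]; abel
    rw [e]
    exact ((hcD k l).sub (hcD l k)).add ((hcm k l).sub (hcm l k))
  intro j l
  simp only [ric, Matrix.sub_apply, Matrix.of_apply, ← Finset.sum_sub_distrib]
  exact I.sum_mem fun i _ => hcurv i l i j

variable {d : Derivation ℝ R R} {J : Ideal R} {x : R} {g h : Matrix ι ι R} {m : ℕ}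

/-- If `M - N` has leading part `c (g - h)`, then `g⁻¹ M - h⁻¹ N` has leading part `c h⁻¹ (g - h)`:
the difference of the inverses is multiplied by `M`, which vanishes at `x = 0`. -/
lemma inv_mul_leading (hg : IsUnit g.det) (hh : IsUnit h.det)
    (hgh : EntriesIn (ordIdeal d J m) (g - h)) {M N : Matrix ι ι R} {c : R}
    (hN : EntriesIn (ordIdeal d J 1) M)
    (hMN : EntriesIn (ordIdeal d J (m + 1)) (M - N - c • (g - h))) :
    EntriesIn (ordIdeal d J (m + 1)) (g⁻¹ * M - h⁻¹ * N - c • (h⁻¹ * (g - h))) := by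
  have h1 := EntriesIn.inv_sub_inv hg hh hgh
  have e : g⁻¹ * M - h⁻¹ * N - c • (h⁻¹ * (g - h))
      = (g⁻¹ - h⁻¹) * M + h⁻¹ * (M - N - c • (g - h)) := by
    simp only [Matrix.sub_mul, Matrix.mul_sub, Matrix.mul_smul, smul_sub]; abel
  rw [e]
  exact (h1.mul hN (by omega)).add (hMN.mul_left _)

/-- Two families of metrics that agree to order `m ≥ 1` at `x = 0`. -/
structure AgreeTo (d : Derivation ℝ R R) (J : Ideal R) (x : R) (m : ℕ) (g h : Matrix ι ι R) :
    Prop where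
  pos : 1 ≤ m
  deriv_x : d x = 1
  x_mem : x ∈ J
  left : IsUnit g.det
  right : IsUnit h.det
  sub : EntriesIn (ordIdeal d J m) (g - h)

namespace AgreeTo

lemma leading_inv_theta (H : AgreeTo d J x m g h) :
    EntriesIn (ordIdeal d J (m + 1)) (g⁻¹ * theta x d g - h⁻¹ * theta x d h
      - (m : R) • (h⁻¹ * (g - h))) :=
  inv_mul_leading H.left H.right H.sub (entriesIn_theta H.x_mem g)
    (theta_leading H.deriv_x H.x_mem H.sub)

lemma inv_theta_sub (H : AgreeTo d J x m g h) :
    EntriesIn (ordIdeal d J m) (g⁻¹ * theta x d g - h⁻¹ * theta x d h) := by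
  have := (H.leading_inv_theta.mono (ordIdeal_mono (Nat.le_succ m))).add
    ((H.sub.mul_left h⁻¹).smul (m : R))
  simpa using this

lemma theta_sub_mem (H : AgreeTo d J x m g h) :
    EntriesIn (ordIdeal d J m) (theta x d g - theta x d h) := by
  rw [← theta_sub]
  exact fun i j => theta_mem_ordIdeal H.deriv_x H.x_mem (H.sub i j)

lemma theta_mul_sub (H : AgreeTo d J x m g h) :
    EntriesIn (ordIdeal d J (m + 1)) (theta x d g * (g⁻¹ * theta x d g)
      - theta x d h * (h⁻¹ * theta x d h)) := by
  have e : theta x d g * (g⁻¹ * theta x d g) - theta x d h * (h⁻¹ * theta x d h)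
      = (theta x d g - theta x d h) * (g⁻¹ * theta x d g)
        + theta x d h * (g⁻¹ * theta x d g - h⁻¹ * theta x d h) := by
    rw [Matrix.sub_mul, Matrix.mul_sub]; abel
  rw [e]
  exact (H.theta_sub_mem.mul ((entriesIn_theta H.x_mem g).mul_left _) le_rfl).add
    ((entriesIn_theta H.x_mem h).mul H.inv_theta_sub (by omega))

/-- The leading part of the radial curvature equation in a perturbation of order `m`: its indicial
roots are `0` and `2`. -/
lemma leading_radialDefect (H : AgreeTo d J x m g h) :
    EntriesIn (ordIdeal d J (m + 1)) (radialDefect x d g - radialDefect x d h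
      - ((m : R) * m - 2 * m) • (g - h)) := by
  have h1 := theta_theta_leading H.deriv_x H.x_mem H.sub
  have h2 := theta_leading H.deriv_x H.x_mem H.sub
  have h3 := (h1.sub (h2.smul 2)).sub (H.theta_mul_sub.smul (algebraMap ℝ R (1 / 2)))
  convert h3 using 1
  ext i j
  simp only [radialDefect, Matrix.sub_apply, Matrix.smul_apply, smul_eq_mul]
  ring

/-- The leading part of the tangential Einstein equation in a perturbation of order `m`. The Ricci
tensor of the slices enters with a factor `x²` and so does not contribute. -/
lemma leading_einTan (H : AgreeTo d J x m g h) {ρg ρh : Matrix ι ι R}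
    (hρ : EntriesIn (ordIdeal d J m) (ρg - ρh)) :
    EntriesIn (ordIdeal d J (m + 1)) (einTan x d g ρg - einTan x d h ρh
      - (((m : R) * m - Fintype.card ι * m) • (g - h)
        - ((m : R) * (h⁻¹ * (g - h)).trace) • h)) := by
  have h1 := theta_theta_leading H.deriv_x H.x_mem H.sub
  have h2 := theta_leading H.deriv_x H.x_mem H.sub
  have h3 := EntriesIn.smul_of_mem H.leading_inv_theta.trace_mem g
  have h4 := EntriesIn.smul_mem (r := (m : R) * (h⁻¹ * (g - h)).trace) (k := m + 1)
    (Ideal.mul_mem_left _ _ (H.sub.mul_left _).trace_mem) H.sub (by have := H.pos; omega)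
  have hVh : (h⁻¹ * theta x d h).trace ∈ ordIdeal d J 1 :=
    ((entriesIn_theta H.x_mem h).mul_left _).trace_mem
  have h5 := EntriesIn.smul_mem hVh H.sub (add_comm m 1).le
  have h6 := EntriesIn.smul_mem H.inv_theta_sub.trace_mem (entriesIn_theta (d := d) H.x_mem g)
    le_rfl
  have h7 := EntriesIn.smul_mem hVh H.theta_sub_mem (add_comm m 1).le
  have h8 : EntriesIn (ordIdeal d J (m + 1)) ((2 * x * x) • (ρg - ρh)) :=
    EntriesIn.smul_mem (a := 1)
      (by rw [mul_comm]; exact x_mul_mem_ordIdeal_one H.x_mem _) hρ (add_comm m 1).le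
  have h9 := ((((h1.sub (h2.smul (Fintype.card ι : R))).sub (h3.add (h4.add h5))).sub
    H.theta_mul_sub).add ((h6.add h7).smul (algebraMap ℝ R (1 / 2)))).sub h8
  convert h9 using 1
  ext i j
  simp only [einTan, Matrix.add_apply, Matrix.sub_apply, Matrix.smul_apply, smul_eq_mul,
    Matrix.trace_sub, Matrix.trace_smul]
  ring

/-- The leading part of the normal Einstein equation in a perturbation of order `m`. -/
lemma leading_einNor (H : AgreeTo d J x m g h) :
    einNor x d g - einNor x d h - ((m : R) * m - 2 * m) * (h⁻¹ * (g - h)).trace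
      ∈ ordIdeal d J (m + 1) := by
  have h1 := (inv_mul_leading H.left H.right H.sub (entriesIn_theta H.x_mem _)
    (theta_theta_leading H.deriv_x H.x_mem H.sub)).trace_mem
  have h2 := H.leading_inv_theta.trace_mem
  have h3 : EntriesIn (ordIdeal d J (m + 1)) (g⁻¹ * theta x d g * (g⁻¹ * theta x d g)
      - h⁻¹ * theta x d h * (h⁻¹ * theta x d h)) := by
    have e : g⁻¹ * theta x d g * (g⁻¹ * theta x d g) - h⁻¹ * theta x d h * (h⁻¹ * theta x d h)
        = (g⁻¹ * theta x d g - h⁻¹ * theta x d h) * (g⁻¹ * theta x d g)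
          + h⁻¹ * theta x d h * (g⁻¹ * theta x d g - h⁻¹ * theta x d h) := by
      rw [Matrix.sub_mul, Matrix.mul_sub]; abel
    rw [e]
    exact (H.inv_theta_sub.mul ((entriesIn_theta H.x_mem g).mul_left _) le_rfl).add
      (((entriesIn_theta H.x_mem h).mul_left _).mul H.inv_theta_sub (by omega))
  have h4 := Ideal.sub_mem _ (Ideal.sub_mem _ h1
    (Ideal.mul_mem_left _ (algebraMap ℝ R (1 / 2)) h3.trace_mem)) (Ideal.mul_mem_left _ 2 h2)
  convert h4 using 1
  simp only [einNor, Matrix.trace_sub, Matrix.trace_smul, smul_eq_mul]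
  ring

/-- The radial curvature equation determines the coefficients of all orders other than `2`. -/
lemma succ_of_radialDefect (H : AgreeTo d J x m g h) (hm : m ≠ 2)
    (hg : EntriesIn (ordIdeal d J (m + 1)) (radialDefect x d g))
    (hh : EntriesIn (ordIdeal d J (m + 1)) (radialDefect x d h)) :
    AgreeTo d J x (m + 1) g h := by
  refine { H with pos := by omega, sub := fun i j => ?_ }
  have h1 := (hg.sub hh).sub H.leading_radialDefect i j
  rw [sub_sub_cancel] at h1
  have hc : ((m : ℝ) * m - 2 * m) ≠ 0 := by
    have h1 : (m : ℝ) ≠ 0 := by have := H.pos; positivity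
    have h2 : (m : ℝ) - 2 ≠ 0 := sub_ne_zero.2 (by exact_mod_cast hm)
    have := mul_ne_zero h1 h2
    rwa [mul_sub, mul_comm (m : ℝ) 2] at this
  refine mem_of_real_mul_mem hc ?_
  convert h1 using 1
  simp only [Matrix.smul_apply, smul_eq_mul, map_sub, map_mul, map_natCast, map_ofNat]

/-- The tangential Einstein equation determines the coefficients of all orders less than the
dimension: its indicial operator `m (m - n) δ - m (tr δ) h` is then invertible. -/
lemma succ_of_einTan (H : AgreeTo d J x m g h) (hm : m < Fintype.card ι) {ρg ρh : Matrix ι ι R}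
    (hρ : EntriesIn (ordIdeal d J m) (ρg - ρh))
    (hg : EntriesIn (ordIdeal d J (m + 1)) (einTan x d g ρg))
    (hh : EntriesIn (ordIdeal d J (m + 1)) (einTan x d h ρh)) :
    AgreeTo d J x (m + 1) g h := by
  refine { H with pos := by omega, sub := ?_ }
  have h0 := (hg.sub hh).sub (H.leading_einTan hρ)
  rw [sub_sub_cancel] at h0
  have hm0 : (m : ℝ) ≠ 0 := by have := H.pos; positivity
  have hmn : (m : ℝ) < Fintype.card ι := by exact_mod_cast hm
  have htr : (h⁻¹ * (g - h)).trace ∈ ordIdeal d J (m + 1) := by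
    -- Tracing the indicial operator leaves `m (m - 2n) tr δ`.
    have h1 := (h0.mul_left h⁻¹).trace_mem
    have hc : (m : ℝ) * (m - 2 * Fintype.card ι) ≠ 0 :=
      mul_ne_zero hm0 (by have : (0 : ℝ) ≤ m := Nat.cast_nonneg m; linarith)
    refine mem_of_real_mul_mem hc ?_
    convert h1 using 1
    simp only [Matrix.mul_sub h⁻¹ (_ • _), Matrix.mul_smul, Matrix.nonsing_inv_mul _ H.right,
      Matrix.trace_sub, Matrix.trace_smul, Matrix.trace_one, smul_eq_mul, map_mul, map_sub,
      map_natCast, map_ofNat]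
    ring
  have h2 := h0.add (EntriesIn.smul_of_mem (Ideal.mul_mem_left _ (m : R) htr) h)
  intro i j
  have hc : (m : ℝ) * (m - Fintype.card ι) ≠ 0 := mul_ne_zero hm0 (by linarith)
  refine mem_of_real_mul_mem hc ?_
  convert h2 i j using 1
  simp only [sub_add_cancel, Matrix.smul_apply, smul_eq_mul, map_mul, map_sub, map_natCast]
  ring

/-- In order equal to the dimension, the trace of the Einstein equation determines the trace of the
coefficient. -/
lemma trace_mem_of_einstein_trace (H : AgreeTo d J x (Fintype.card ι) g h) {ρg ρh : Matrix ι ι R}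
    (hρ : EntriesIn (ordIdeal d J (Fintype.card ι)) (ρg - ρh))
    (hg : EntriesIn (ordIdeal d J 1) (einTan x d g ρg))
    (htg : einNor x d g + (g⁻¹ * einTan x d g ρg).trace ∈ ordIdeal d J (Fintype.card ι + 1))
    (hth : einNor x d h + (h⁻¹ * einTan x d h ρh).trace ∈ ordIdeal d J (Fintype.card ι + 1)) :
    (h⁻¹ * (g - h)).trace ∈ ordIdeal d J (Fintype.card ι + 1) := by
  have h1 := ((H.leading_einTan hρ).mul_left h⁻¹).trace_mem
  have h2 := ((EntriesIn.inv_sub_inv H.left H.right H.sub).mul hg le_rfl).trace_mem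
  have h3 := Ideal.sub_mem _ (Ideal.sub_mem _ (Ideal.sub_mem _ (Ideal.sub_mem _ htg hth) h1) h2)
    H.leading_einNor
  -- At `m = n` the tangential trace contributes `-n² tr δ` and the normal component
  -- `(n² - 2n) tr δ`.
  have hc : -2 * (Fintype.card ι : ℝ) ≠ 0 := by
    have := H.pos
    have : (Fintype.card ι : ℝ) ≠ 0 := by positivity
    simpa using this
  refine mem_of_real_mul_mem hc ?_
  convert h3 using 1
  simp only [Matrix.mul_sub h⁻¹ (_ - _) _, Matrix.mul_sub h⁻¹ (_ • _),
    Matrix.mul_sub h⁻¹ (einTan _ _ _ _),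
    Matrix.sub_mul g⁻¹ h⁻¹ (einTan _ _ _ _), Matrix.mul_smul,
    Matrix.nonsing_inv_mul _ H.right, Matrix.trace_sub, Matrix.trace_smul, Matrix.trace_one,
    smul_eq_mul, map_mul, map_neg, map_natCast, map_ofNat]
  ring

/-- If the leading coefficient of `g - h` is trace-free then `det g` and `det h` agree to one order
more. -/
lemma det_sub_det_mem_succ (H : AgreeTo d J x m g h)
    (ht : (h⁻¹ * (g - h)).trace ∈ ordIdeal d J (m + 1)) :
    g.det - h.det ∈ ordIdeal d J (m + 1) := by
  have hX := H.sub.mul_left h⁻¹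
  have h1 := det_one_add_sub_mem (I := ordIdeal d J (m + 1)) (X := h⁻¹ * (g - h))
    fun i j k l => mul_mem_ordIdeal (hX i j) (hX k l) (by have := H.pos; omega)
  have h2 : g = h * (1 + h⁻¹ * (g - h)) := by
    rw [Matrix.mul_add, ← Matrix.mul_assoc, Matrix.mul_nonsing_inv _ H.right]; simp
  have h3 : g.det = h.det * (1 + h⁻¹ * (g - h)).det := by
    rw [← Matrix.det_mul, ← h2]
  rw [h3]
  have h4 := Ideal.mul_mem_left _ h.det (Ideal.add_mem _ h1 ht)
  convert h4 using 1
  ring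

/-- Two solutions of the tangential Einstein equation with the same initial metric agree up to the
order of the dimension. -/
theorem of_einTan {D : ι → Derivation ℝ R R} (hJ : ∀ i, ∀ F ∈ J, D i F ∈ J)
    (hc : ∀ i F, d (D i F) = D i (d F)) (H : AgreeTo d J x 1 g h)
    (hg : EntriesIn (ordIdeal d J (Fintype.card ι)) (einTan x d g (ric D (chr D g))))
    (hh : EntriesIn (ordIdeal d J (Fintype.card ι)) (einTan x d h (ric D (chr D h))))
    (hm : 1 ≤ m) (hmn : m ≤ Fintype.card ι) : AgreeTo d J x m g h := by
  induction m, hm using Nat.le_induction with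
  | base => exact H
  | succ m hm ih =>
    have ih := ih (by omega)
    exact ih.succ_of_einTan (by omega)
      (ric_sub_ric_mem (fun i F hF => derivation_mem_ordIdeal (hJ i) (hc i) hF) ih.left ih.right
        ih.sub)
      (hg.mono (ordIdeal_mono hmn)) (hh.mono (ordIdeal_mono hmn))

end AgreeTo

end Uniqueness

/-! ### The algebra of smooth functions on a set with unique derivatives -/

section SmoothAlg

open Classical in
/-- The extension by zero of a function on `S`. -/
def extendZ {E : Type*} (S : Set E) (f : S → ℝ) (z : E) : ℝ := if h : z ∈ S then f ⟨z, h⟩ else 0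

lemma extendZ_of_mem {E : Type*} {S : Set E} (f : S → ℝ) {z : E} (hz : z ∈ S) :
    extendZ S f z = f ⟨z, hz⟩ := by simp [extendZ, hz]

variable {E E' : Type*} [NormedAddCommGroup E] [NormedSpace ℝ E] [NormedAddCommGroup E']
  [NormedSpace ℝ E']

/-- The algebra of smooth functions on `S`. The set `S` may have a boundary, where smoothness is
one-sided. -/
def smoothAlg (S : Set E) : Subalgebra ℝ (S → ℝ) where
  carrier := {f | ContDiffOn ℝ ∞ (extendZ S f) S}
  mul_mem' {f g} hf hg := (hf.mul hg).congr fun z hz => by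
    simp [extendZ_of_mem _ hz]
  add_mem' {f g} hf hg := (hf.add hg).congr fun z hz => by
    simp [extendZ_of_mem _ hz]
  algebraMap_mem' r := (contDiffOn_const (c := r)).congr fun z hz => by
    rw [extendZ_of_mem _ hz]; rfl

/-- The underlying function of an element of `smoothAlg S`, extended by zero. -/
def smFn {S : Set E} (f : smoothAlg S) : E → ℝ := extendZ S f.1

lemma smFn_apply {S : Set E} (f : smoothAlg S) (y : S) : smFn f y = f.1 y :=
  extendZ_of_mem _ y.2

lemma contDiffOn_smFn {S : Set E} (f : smoothAlg S) : ContDiffOn ℝ ∞ (smFn f) S := f.2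

/-- The element of `smoothAlg S` given by a function that is smooth on `S`. -/
def smMk {S : Set E} (F : E → ℝ) (hF : ContDiffOn ℝ ∞ F S) : smoothAlg S :=
  ⟨fun y => F y, hF.congr fun z hz => by rw [extendZ_of_mem _ hz]⟩

lemma smFn_smMk {S : Set E} (F : E → ℝ) (hF : ContDiffOn ℝ ∞ F S) : EqOn (smFn (smMk F hF)) F S :=
  fun z hz => smFn_apply (smMk F hF) ⟨z, hz⟩

lemma smoothAlg_ext {S : Set E} {f g : smoothAlg S} (h : ∀ y, f.1 y = g.1 y) : f = g :=
  Subtype.ext (funext h)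

/-- Evaluation at a point of `S`. -/
def evalAt {S : Set E} (y : S) : smoothAlg S →ₐ[ℝ] ℝ :=
  (Pi.evalAlgHom ℝ (fun _ : S => ℝ) y).comp (smoothAlg S).val

lemma evalAt_apply {S : Set E} (y : S) (f : smoothAlg S) : evalAt y f = f.1 y := rfl

/-- The derivative in the direction `v`. -/
def dirD {S : Set E} (hS : UniqueDiffOn ℝ S) (v : E) :
    Derivation ℝ (smoothAlg S) (smoothAlg S) :=
  Derivation.mk'
    { toFun := fun f => smMk (fun z => fderivWithin ℝ (smFn f) S z v)
        (((contDiffOn_smFn f).fderivWithin hS (m := ∞) (by simp)).clm_apply contDiffOn_const)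
      map_add' := fun f g => smoothAlg_ext fun y => by
        have h1 : fderivWithin ℝ (smFn (f + g)) S y
            = fderivWithin ℝ (smFn f + smFn g) S y :=
          fderivWithin_congr (fun z hz => by
            rw [Pi.add_apply, smFn_apply _ ⟨z, hz⟩, smFn_apply f ⟨z, hz⟩, smFn_apply g ⟨z, hz⟩]
            rfl) (by rw [Pi.add_apply, smFn_apply, smFn_apply, smFn_apply]; rfl)
        have h2 := fderivWithin_add (hS y y.2)
          ((contDiffOn_smFn f).differentiableOn (by simp) y y.2)
          ((contDiffOn_smFn g).differentiableOn (by simp) y y.2)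
        show fderivWithin ℝ (smFn (f + g)) S y v = fderivWithin ℝ (smFn f) S y v
          + fderivWithin ℝ (smFn g) S y v
        rw [h1, h2]; rfl
      map_smul' := fun r f => smoothAlg_ext fun y => by
        have h1 : fderivWithin ℝ (smFn (r • f)) S y
            = fderivWithin ℝ (r • smFn f) S y :=
          fderivWithin_congr (fun z hz => by
            rw [Pi.smul_apply, smFn_apply _ ⟨z, hz⟩, smFn_apply f ⟨z, hz⟩]
            rfl) (by rw [Pi.smul_apply, smFn_apply, smFn_apply]; rfl)
        have h2 := fderivWithin_const_smul (c := r) (hS y y.2)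
          ((contDiffOn_smFn f).differentiableOn (by simp) y y.2)
        show fderivWithin ℝ (smFn (r • f)) S y v = r • fderivWithin ℝ (smFn f) S y v
        rw [h1, h2]; rfl }
    fun f g => smoothAlg_ext fun y => by
      have h1 : fderivWithin ℝ (smFn (f * g)) S y
          = fderivWithin ℝ (smFn f * smFn g) S y :=
        fderivWithin_congr (fun z hz => by
          rw [Pi.mul_apply, smFn_apply _ ⟨z, hz⟩, smFn_apply f ⟨z, hz⟩, smFn_apply g ⟨z, hz⟩]
          rfl) (by rw [Pi.mul_apply, smFn_apply, smFn_apply, smFn_apply]; rfl)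
      have h2 := fderivWithin_mul (hS y y.2)
        ((contDiffOn_smFn f).differentiableOn (by simp) y y.2)
        ((contDiffOn_smFn g).differentiableOn (by simp) y y.2)
      show fderivWithin ℝ (smFn (f * g)) S y v = f.1 y * fderivWithin ℝ (smFn g) S y v
        + g.1 y * fderivWithin ℝ (smFn f) S y v
      rw [h1, h2, smFn_apply, smFn_apply]
      rfl

lemma dirD_apply {S : Set E} (hS : UniqueDiffOn ℝ S) (v : E) (f : smoothAlg S) (y : S) :
    (dirD hS v f).1 y = fderivWithin ℝ (smFn f) S y v := rfl

lemma dirD_smMk {S : Set E} (hS : UniqueDiffOn ℝ S) (v : E) (F : E → ℝ)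
    (hF : ContDiffOn ℝ ∞ F S) (y : S) :
    (dirD hS v (smMk F hF)).1 y = fderivWithin ℝ F S y v := by
  rw [dirD_apply, fderivWithin_congr (smFn_smMk F hF) (smFn_smMk F hF y.2)]

lemma dirD_comm {S : Set E} (hS : UniqueDiffOn ℝ S) (hS' : S ⊆ closure (interior S)) (v w : E)
    (f : smoothAlg S) : dirD hS v (dirD hS w f) = dirD hS w (dirD hS v f) := by
  have key : ∀ (v w : E) (y : S), (dirD hS v (dirD hS w f)).1 y
      = fderivWithin ℝ (fderivWithin ℝ (smFn f) S) S y v w := by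
    intro v w y
    have h1 : dirD hS w f = smMk (fun z => fderivWithin ℝ (smFn f) S z w)
        (((contDiffOn_smFn f).fderivWithin hS (m := ∞) (by simp)).clm_apply contDiffOn_const) := rfl
    rw [h1, dirD_smMk, fderivWithin_clm_apply (hS y y.2)
      (((contDiffOn_smFn f).fderivWithin hS (m := ∞) (by simp)).differentiableOn (by simp) y y.2)
      (differentiableWithinAt_const _)]
    simp
  refine smoothAlg_ext fun y => ?_
  rw [key, key]
  exact ((contDiffOn_smFn f) y y.2).isSymmSndFDerivWithinAt
    (by rw [minSmoothness_of_isRCLikeNormedField]; exact WithTop.coe_le_coe.2 le_top) hS (hS' y.2)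
    y.2 v w

/-- Pullback of smooth functions along an affine map `c` with linear part `L`. -/
def pullback {S : Set E} {S' : Set E'} (c : E' → E) (L : E' →L[ℝ] E)
    (hc : ∀ z, HasFDerivAt c L z) (hm : MapsTo c S' S) : smoothAlg S →ₐ[ℝ] smoothAlg S' where
  toFun f := ⟨fun y => f.1 ⟨c y, hm y.2⟩, by
    have h1 : ContDiff ℝ ∞ c := by
      refine contDiff_infty_iff_fderiv.2 ⟨fun z => (hc z).differentiableAt, ?_⟩
      rw [show fderiv ℝ c = fun _ => L from funext fun z => (hc z).fderiv]
      exact contDiff_const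
    refine ((contDiffOn_smFn f).comp h1.contDiffOn hm).congr fun z hz => ?_
    rw [extendZ_of_mem _ hz, Function.comp_apply, smFn_apply f ⟨c z, hm hz⟩]⟩
  map_one' := rfl
  map_mul' _ _ := rfl
  map_zero' := rfl
  map_add' _ _ := rfl
  commutes' _ := rfl

lemma pullback_apply {S : Set E} {S' : Set E'} (c : E' → E) (L : E' →L[ℝ] E)
    (hc : ∀ z, HasFDerivAt c L z) (hm : MapsTo c S' S) (f : smoothAlg S) (y : S') :
    (pullback c L hc hm f).1 y = f.1 ⟨c y, hm y.2⟩ := rfl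

lemma dirD_pullback {S : Set E} {S' : Set E'} (hS : UniqueDiffOn ℝ S) (hS' : UniqueDiffOn ℝ S')
    (c : E' → E) (L : E' →L[ℝ] E) (hc : ∀ z, HasFDerivAt c L z) (hm : MapsTo c S' S)
    (v : E') (f : smoothAlg S) :
    pullback c L hc hm (dirD hS (L v) f) = dirD hS' v (pullback c L hc hm f) := by
  refine smoothAlg_ext fun y => ?_
  rw [pullback_apply, dirD_apply, dirD_apply]
  have h1 : fderivWithin ℝ (smFn (pullback c L hc hm f)) S' y
      = fderivWithin ℝ (smFn f ∘ c) S' y := by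
    have : EqOn (smFn (pullback c L hc hm f)) (smFn f ∘ c) S' := fun z hz => by
      rw [smFn_apply _ ⟨z, hz⟩, Function.comp_apply, smFn_apply f ⟨c z, hm hz⟩, pullback_apply]
    exact fderivWithin_congr this (this y.2)
  rw [h1, fderivWithin_comp y.1 ((contDiffOn_smFn f).differentiableOn (by simp) _ (hm y.2))
    (hc y).differentiableAt.differentiableWithinAt hm (hS' y y.2),
    (hc y).hasFDerivWithinAt.fderivWithin (hS' y y.2)]
  rfl

lemma isUnit_smoothAlg {S : Set E} {f : smoothAlg S} (h : ∀ y, f.1 y ≠ 0) : IsUnit f := by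
  refine IsUnit.of_mul_eq_one (smMk (fun z => (smFn f z)⁻¹) ((contDiffOn_smFn f).inv
    fun z hz => ?_)) (smoothAlg_ext fun y => ?_)
  · rw [smFn_apply f ⟨z, hz⟩]; exact h _
  · show f.1 y * (smFn f y)⁻¹ = 1
    rw [smFn_apply, mul_inv_cancel₀ (h y)]

variable {ι : Type*}

/-- A matrix of smooth functions. -/
def smMat {S : Set E} (G : E → Matrix ι ι ℝ) (hG : ∀ i j, ContDiffOn ℝ ∞ (fun z => G z i j) S) :
    Matrix ι ι (smoothAlg S) := Matrix.of fun i j => smMk (fun z => G z i j) (hG i j)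

@[simp] lemma smMat_map {S : Set E} (G : E → Matrix ι ι ℝ)
    (hG : ∀ i j, ContDiffOn ℝ ∞ (fun z => G z i j) S) (y : S) :
    (smMat G hG).map (evalAt y) = G y := rfl

variable [Fintype ι] [DecidableEq ι]

lemma isUnit_det_smoothAlg {S : Set E} {A : Matrix ι ι (smoothAlg S)}
    (h : ∀ y, (A.map (evalAt y)).det ≠ 0) : IsUnit A.det := by
  refine isUnit_smoothAlg fun y => ?_
  have := h y
  rwa [show A.map (evalAt y) = (evalAt y).mapMatrix A from rfl, ← AlgHom.map_det] at this

/-- The Christoffel symbols of the components `G` are those computed in the algebra of smooth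
functions. -/
lemma christoffel_eq_chr {S : Set E} (hS : IsOpen S) (e : ι → E) {G : E → Matrix ι ι ℝ}
    {A : Matrix ι ι (smoothAlg S)} (hA : ∀ y : S, A.map (evalAt y) = G y)
    (hu : IsUnit A.det) (k i j : ι) (y : S) :
    christoffel e G k i j y
      = evalAt y (chr (fun i => dirD hS.uniqueDiffOn (e i)) A i k j) := by
  have hD : ∀ i k l, partialD e (fun z => G z k l) i y
      = evalAt y (dirD hS.uniqueDiffOn (e i) (A k l)) := by
    intro i k l
    rw [evalAt_apply, dirD_apply, fderivWithin_of_isOpen hS y.2, partialD]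
    congr 1
    refine Filter.EventuallyEq.fderiv_eq ?_
    filter_upwards [hS.mem_nhds y.2] with z hz
    rw [smFn_apply (A k l) ⟨z, hz⟩, ← hA ⟨z, hz⟩]; rfl
  have hinv : (G y)⁻¹ = (A⁻¹).map (evalAt y) := by rw [map_inv_of_isUnit _ hu, hA]
  simp only [christoffel, chr, Matrix.of_apply, map_smul, map_sum, map_mul, map_add, map_sub, hD,
    hinv, Matrix.map_apply, smul_eq_mul]

lemma riemannUp_eq_curv {S : Set E} (hS : IsOpen S) (e : ι → E) {G : E → Matrix ι ι ℝ}
    {A : Matrix ι ι (smoothAlg S)} (hA : ∀ y : S, A.map (evalAt y) = G y)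
    (hu : IsUnit A.det) (i j k l : ι) (y : S) :
    riemannUp e G i j k l y = evalAt y (curv (fun i => dirD hS.uniqueDiffOn (e i))
      (chr (fun i => dirD hS.uniqueDiffOn (e i)) A) k l i j) := by
  have hD : ∀ m k i j, partialD e (christoffel e G k i j) m y
      = evalAt y (dirD hS.uniqueDiffOn (e m)
        (chr (fun i => dirD hS.uniqueDiffOn (e i)) A i k j)) := by
    intro m k i j
    rw [evalAt_apply, dirD_apply, fderivWithin_of_isOpen hS y.2, partialD]
    congr 1
    refine Filter.EventuallyEq.fderiv_eq ?_
    filter_upwards [hS.mem_nhds y.2] with z hz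
    rw [smFn_apply _ ⟨z, hz⟩, christoffel_eq_chr hS e hA hu k i j ⟨z, hz⟩, evalAt_apply]
  simp only [riemannUp, hD, christoffel_eq_chr hS e hA hu, curv, Matrix.add_apply,
    Matrix.sub_apply, matD_apply, Matrix.mul_apply, map_add, map_sub, map_sum, map_mul,
    Finset.sum_sub_distrib]

lemma riemann_eq_curv {S : Set E} (hS : IsOpen S) (e : ι → E) {G : E → Matrix ι ι ℝ}
    {A : Matrix ι ι (smoothAlg S)} (hA : ∀ y : S, A.map (evalAt y) = G y)
    (hu : IsUnit A.det) (i j k l : ι) (y : S) :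
    riemann e G i j k l y = evalAt y ((A * curv (fun i => dirD hS.uniqueDiffOn (e i))
      (chr (fun i => dirD hS.uniqueDiffOn (e i)) A) k l) i j) := by
  simp only [riemann, riemannUp_eq_curv hS e hA hu, Matrix.mul_apply, map_sum, map_mul, ← hA y,
    Matrix.map_apply]

lemma ricci_eq_ric {S : Set E} (hS : IsOpen S) (e : ι → E) {G : E → Matrix ι ι ℝ}
    {A : Matrix ι ι (smoothAlg S)} (hA : ∀ y : S, A.map (evalAt y) = G y)
    (hu : IsUnit A.det) (y : S) :
    ricci e G y = (ric (fun i => dirD hS.uniqueDiffOn (e i))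
      (chr (fun i => dirD hS.uniqueDiffOn (e i)) A)).map (evalAt y) := by
  ext j l
  simp only [ricci, ric, Matrix.of_apply, Matrix.map_apply, map_sum,
    riemannUp_eq_curv hS e hA hu]

end SmoothAlg

/-! ### Functions smooth up to the boundary `x = 0` -/

section Interval

lemma dirD_one_eq_derivWithin {I : Set ℝ} (hI : UniqueDiffOn ℝ I) (f : smoothAlg I) :
    EqOn (smFn (dirD hI 1 f)) (derivWithin (smFn f) I) I := fun x hx => by
  rw [smFn_apply _ ⟨x, hx⟩, dirD_apply]; rfl

lemma iteratedDerivWithin_smFn {I : Set ℝ} (hI : UniqueDiffOn ℝ I) (j : ℕ) (f : smoothAlg I) :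
    EqOn (iteratedDerivWithin j (smFn f) I) (smFn ((dirD hI 1)^[j] f)) I := by
  induction j generalizing f with
  | zero => intro x _; simp
  | succ j ih =>
    intro x hx
    rw [iteratedDerivWithin_succ', Function.iterate_succ_apply, ← ih (dirD hI 1 f) hx]
    exact iteratedDerivWithin_congr (dirD_one_eq_derivWithin hI f).symm hx

lemma iteratedDerivWithin_Ici_eq {a : ℝ} (ha : 0 < a) (j : ℕ) (F : ℝ → ℝ) :
    iteratedDerivWithin j F (Ici 0) 0 = iteratedDerivWithin j F (Ico 0 a) 0 := by
  rw [iteratedDerivWithin, iteratedDerivWithin, iteratedFDerivWithin_congr_set]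
  filter_upwards [Iio_mem_nhds ha] with x hx
  exact propext ⟨fun h => ⟨h, hx⟩, fun h => h.1⟩

/-- The derivatives of order less than `m` of a function that is `O(x^m)` vanish. -/
lemma iteratedDerivWithin_eq_zero_of_isBigO {a : ℝ} (ha : 0 < a) {F : ℝ → ℝ}
    (hF : ContDiffOn ℝ ∞ F (Ico 0 a)) {m : ℕ} (h : F =O[𝓝[>] 0] fun x => x ^ m) (j : ℕ)
    (hj : j < m) : iteratedDerivWithin j F (Ico 0 a) 0 = 0 := by
  induction j using Nat.strong_induction_on with
  | _ j ih =>
    have h1 := taylor_isLittleO (convex_Ico (0 : ℝ) a) ⟨le_rfl, ha⟩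
      (hF.of_le (m := j) (mod_cast le_top))
    have h2 : 𝓝[>] (0 : ℝ) ≤ 𝓝[Ico 0 a] 0 := by
      rw [← nhdsWithin_Ioo_eq_nhdsGT ha]
      exact nhdsWithin_mono _ Ioo_subset_Ico_self
    have h3 : ∀ x, taylorWithinEval F j (Ico 0 a) 0 x
        = ((j.factorial : ℝ)⁻¹ * iteratedDerivWithin j F (Ico 0 a) 0) * x ^ j := by
      intro x
      rw [taylor_within_apply, Finset.sum_range_succ, Finset.sum_eq_zero]
      · simp; ring
      · intro k hk
        rw [ih k (Finset.mem_range.1 hk) (by have := Finset.mem_range.1 hk; omega), smul_zero]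
    simp only [h3, sub_zero] at h1
    have h4 : F =o[𝓝[>] 0] fun x => x ^ j :=
      h.trans_isLittleO ((isLittleO_pow_pow hj).mono nhdsWithin_le_nhds)
    have h5 := h4.sub (h1.mono h2)
    simp only [sub_sub_cancel] at h5
    set c := (j.factorial : ℝ)⁻¹ * iteratedDerivWithin j F (Ico 0 a) 0
    have hc : c = 0 := by
      by_contra hc
      have h6 : (fun x : ℝ => x ^ j) =o[𝓝[>] 0] fun x => x ^ j :=
        (isLittleO_const_mul_left_iff hc).1 h5
      obtain ⟨x, hx, hx'⟩ := ((h6.def (c := 1 / 2) (by norm_num)).and self_mem_nhdsWithin).exists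
      have h7 : 0 < ‖x ^ j‖ := norm_pos_iff.2 (pow_pos (mem_Ioi.1 hx') j).ne'
      linarith
    have hj' : (j.factorial : ℝ)⁻¹ ≠ 0 := by positivity
    exact (mul_eq_zero.1 hc).resolve_left hj'

end Interval

section Collar

variable {n : ℕ} {Y : Set (Eu n)} {a : ℝ}

lemma uniqueDiffOn_collar (hY : IsOpen Y) (a : ℝ) : UniqueDiffOn ℝ (Y ×ˢ Ico (0 : ℝ) a) :=
  hY.uniqueDiffOn.prod (uniqueDiffOn_Ico 0 a)

lemma collar_subset_closure (hY : IsOpen Y) (ha : 0 < a) :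
    Y ×ˢ Ico (0 : ℝ) a ⊆ closure (interior (Y ×ˢ Ico (0 : ℝ) a)) := by
  rw [interior_prod_eq, closure_prod_eq, interior_Ico, closure_Ioo ha.ne, hY.interior_eq]
  exact prod_mono subset_closure Ico_subset_Icc_self

/-- The coordinate derivatives on `Y × [0, a)`. -/
def collarD (hY : IsOpen Y) (a : ℝ) (i : Fin n ⊕ Unit) :
    Derivation ℝ (smoothAlg (Y ×ˢ Ico (0 : ℝ) a)) (smoothAlg (Y ×ˢ Ico (0 : ℝ) a)) :=
  dirD (uniqueDiffOn_collar hY a) (stdVecPlus n i)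

/-- The coordinate `x` as a smooth function. -/
def coordX (S : Set (Eu n × ℝ)) : smoothAlg S := smMk Prod.snd contDiff_snd.contDiffOn

lemma dirD_coordX {S : Set (Eu n × ℝ)} (hS : UniqueDiffOn ℝ S) (v : Eu n × ℝ) :
    dirD hS v (coordX S) = algebraMap ℝ _ v.2 := by
  refine smoothAlg_ext fun y => ?_
  rw [coordX, dirD_smMk, fderivWithin_snd (hS y y.2)]
  rfl

lemma hasFDerivAt_bottom (y : Eu n) : HasFDerivAt (fun y : Eu n => (y, (0 : ℝ)))
    (ContinuousLinearMap.inl ℝ (Eu n) ℝ) y := hasFDerivAt_prodMk_left y 0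

lemma hasFDerivAt_fiber (y : Eu n) (x : ℝ) : HasFDerivAt (fun x : ℝ => (y, x))
    (ContinuousLinearMap.inr ℝ (Eu n) ℝ) x := hasFDerivAt_prodMk_right y x

lemma mapsTo_bottom (ha : 0 < a) : MapsTo (fun y : Eu n => (y, (0 : ℝ))) Y (Y ×ˢ Ico (0 : ℝ) a) :=
  fun _ hy => ⟨hy, le_rfl, ha⟩

lemma mapsTo_fiber {y : Eu n} (hy : y ∈ Y) (a : ℝ) :
    MapsTo (fun x : ℝ => (y, x)) (Ico 0 a) (Y ×ˢ Ico (0 : ℝ) a) := fun _ hx => ⟨hy, hx⟩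

/-- The ideal of the functions on `Y × [0, a)` that vanish at `x = 0`. -/
def bottomIdeal (ha : 0 < a) : Ideal (smoothAlg (Y ×ˢ Ico (0 : ℝ) a)) :=
  RingHom.ker (pullback _ _ hasFDerivAt_bottom (mapsTo_bottom (Y := Y) ha))

lemma mem_bottomIdeal (ha : 0 < a) {F : smoothAlg (Y ×ˢ Ico (0 : ℝ) a)} :
    F ∈ bottomIdeal ha ↔ ∀ y : Y, F.1 ⟨(y, 0), mapsTo_bottom ha y.2⟩ = 0 := by
  rw [bottomIdeal, RingHom.mem_ker]
  exact ⟨fun h y => congrFun (congrArg Subtype.val h) y, fun h => smoothAlg_ext h⟩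

lemma collarD_mem_bottomIdeal (hY : IsOpen Y) (ha : 0 < a) (i : Fin n)
    (F : smoothAlg (Y ×ˢ Ico (0 : ℝ) a)) (hF : F ∈ bottomIdeal ha) :
    collarD hY a (Sum.inl i) F ∈ bottomIdeal ha := by
  have h := dirD_pullback (uniqueDiffOn_collar hY a) hY.uniqueDiffOn _ _ hasFDerivAt_bottom
    (mapsTo_bottom ha) (stdVec n i) F
  rw [bottomIdeal, RingHom.mem_ker] at hF ⊢
  rw [hF, map_zero] at h
  exact h

lemma collarD_comm (hY : IsOpen Y) (ha : 0 < a) (i j : Fin n ⊕ Unit)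
    (F : smoothAlg (Y ×ˢ Ico (0 : ℝ) a)) :
    collarD hY a i (collarD hY a j F) = collarD hY a j (collarD hY a i F) :=
  dirD_comm _ (collar_subset_closure hY ha) _ _ _

lemma coordX_mem_bottomIdeal (ha : 0 < a) :
    coordX (Y ×ˢ Ico (0 : ℝ) a) ∈ bottomIdeal ha := (mem_bottomIdeal ha).2 fun _ => rfl

lemma collarD_coordX (hY : IsOpen Y) (a : ℝ) :
    collarD hY a (Sum.inr ()) (coordX _) = 1 := by
  rw [collarD, dirD_coordX]; exact map_one _

/-- The `x`-derivatives on `Y × [0, a)` are the derivatives along the fibers. -/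
lemma iterate_collarD_apply (hY : IsOpen Y) (a : ℝ) (j : ℕ)
    (F : smoothAlg (Y ×ˢ Ico (0 : ℝ) a)) (y : Y) (x : ℝ) (hx : x ∈ Ico 0 a) :
    ((collarD hY a (Sum.inr ()))^[j] F).1 ⟨(y, x), y.2, hx⟩
      = iteratedDerivWithin j (fun x => smFn F (y, x)) (Ico 0 a) x := by
  set ρ := pullback _ _ (hasFDerivAt_fiber y.1) (mapsTo_fiber y.2 a) with hρ
  have h1 : ∀ K, ρ (collarD hY a (Sum.inr ()) K) = dirD (uniqueDiffOn_Ico 0 a) 1 (ρ K) := fun K =>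
    dirD_pullback (uniqueDiffOn_collar hY a) (uniqueDiffOn_Ico 0 a) _ _ (hasFDerivAt_fiber y.1)
      (mapsTo_fiber y.2 a) 1 K
  have h2 : ∀ (j : ℕ) K, ρ ((collarD hY a (Sum.inr ()))^[j] K)
      = (dirD (uniqueDiffOn_Ico 0 a) 1)^[j] (ρ K) := by
    intro j
    induction j with
    | zero => intro K; rfl
    | succ j ih => intro K; rw [Function.iterate_succ_apply, ih, h1, Function.iterate_succ_apply]
  have h3 : EqOn (fun x => smFn F (y, x)) (smFn (ρ F)) (Ico 0 a) := fun x hx => by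
    rw [smFn_apply (ρ F) ⟨x, hx⟩, hρ, pullback_apply]
    exact smFn_apply F ⟨(y, x), y.2, hx⟩
  rw [iteratedDerivWithin_congr h3 hx, iteratedDerivWithin_smFn (uniqueDiffOn_Ico 0 a) j (ρ F) hx,
    ← h2, smFn_apply _ ⟨x, hx⟩]
  rfl

/-- A smooth function that is `O(x^m)` at every point vanishes to order `m`. -/
lemma mem_ordIdeal_of_isBigO (hY : IsOpen Y) (ha : 0 < a) {F : smoothAlg (Y ×ˢ Ico (0 : ℝ) a)}
    {m : ℕ} (h : ∀ y ∈ Y, (fun x : ℝ => smFn F (y, x)) =O[𝓝[>] 0] fun x => x ^ m) :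
    F ∈ ordIdeal (collarD hY a (Sum.inr ())) (bottomIdeal ha) m := by
  rw [mem_ordIdeal_iff]
  intro j hj
  rw [mem_bottomIdeal]
  intro y
  rw [iterate_collarD_apply hY a j F y 0 ⟨le_rfl, ha⟩]
  refine iteratedDerivWithin_eq_zero_of_isBigO ha ?_ (h y y.2) j hj
  exact (contDiffOn_smFn F).comp (contDiff_prodMk_right y.1).contDiffOn (mapsTo_fiber y.2 a)

lemma mem_ordIdeal_of_forall_pos (hY : IsOpen Y) (ha : 0 < a)
    {F : smoothAlg (Y ×ˢ Ico (0 : ℝ) a)}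
    (h : ∀ (y : Y) (x : ℝ) (hx : x ∈ Ioo 0 a), F.1 ⟨(y, x), y.2, Ioo_subset_Ico_self hx⟩ = 0)
    (m : ℕ) : F ∈ ordIdeal (collarD hY a (Sum.inr ())) (bottomIdeal ha) m := by
  refine mem_ordIdeal_of_isBigO hY ha fun y hy => ?_
  refine EventuallyEq.trans_isBigO ?_ (isBigO_zero _ _)
  filter_upwards [Ioo_mem_nhdsGT ha] with x hx
  rw [smFn_apply F ⟨(y, x), hy, Ioo_subset_Ico_self hx⟩]
  exact h ⟨y, hy⟩ x hx

/-- Functions that agree to order `m + 1` have the same Taylor coefficients up to order `m`. -/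
lemma iteratedDerivWithin_eq_of_sub_mem (hY : IsOpen Y) (ha : 0 < a)
    {F K : smoothAlg (Y ×ˢ Ico (0 : ℝ) a)} {m : ℕ}
    (h : F - K ∈ ordIdeal (collarD hY a (Sum.inr ())) (bottomIdeal ha) m) (y : Y) {j : ℕ}
    (hj : j < m) : iteratedDerivWithin j (fun x => smFn F (y, x)) (Ici 0) 0
      = iteratedDerivWithin j (fun x => smFn K (y, x)) (Ici 0) 0 := by
  rw [iteratedDerivWithin_Ici_eq ha, iteratedDerivWithin_Ici_eq ha,
    ← iterate_collarD_apply hY a j F y 0 ⟨le_rfl, ha⟩,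
    ← iterate_collarD_apply hY a j K y 0 ⟨le_rfl, ha⟩]
  have h1 := (mem_bottomIdeal ha).1 (mem_ordIdeal_iff.1 h j hj) y
  rw [iterate_map_sub] at h1
  exact sub_eq_zero.1 h1

end Collar

/-! ### Conformally flat metrics in coordinates -/

section Naturality

variable {R S ι : Type*} [CommRing R] [Algebra ℝ R] [CommRing S] [Algebra ℝ S] [Fintype ι]
  {D : ι → Derivation ℝ R R} {D' : ι → Derivation ℝ S S}

lemma IsLC.map {G : Matrix ι ι R} {Γ : ι → Matrix ι ι R} (H : IsLC D G Γ) (ρ : R →ₐ[ℝ] S)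
    (h : ∀ i r, ρ (D i r) = D' i (ρ r)) : IsLC D' (G.map ρ) (fun k => (Γ k).map ρ) := by
  refine ⟨fun i j k => congrArg ρ (H.torsion i j k), fun k => ?_⟩
  rw [← matD_map (D k) (D' k) ρ (h k), H.compat k, ← Matrix.map_mul]
  ext i j
  exact map_add ρ _ _

variable [DecidableEq ι]

lemma IsSchouten.map {G : Matrix ι ι R} {Γ : ι → Matrix ι ι R} {b : Matrix ι ι R}
    (H : IsSchouten D G Γ b) (ρ : R →ₐ[ℝ] S) (h : ∀ i r, ρ (D i r) = D' i (ρ r)) :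
    IsSchouten D' (G.map ρ) (fun k => (Γ k).map ρ) (b.map ρ) := by
  refine ⟨?_, fun k l i j => ?_, fun i k l => ?_⟩
  · rw [← Matrix.map_mul, ← Matrix.transpose_map, H.symm]
  · rw [← curv_map ρ h, ← Matrix.map_mul, Matrix.map_apply, H.curvature]
    simp [Matrix.one_apply, apply_ite ρ]
  · rw [← Matrix.map_mul, ← Matrix.map_mul]
    simp only [Matrix.map_apply, ← h, ← map_add, H.codazzi]

end Naturality

variable {n : ℕ}

/-- On the open set `Y`, the matrices `G` are the components of a smooth pseudo-Riemannian metric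
and `e^{2f} G` is flat. -/
structure IsFlatPatch (Y : Set (Eu n)) (G : Eu n → Matrix (Fin n) (Fin n) ℝ) (f : Eu n → ℝ) :
    Prop where
  isOpen : IsOpen Y
  smooth : ∀ i j, ContDiffOn ℝ ∞ (fun y => G y i j) Y
  symm : ∀ y ∈ Y, (G y)ᵀ = G y
  det_ne : ∀ y ∈ Y, (G y).det ≠ 0
  smooth_factor : ContDiffOn ℝ ∞ f Y
  flat : ∀ y ∈ Y, ∀ i j k l,
    riemann (stdVec n) (fun z => Real.exp (2 * f z) • G z) i j k l y = 0

/-- The coordinate derivatives on an open subset of `ℝⁿ`. -/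
def baseD {Y : Set (Eu n)} (hY : IsOpen Y) (i : Fin n) :
    Derivation ℝ (smoothAlg Y) (smoothAlg Y) := dirD hY.uniqueDiffOn (stdVec n i)

lemma baseD_comm {Y : Set (Eu n)} (hY : IsOpen Y) (i j : Fin n) (F : smoothAlg Y) :
    baseD hY i (baseD hY j F) = baseD hY j (baseD hY i F) :=
  dirD_comm _ (by rw [hY.interior_eq]; exact subset_closure) _ _ _

namespace IsFlatPatch

variable {Y : Set (Eu n)} {G : Eu n → Matrix (Fin n) (Fin n) ℝ} {f : Eu n → ℝ}

lemma mono (H : IsFlatPatch Y G f) {Y' : Set (Eu n)} (hY' : IsOpen Y') (h : Y' ⊆ Y) :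
    IsFlatPatch Y' G f where
  isOpen := hY'
  smooth i j := (H.smooth i j).mono h
  symm y hy := H.symm y (h hy)
  det_ne y hy := H.det_ne y (h hy)
  smooth_factor := H.smooth_factor.mono h
  flat y hy := H.flat y (h hy)

lemma isUnit_det (H : IsFlatPatch Y G f) : IsUnit (smMat G H.smooth).det :=
  isUnit_det_smoothAlg fun y => H.det_ne y y.2

lemma transpose_smMat (H : IsFlatPatch Y G f) : (smMat G H.smooth)ᵀ = smMat G H.smooth := by
  ext1 i j
  exact smoothAlg_ext fun y => congrFun (congrFun (H.symm y y.2) i) j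

/-- The Schouten endomorphism as a matrix of smooth functions. -/
def schoutenMat (H : IsFlatPatch Y G f) : Matrix (Fin n) (Fin n) (smoothAlg Y) :=
  confSchouten (baseD H.isOpen) (smMat G H.smooth) (smMk f H.smooth_factor)

lemma isLC (H : IsFlatPatch Y G f) : IsLC (baseD H.isOpen) (smMat G H.smooth)
    (chr (baseD H.isOpen) (smMat G H.smooth)) := chr_isLC _ H.isUnit_det H.transpose_smMat

lemma isSchouten (H : IsFlatPatch Y G f) : IsSchouten (baseD H.isOpen) (smMat G H.smooth)
    (chr (baseD H.isOpen) (smMat G H.smooth)) H.schoutenMat := by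
  have hw : ContDiffOn ℝ ∞ (fun z => Real.exp (2 * f z)) Y :=
    (contDiffOn_const.mul H.smooth_factor).exp
  set w : smoothAlg Y := smMk _ hw with hwdef
  have hwu : IsUnit w := isUnit_smoothAlg fun y => (Real.exp_pos _).ne'
  have hu : IsUnit (w • smMat G H.smooth).det := by
    rw [Matrix.det_smul]; exact (hwu.pow _).mul H.isUnit_det
  refine isSchouten_confSchouten (baseD_comm H.isOpen) H.isUnit_det H.transpose_smMat hwu
    (fun k => smoothAlg_ext fun y => ?_) fun k l => ?_
  · have h1 : HasFDerivWithinAt f (fderivWithin ℝ f Y y) Y y :=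
      (H.smooth_factor.differentiableOn (by simp) y y.2).hasFDerivWithinAt
    have h2 := ((h1.const_mul 2).exp).fderivWithin (H.isOpen.uniqueDiffOn y y.2)
    show (dirD _ _ (smMk _ _)).1 y = Real.exp (2 * f y) * (dirD _ _ (smMk _ _)).1 y
      + Real.exp (2 * f y) * (dirD _ _ (smMk _ _)).1 y
    rw [dirD_smMk, dirD_smMk, h2]
    simp
    ring
  · have hev : ∀ y : Y, (w • smMat G H.smooth).map (evalAt y) = Real.exp (2 * f y) • G y := by
      intro y
      ext i j
      simp [smMat, evalAt_apply, smMk, hwdef]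
    have h0 : w • smMat G H.smooth * curv (baseD H.isOpen)
        (chr (baseD H.isOpen) (w • smMat G H.smooth)) k l = 0 := by
      ext1 i j
      refine smoothAlg_ext fun y => ?_
      have h1 := riemann_eq_curv H.isOpen (stdVec n) (G := fun z => Real.exp (2 * f z) • G z)
        hev hu i j k l y
      rw [H.flat y y.2] at h1
      exact h1.symm
    calc _ = (w • smMat G H.smooth)⁻¹ * (w • smMat G H.smooth * curv (baseD H.isOpen)
        (chr (baseD H.isOpen) (w • smMat G H.smooth)) k l) := by
          rw [← Matrix.mul_assoc, Matrix.nonsing_inv_mul _ hu, Matrix.one_mul]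
      _ = 0 := by rw [h0, Matrix.mul_zero]

lemma map_schoutenMat (H : IsFlatPatch Y G f) (hn : 2 < n) (y : Y) :
    H.schoutenMat.map (evalAt y) = schoutenEnd G y := by
  set b := H.schoutenMat.map (evalAt y) with hb
  have hG : (smMat G H.smooth).map (evalAt y) = G y := rfl
  have hdet : IsUnit (G y).det := (H.det_ne y y.2).isUnit
  have hric : ricci (stdVec n) G y = ((n : ℝ) - 2) • (G y * b) + b.trace • G y := by
    rw [ricci_eq_ric H.isOpen (stdVec n) (fun y => smMat_map G H.smooth y) H.isUnit_det y]
    have h1 := H.isSchouten.ric_eq H.transpose_smMat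
    have h2 := congrArg (fun M : Matrix (Fin n) (Fin n) (smoothAlg Y) => M.map (evalAt y)) h1
    have h3 : (smMat G H.smooth * H.schoutenMat).map (evalAt y) = G y * b := by
      rw [Matrix.map_mul, hG]
    have h4 : evalAt y H.schoutenMat.trace = b.trace := by
      simp [Matrix.trace, hb]
    refine h2.trans ?_
    rw [← h3, ← h4, ← hG]
    ext i j
    simp only [Matrix.map_apply, Matrix.add_apply, Matrix.smul_apply, smul_eq_mul, map_add, map_mul,
      map_sub, map_natCast, map_ofNat, Fintype.card_fin]
  have htr : metricTrace (G y) (G y * b) = b.trace := by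
    have h1 : metricTrace (G y) (G y * b) = ((G y)⁻¹ᵀ * (G y * b)).trace := by
      simp only [metricTrace, Matrix.trace, Matrix.mul_apply (M := (G y)⁻¹ᵀ), Matrix.diag_apply,
        Matrix.transpose_apply]
      rw [Finset.sum_comm]
    rw [h1, Matrix.transpose_nonsing_inv, H.symm y y.2, ← Matrix.mul_assoc,
      Matrix.nonsing_inv_mul _ hdet, Matrix.one_mul]
  have htr' : metricTrace (G y) (G y) = n := by
    have h1 : metricTrace (G y) (G y) = ((G y)⁻¹ᵀ * G y).trace := by
      simp only [metricTrace, Matrix.trace, Matrix.mul_apply (M := (G y)⁻¹ᵀ), Matrix.diag_apply,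
        Matrix.transpose_apply]
      rw [Finset.sum_comm]
    rw [h1, Matrix.transpose_nonsing_inv, H.symm y y.2, Matrix.nonsing_inv_mul _ hdet]
    simp
  have hR : scalarCurv (stdVec n) G y = 2 * ((n : ℝ) - 1) * b.trace := by
    have h1 : metricTrace (G y) (((n : ℝ) - 2) • (G y * b) + b.trace • G y)
        = ((n : ℝ) - 2) * metricTrace (G y) (G y * b) + b.trace * metricTrace (G y) (G y) := by
      simp only [metricTrace, Finset.mul_sum, ← Finset.sum_add_distrib]
      refine Finset.sum_congr rfl fun i _ => Finset.sum_congr rfl fun j _ => ?_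
      simp only [Matrix.add_apply, Matrix.smul_apply, smul_eq_mul]
      ring
    rw [scalarCurv, hric, h1, htr, htr']
    ring
  have hn' : (2 : ℝ) < n := by exact_mod_cast hn
  have hP : schouten G y = G y * b := by
    have h1 : (n : ℝ) - 2 ≠ 0 := by linarith
    have h2 : (n : ℝ) - 1 ≠ 0 := by linarith
    rw [schouten, hric, hR]
    have h3 : 2 * ((n : ℝ) - 1) * b.trace / (2 * ((n : ℝ) - 1)) = b.trace := by
      field_simp
    rw [h3, add_sub_cancel_right, smul_smul, one_div, inv_mul_cancel₀ h1, one_smul]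
  rw [schoutenEnd, hP, ← Matrix.mul_assoc, Matrix.nonsing_inv_mul _ hdet, Matrix.one_mul]

lemma schoutenEnd_smooth (H : IsFlatPatch Y G f) (hn : 2 < n) (i j : Fin n) :
    ContDiffOn ℝ ∞ (fun y => schoutenEnd G y i j) Y :=
  (contDiffOn_smFn (H.schoutenMat i j)).congr fun y hy => by
    rw [smFn_apply _ ⟨y, hy⟩, ← H.map_schoutenMat hn ⟨y, hy⟩]; rfl

lemma mul_schoutenEnd_symm (H : IsFlatPatch Y G f) (hn : 2 < n) {y : Eu n} (hy : y ∈ Y) :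
    (G y * schoutenEnd G y)ᵀ = G y * schoutenEnd G y := by
  have h := congrArg (fun M : Matrix (Fin n) (Fin n) (smoothAlg Y) => M.map (evalAt ⟨y, hy⟩))
    H.isSchouten.symm
  have h3 : (smMat G H.smooth * H.schoutenMat).map (evalAt ⟨y, hy⟩) = G y * schoutenEnd G y := by
    rw [Matrix.map_mul, H.map_schoutenMat hn ⟨y, hy⟩]; rfl
  rw [← h3]
  exact h

end IsFlatPatch

/-- The family `g_x = g (1 - x² P / 2)²`. -/
def hypFamily (G : Eu n → Matrix (Fin n) (Fin n) ℝ) (x : ℝ) (y : Eu n) :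
    Matrix (Fin n) (Fin n) ℝ :=
  G y * hypA x (schoutenEnd G y) * hypA x (schoutenEnd G y)

lemma map_hypA {R S : Type*} [CommRing R] [Algebra ℝ R] [CommRing S] [Algebra ℝ S]
    {ι : Type*} [DecidableEq ι] (ρ : R →ₐ[ℝ] S) (x : R) (b : Matrix ι ι R) :
    (hypA x b).map ρ = hypA (ρ x) (b.map ρ) := by
  ext i j
  simp [hypA_apply, Matrix.one_apply, apply_ite ρ]

/-- The coordinate derivatives on an open subset of `ℝⁿ × ℝ`. -/
def openD {O : Set (Eu n × ℝ)} (hO : IsOpen O) (i : Fin n ⊕ Unit) :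
    Derivation ℝ (smoothAlg O) (smoothAlg O) := dirD hO.uniqueDiffOn (stdVecPlus n i)

lemma openD_comm {O : Set (Eu n × ℝ)} (hO : IsOpen O) (i j : Fin n ⊕ Unit) (F : smoothAlg O) :
    openD hO i (openD hO j F) = openD hO j (openD hO i F) :=
  dirD_comm _ (by rw [hO.interior_eq]; exact subset_closure) _ _ _

lemma openD_coordX_inl {O : Set (Eu n × ℝ)} (hO : IsOpen O) (i : Fin n) :
    openD hO (Sum.inl i) (coordX O) = 0 := by
  rw [openD, dirD_coordX]; exact map_zero _

lemma openD_coordX_inr {O : Set (Eu n × ℝ)} (hO : IsOpen O) :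
    openD hO (Sum.inr ()) (coordX O) = 1 := by
  rw [openD, dirD_coordX]; exact map_one _

/-- The function `x⁻¹` on a set where `x > 0`. -/
def coordXInv {O : Set (Eu n × ℝ)} (hO : ∀ z ∈ O, 0 < z.2) : smoothAlg O :=
  smMk (fun z => z.2⁻¹) (contDiff_snd.contDiffOn.inv fun z hz => (hO z hz).ne')

lemma coordX_mul_coordXInv {O : Set (Eu n × ℝ)} (hO : ∀ z ∈ O, 0 < z.2) :
    coordX O * coordXInv hO = 1 :=
  smoothAlg_ext fun z => mul_inv_cancel₀ (hO z z.2).ne'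

/-- The metric `x⁻² (dx² + g_x)` in the algebra of smooth functions. -/
lemma map_gPlus {O : Set (Eu n × ℝ)} (hO : ∀ z ∈ O, 0 < z.2)
    {h : ℝ → Eu n → Matrix (Fin n) (Fin n) ℝ} {g : Matrix (Fin n) (Fin n) (smoothAlg O)} (z : O)
    (hg : g.map (evalAt z) = h z.1.2 z.1.1) :
    ((coordXInv hO * coordXInv hO) • Matrix.fromBlocks g 0 0 1).map (evalAt z)
      = gPlus h z := by
  rw [gPlus, ← hg]
  have e : evalAt z (coordXInv hO * coordXInv hO) = (z.1.2 ^ 2)⁻¹ := by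
    rw [map_mul, sq, mul_inv]; rfl
  ext i j
  rw [Matrix.map_apply, Matrix.smul_apply, smul_eq_mul, map_mul, e]
  rcases i with i | i <;> rcases j with j | j <;> simp

/-- The metric `x⁻² (dx² + g_x)` with `g_x = g (1 - x² P / 2)²` is hyperbolic. -/
theorem IsFlatPatch.riemann_hypFamily {Y : Set (Eu n)} {G : Eu n → Matrix (Fin n) (Fin n) ℝ}
    {f : Eu n → ℝ} (H : IsFlatPatch Y G f) (hn : 2 < n) {O : Set (Eu n × ℝ)} (hO : IsOpen O)
    (hOY : ∀ z ∈ O, z.1 ∈ Y) (hpos : ∀ z ∈ O, 0 < z.2)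
    (hA : ∀ z ∈ O, (hypA z.2 (schoutenEnd G z.1)).det ≠ 0) {z : Eu n × ℝ} (hz : z ∈ O)
    (A B C F : Fin n ⊕ Unit) :
    riemann (stdVecPlus n) (gPlus (hypFamily G)) A B C F z =
      -(gPlus (hypFamily G) z A C * gPlus (hypFamily G) z B F
        - gPlus (hypFamily G) z A F * gPlus (hypFamily G) z B C) := by
  have hfst : ∀ z : Eu n × ℝ, HasFDerivAt (Prod.fst : Eu n × ℝ → Eu n)
    (ContinuousLinearMap.fst ℝ (Eu n) ℝ) z := fun z => hasFDerivAt_fst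
  set π : smoothAlg Y →ₐ[ℝ] smoothAlg O := pullback _ _ hfst hOY with hπ
  have hπD : ∀ i r, π (baseD H.isOpen i r) = openD hO (Sum.inl i) (π r) := fun i r =>
    dirD_pullback H.isOpen.uniqueDiffOn hO.uniqueDiffOn _ _ hfst hOY (stdVec n i, 0) r
  have hπx : ∀ r, openD hO (Sum.inr ()) (π r) = 0 := fun r => by
    have h := dirD_pullback H.isOpen.uniqueDiffOn hO.uniqueDiffOn _ _ hfst hOY (0, 1) r
    refine h.symm.trans ?_
    have h0 : dirD H.isOpen.uniqueDiffOn
        (ContinuousLinearMap.fst ℝ (Eu n) ℝ (0, 1)) r = 0 := smoothAlg_ext fun y => by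
      rw [dirD_apply, ContinuousLinearMap.coe_fst', map_zero]; rfl
    rw [h0, map_zero]
  have hπM : ∀ M : Matrix (Fin n) (Fin n) (smoothAlg Y),
      matD (openD hO (Sum.inr ())) (M.map π) = 0 := fun M => by
    ext1 i j; exact hπx _
  set G' := (smMat G H.smooth).map π with hG'
  set b := H.schoutenMat.map π with hb
  have hev : ∀ z : O, ∀ M : Matrix (Fin n) (Fin n) (smoothAlg Y),
      (M.map π).map (evalAt z) = M.map (evalAt ⟨z.1.1, hOY z z.2⟩) := fun z M => rfl
  have hevb : ∀ z : O, b.map (evalAt z) = schoutenEnd G z.1.1 := fun z => by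
    rw [hb, hev, H.map_schoutenMat hn]
  have hevA : ∀ z : O, (hypA (coordX O) b).map (evalAt z)
      = hypA z.1.2 (schoutenEnd G z.1.1) := fun z => by
    rw [map_hypA, hevb]; rfl
  have hevg : ∀ z : O, (G' * hypA (coordX O) b * hypA (coordX O) b).map (evalAt z)
      = hypFamily G z.1.2 z.1.1 := fun z => by
    rw [Matrix.map_mul, Matrix.map_mul, hevA, hG', hev, smMat_map]; rfl
  have hAu : IsUnit (hypA (coordX O) b).det := isUnit_det_smoothAlg fun z => by
    rw [hevA]; exact hA z z.2
  have hGu : IsUnit G'.det := isUnit_det_smoothAlg fun z => by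
    rw [hG', hev]; exact H.det_ne z.1.1 (hOY z z.2)
  have hxi := coordX_mul_coordXInv hpos
  set gp : Matrix (Fin n ⊕ Unit) (Fin n ⊕ Unit) (smoothAlg O) := (coordXInv hpos * coordXInv hpos)
    • Matrix.fromBlocks (G' * hypA (coordX O) b * hypA (coordX O) b) 0 0 1 with hgp
  have hgpev : ∀ z : O, gp.map (evalAt z) = gPlus (hypFamily G) z := fun z =>
    map_gPlus hpos z (hevg z)
  have hgpu : IsUnit gp.det := by
    rw [hgp, Matrix.det_smul, Matrix.det_fromBlocks_zero₂₁, Matrix.det_one, mul_one,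
      Matrix.det_mul, Matrix.det_mul]
    have hxiu : IsUnit (coordXInv hpos) := IsUnit.of_mul_eq_one _ (by rw [mul_comm]; exact hxi)
    exact ((hxiu.mul hxiu).pow _).mul ((hGu.mul hAu).mul hAu)
  have key := hyp_riemann (openD_comm hO) hxi (openD_coordX_inr hO) (openD_coordX_inl hO) hGu
    (by rw [hG', ← Matrix.transpose_map, H.transpose_smMat]) (H.isLC.map π hπD)
    (H.isSchouten.map π hπD) (hπM _) (hπM _) (fun k => hπM _) hAu hgp A B C F
  have h1 := riemann_eq_curv hO (stdVecPlus n) hgpev hgpu A B C F ⟨z, hz⟩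
  have h2 := congrArg (evalAt ⟨z, hz⟩) key
  rw [h1, ← hgpev ⟨z, hz⟩]
  refine h2.trans ?_
  simp

/-! ### The Einstein equation near the boundary -/

section Naturality

variable {R S ι : Type*} [CommRing R] [Algebra ℝ R] [CommRing S] [Algebra ℝ S]
  {d : Derivation ℝ R R} {d' : Derivation ℝ S S} {x : R}

lemma theta_map (ρ : R →ₐ[ℝ] S) (h : ∀ r, ρ (d r) = d' (ρ r)) (M : Matrix ι ι R) :
    (theta x d M).map ρ = theta (ρ x) d' (M.map ρ) := by
  ext i j
  simp [theta, h]

variable [Fintype ι]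

lemma map_trace (ρ : R →ₐ[ℝ] S) (M : Matrix ι ι R) : ρ M.trace = (M.map ρ).trace := by
  simp [Matrix.trace]

variable [DecidableEq ι] {g : Matrix ι ι R}

lemma einTan_map (ρ : R →ₐ[ℝ] S) (h : ∀ r, ρ (d r) = d' (ρ r)) (hg : IsUnit g.det)
    (r : Matrix ι ι R) :
    (einTan x d g r).map ρ = einTan (ρ x) d' (g.map ρ) (r.map ρ) := by
  simp only [einTan, ← theta_map ρ h, ← map_inv_of_isUnit ρ hg, ← Matrix.map_mul, ← map_trace]
  ext i j
  simp only [Matrix.map_apply, Matrix.add_apply, Matrix.sub_apply, Matrix.smul_apply, smul_eq_mul,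
    map_add, map_sub, map_mul, map_natCast, map_ofNat, AlgHom.commutes]

lemma einNor_map (ρ : R →ₐ[ℝ] S) (h : ∀ r, ρ (d r) = d' (ρ r)) (hg : IsUnit g.det) :
    ρ (einNor x d g) = einNor (ρ x) d' (g.map ρ) := by
  simp only [einNor, ← theta_map ρ h, ← map_inv_of_isUnit ρ hg, ← Matrix.map_mul, ← map_trace]
  simp only [map_sub, map_mul, map_ofNat, AlgHom.commutes]

lemma radialDefect_map (ρ : R →ₐ[ℝ] S) (h : ∀ r, ρ (d r) = d' (ρ r)) (hg : IsUnit g.det) :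
    (radialDefect x d g).map ρ = radialDefect (ρ x) d' (g.map ρ) := by
  simp only [radialDefect, ← theta_map ρ h, ← map_inv_of_isUnit ρ hg, ← Matrix.map_mul]
  ext i j
  simp only [Matrix.map_apply, Matrix.sub_apply, Matrix.smul_apply, smul_eq_mul,
    map_sub, map_mul, map_ofNat, AlgHom.commutes]

end Naturality

variable {n : ℕ}

/-- `h x`, for `x ∈ [0, a)`, are the components of a smooth family of metrics on `Y`. -/
structure IsCollarFamily (Y : Set (Eu n)) (a : ℝ) (h : ℝ → Eu n → Matrix (Fin n) (Fin n) ℝ) :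
    Prop where
  smooth : ∀ i j, ContDiffOn ℝ ∞ (fun z : Eu n × ℝ => h z.2 z.1 i j) (Y ×ˢ Ico (0 : ℝ) a)
  symm : ∀ y ∈ Y, ∀ x ∈ Ico 0 a, (h x y)ᵀ = h x y
  det_ne : ∀ y ∈ Y, ∀ x ∈ Ico 0 a, (h x y).det ≠ 0

namespace IsCollarFamily

variable {Y : Set (Eu n)} {a : ℝ} {h : ℝ → Eu n → Matrix (Fin n) (Fin n) ℝ}

/-- The family as a matrix of smooth functions on `Y × [0, a)`. -/
def mat (H : IsCollarFamily Y a h) : Matrix (Fin n) (Fin n) (smoothAlg (Y ×ˢ Ico (0 : ℝ) a)) :=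
  smMat (fun z => h z.2 z.1) H.smooth

lemma map_mat (H : IsCollarFamily Y a h) (z : ↥(Y ×ˢ Ico (0 : ℝ) a)) :
    H.mat.map (evalAt z) = h z.1.2 z.1.1 := rfl

lemma isUnit_det (H : IsCollarFamily Y a h) : IsUnit H.mat.det :=
  isUnit_det_smoothAlg fun z => H.det_ne z.1.1 z.2.1 z.1.2 z.2.2

lemma transpose_mat (H : IsCollarFamily Y a h) : H.matᵀ = H.mat := by
  ext1 i j
  exact smoothAlg_ext fun z => congrFun (congrFun (H.symm z.1.1 z.2.1 z.1.2 z.2.2) i) j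

/-- The tangential Einstein tensor as a matrix of functions smooth up to `x = 0`. -/
def tan (H : IsCollarFamily Y a h) (hY : IsOpen Y) :
    Matrix (Fin n) (Fin n) (smoothAlg (Y ×ˢ Ico (0 : ℝ) a)) :=
  einTan (coordX _) (collarD hY a (Sum.inr ())) H.mat
    (ric (fun i => collarD hY a (Sum.inl i)) (chr (fun i => collarD hY a (Sum.inl i)) H.mat))

/-- The functions `tan`, `einNor` and `radialDefect` are, up to the factor `-2 x²`, components of
the curvature of `x⁻² (dx² + h_x)`. -/
lemma curvature_components (H : IsCollarFamily Y a h) (hY : IsOpen Y) {y : Eu n} (hy : y ∈ Y)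
    {x : ℝ} (hx : x ∈ Ioo 0 a) :
    (∀ j l, evalAt (S := Y ×ˢ Ico (0 : ℝ) a) ⟨(y, x), hy, Ioo_subset_Ico_self hx⟩ (H.tan hY j l)
      = -(2 * x * x) * einsteinDefect h (y, x) (Sum.inl j) (Sum.inl l)) ∧
    evalAt (S := Y ×ˢ Ico (0 : ℝ) a) ⟨(y, x), hy, Ioo_subset_Ico_self hx⟩
        (einNor (coordX _) (collarD hY a (Sum.inr ())) H.mat)
      = -(2 * x * x) * einsteinDefect h (y, x) (Sum.inr ()) (Sum.inr ()) ∧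
    (∀ j l, evalAt (S := Y ×ˢ Ico (0 : ℝ) a) ⟨(y, x), hy, Ioo_subset_Ico_self hx⟩
        (radialDefect (coordX _) (collarD hY a (Sum.inr ())) H.mat j l)
      = -(2 * x * x) * (riemannUp (stdVecPlus n) (gPlus h) (Sum.inr ()) (Sum.inl j) (Sum.inr ())
          (Sum.inl l) (y, x) + gPlus h (y, x) (Sum.inl j) (Sum.inl l))) := by
  set O : Set (Eu n × ℝ) := Y ×ˢ Ioo (0 : ℝ) a with hOdef
  have hO : IsOpen O := hY.prod isOpen_Ioo
  have hpos : ∀ z ∈ O, 0 < z.2 := fun z hz => hz.2.1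
  have hid : ∀ z : Eu n × ℝ, HasFDerivAt (id : Eu n × ℝ → Eu n × ℝ)
    (ContinuousLinearMap.id ℝ (Eu n × ℝ)) z := fun z => hasFDerivAt_id z
  have hOS : MapsTo id O (Y ×ˢ Ico (0 : ℝ) a) := fun z hz => ⟨hz.1, Ioo_subset_Ico_self hz.2⟩
  set ρ : smoothAlg (Y ×ˢ Ico (0 : ℝ) a) →ₐ[ℝ] smoothAlg O := pullback _ _ hid hOS
  have hρD : ∀ i r, ρ (collarD hY a i r) = openD hO i (ρ r) := fun i r =>
    dirD_pullback (uniqueDiffOn_collar hY a) hO.uniqueDiffOn _ _ hid hOS (stdVecPlus n i) r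
  have hρx : ρ (coordX _) = coordX O := rfl
  set z : O := ⟨(y, x), hy, hx⟩ with hz
  have hev : ∀ F, evalAt (S := Y ×ˢ Ico (0 : ℝ) a) ⟨(y, x), hy, Ioo_subset_Ico_self hx⟩ F
      = evalAt z (ρ F) := fun F => rfl
  set g : Matrix (Fin n) (Fin n) (smoothAlg O) := H.mat.map ρ with hg
  have hgu : IsUnit g.det := by
    rw [hg, show H.mat.map ρ = ρ.mapMatrix H.mat from rfl, ← AlgHom.map_det]
    exact H.isUnit_det.map ρ
  have hgs : gᵀ = g := by rw [hg, ← Matrix.transpose_map, H.transpose_mat]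
  have hgev : ∀ z : O, g.map (evalAt z) = h z.1.2 z.1.1 := fun z => rfl
  have hxi := coordX_mul_coordXInv hpos
  set gp : Matrix (Fin n ⊕ Unit) (Fin n ⊕ Unit) (smoothAlg O) :=
    (coordXInv hpos * coordXInv hpos) • Matrix.fromBlocks g 0 0 1 with hgp
  have hgpev : ∀ z : O, gp.map (evalAt z) = gPlus h z := fun z => map_gPlus hpos z (hgev z)
  have hgpu : IsUnit gp.det := by
    rw [hgp, Matrix.det_smul, Matrix.det_fromBlocks_zero₂₁, Matrix.det_one, mul_one]
    have hxiu : IsUnit (coordXInv hpos) := IsUnit.of_mul_eq_one _ (by rw [mul_comm]; exact hxi)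
    exact ((hxiu.mul hxiu).pow _).mul hgu
  set D := fun i => openD hO (Sum.inl i : Fin n ⊕ Unit) with hD
  have hLC : IsLC D g (chr D g) := chr_isLC D hgu hgs
  have hconn := (normalConn_isLC (xi := coordXInv hpos) hxi (openD_coordX_inr hO)
    (openD_coordX_inl hO) hgu hgs hLC).eq_chr hgpu
  have hxx := openD_coordX_inr hO
  have hric : (ric (fun i => collarD hY a (Sum.inl i))
      (chr (fun i => collarD hY a (Sum.inl i)) H.mat)).map ρ = ric D (chr D g) := by
    rw [ric_map ρ (fun i => hρD (Sum.inl i))]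
    congr 1
    funext k
    rw [chr_map ρ (fun i => hρD (Sum.inl i)) H.isUnit_det]
  have hxz : evalAt z (coordX O) = x := rfl
  have hc : evalAt z (-(2 * coordX O * coordX O)) = -(2 * x * x) := by
    simp [hxz, map_ofNat]
  have hricp : ∀ A B, einsteinDefect h (y, x) A B = evalAt z
      (ric (openD hO) (chr (openD hO) gp) A B + (Fintype.card (Fin n) : smoothAlg O) * gp A B) := by
    intro A B
    rw [einsteinDefect, ricci_eq_ric hO (stdVecPlus n) hgpev hgpu z, ← hgpev z, map_add, map_mul,
      map_natCast, Fintype.card_fin]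
    rfl
  refine ⟨fun j l => ?_, ?_, fun j l => ?_⟩
  · have h1 : ρ (H.tan hY j l) = einTan (coordX O) (openD hO (Sum.inr ())) g
        (ric D (chr D g)) j l := by
      rw [← hric, ← hρx, ← einTan_map ρ (hρD (Sum.inr ())) H.isUnit_det]; rfl
    have h2 := congrArg (evalAt z) (normalConn_ric_tan (Γ := chr D g) hxi hxx hgu hgs j l)
    rw [hconn] at h2
    rw [hev, h1, ← h2, hricp, map_mul, hc]
    rfl
  · have h1 : ρ (einNor (coordX _) (collarD hY a (Sum.inr ())) H.mat)
        = einNor (coordX O) (openD hO (Sum.inr ())) g := by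
      rw [← hρx, ← einNor_map ρ (hρD (Sum.inr ())) H.isUnit_det]
    have h2 := congrArg (evalAt z) (normalConn_ric_nor (Γ := chr D g) hxi hxx hgu)
    rw [hconn] at h2
    have h3 : gp (Sum.inr ()) (Sum.inr ()) = coordXInv hpos * coordXInv hpos := by simp [hgp]
    rw [hev, h1, ← h2, hricp, map_mul, hc, h3]
  · have h1 : ρ (radialDefect (coordX _) (collarD hY a (Sum.inr ())) H.mat j l)
        = radialDefect (coordX O) (openD hO (Sum.inr ())) g j l := by
      rw [← hρx, ← radialDefect_map ρ (hρD (Sum.inr ())) H.isUnit_det]; rfl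
    have h2 := congrArg (evalAt z) (normalConn_radial (Γ := chr D g) hxi hxx hgu hgs j l)
    rw [hconn] at h2
    have h3 := riemannUp_eq_curv hO (stdVecPlus n) hgpev hgpu (Sum.inr ()) (Sum.inl j)
      (Sum.inr ()) (Sum.inl l) z
    rw [hev, h1, ← h2, h3, ← hgpev z, map_mul, map_add, hc]
    rfl

end IsCollarFamily

/-- The inverse of `x⁻² (dx² + h_x)`. -/
lemma gPlus_inv {h : ℝ → Eu n → Matrix (Fin n) (Fin n) ℝ} {y : Eu n} {x : ℝ} (hx : x ≠ 0)
    (hd : (h x y).det ≠ 0) :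
    (gPlus h (y, x))⁻¹ = (x ^ 2) • Matrix.fromBlocks (h x y)⁻¹ 0 0 1 := by
  apply Matrix.inv_eq_right_inv
  rw [gPlus, Matrix.smul_mul, Matrix.mul_smul, smul_smul, Matrix.fromBlocks_multiply,
    inv_mul_cancel₀ (by positivity)]
  simp [Matrix.mul_nonsing_inv _ hd.isUnit]

lemma det_gPlus_ne {h : ℝ → Eu n → Matrix (Fin n) (Fin n) ℝ} {y : Eu n} {x : ℝ} (hx : x ≠ 0)
    (hd : (h x y).det ≠ 0) : (gPlus h (y, x)).det ≠ 0 := by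
  rw [gPlus, Matrix.det_smul, Matrix.det_fromBlocks_zero₂₁, Matrix.det_one, mul_one]
  exact mul_ne_zero (by positivity) hd

/-- A metric of constant sectional curvature `-1` has `R^A_{BCF} = -(δ^A_C g_{BF} - δ^A_F g_{BC})`
and `Ric = -(N - 1) g`. -/
lemma riemannUp_of_constant_curvature {E ι : Type*} [Fintype ι] [DecidableEq ι]
    [NormedAddCommGroup E] [NormedSpace ℝ E] (e : ι → E) {G : E → Matrix ι ι ℝ} {z : E}
    (hd : (G z).det ≠ 0)
    (hR : ∀ A B C F, riemann e G A B C F z = -(G z A C * G z B F - G z A F * G z B C))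
    (A B C F : ι) : riemannUp e G A B C F z
      = -((1 : Matrix ι ι ℝ) A C * G z B F - (1 : Matrix ι ι ℝ) A F * G z B C) := by
  have h1 : G z *ᵥ (fun A => riemannUp e G A B C F z) = fun A => riemann e G A B C F z := rfl
  have h2 : (fun A => riemannUp e G A B C F z)
      = (G z)⁻¹ *ᵥ fun A => riemann e G A B C F z := by
    rw [← h1, Matrix.mulVec_mulVec, Matrix.nonsing_inv_mul _ hd.isUnit, Matrix.one_mulVec]
  have h3 : ∀ A C, ∑ m, (G z)⁻¹ A m * G z m C = (1 : Matrix ι ι ℝ) A C := fun A C => by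
    rw [← Matrix.mul_apply, Matrix.nonsing_inv_mul _ hd.isUnit]
  have h4 : riemannUp e G A B C F z = ∑ m, (G z)⁻¹ A m * riemann e G m B C F z := congrFun h2 A
  rw [h4, ← h3 A C, ← h3 A F]
  simp only [hR, Finset.sum_mul, ← Finset.sum_sub_distrib, ← Finset.sum_neg_distrib]
  exact Finset.sum_congr rfl fun m _ => by ring

lemma einsteinDefect_of_constant_curvature {h : ℝ → Eu n → Matrix (Fin n) (Fin n) ℝ}
    {y : Eu n} {x : ℝ} (hx : x ≠ 0) (hd : (h x y).det ≠ 0)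
    (hR : ∀ A B C F, riemann (stdVecPlus n) (gPlus h) A B C F (y, x)
      = -(gPlus h (y, x) A C * gPlus h (y, x) B F - gPlus h (y, x) A F * gPlus h (y, x) B C)) :
    einsteinDefect h (y, x) = 0 := by
  ext B F
  have h1 : ricci (stdVecPlus n) (gPlus h) (y, x) B F
      = ∑ A, riemannUp (stdVecPlus n) (gPlus h) A B A F (y, x) := rfl
  have h2 : ∑ A, (1 : Matrix (Fin n ⊕ Unit) (Fin n ⊕ Unit) ℝ) A F * gPlus h (y, x) B A
      = gPlus h (y, x) B F := by
    simp [Matrix.one_apply]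
  rw [einsteinDefect, Matrix.add_apply, h1]
  simp only [riemannUp_of_constant_curvature _ (det_gPlus_ne hx hd) hR, Matrix.one_apply_eq,
    Finset.sum_neg_distrib, Finset.sum_sub_distrib, h2, one_mul]
  simp
  ring

/-! ### Comparison with the explicit hyperbolic metric -/

lemma contDiffOn_det {ι E : Type*} [Fintype ι] [DecidableEq ι] [NormedAddCommGroup E]
    [NormedSpace ℝ E] {S : Set E} {A : E → Matrix ι ι ℝ}
    (hA : ∀ i j, ContDiffOn ℝ ∞ (fun z => A z i j) S) :
    ContDiffOn ℝ ∞ (fun z => (A z).det) S :=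
  (contDiffOn_smFn (smMat A hA).det).congr fun z hz => by
    rw [smFn_apply _ ⟨z, hz⟩, ← evalAt_apply, AlgHom.map_det]; rfl

variable {n : ℕ} {Y : Set (Eu n)} {a : ℝ} {G : Eu n → Matrix (Fin n) (Fin n) ℝ} {f : Eu n → ℝ}
  {h : ℝ → Eu n → Matrix (Fin n) (Fin n) ℝ}

namespace IsCollarFamily

/-- For a hyperbolic metric the equations used in the comparison hold identically for `x > 0`, hence
to every order at `x = 0`. -/
lemma entries_mem_of_constant_curvature (H : IsCollarFamily Y a h) (hY : IsOpen Y) (ha : 0 < a)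
    (hR : ∀ y ∈ Y, ∀ x ∈ Ioo 0 a, ∀ A B C F, riemann (stdVecPlus n) (gPlus h) A B C F (y, x)
      = -(gPlus h (y, x) A C * gPlus h (y, x) B F - gPlus h (y, x) A F * gPlus h (y, x) B C))
    (m : ℕ) :
    EntriesIn (ordIdeal (collarD hY a (Sum.inr ())) (bottomIdeal ha) m) (H.tan hY) ∧
    einNor (coordX _) (collarD hY a (Sum.inr ())) H.mat
      ∈ ordIdeal (collarD hY a (Sum.inr ())) (bottomIdeal ha) m ∧
    EntriesIn (ordIdeal (collarD hY a (Sum.inr ())) (bottomIdeal ha) m)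
      (radialDefect (coordX _) (collarD hY a (Sum.inr ())) H.mat) := by
  have hE : ∀ y ∈ Y, ∀ x ∈ Ioo 0 a, einsteinDefect h (y, x) = 0 := fun y hy x hx =>
    einsteinDefect_of_constant_curvature hx.1.ne' (H.det_ne y hy x (Ioo_subset_Ico_self hx))
      (hR y hy x hx)
  refine ⟨fun j l => ?_, ?_, fun j l => ?_⟩ <;>
    refine mem_ordIdeal_of_forall_pos hY ha (fun y x hx => ?_) m
  · have h1 := (H.curvature_components hY y.2 hx).1 j l
    rw [hE y y.2 x hx, Matrix.zero_apply, mul_zero] at h1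
    exact h1
  · have h1 := (H.curvature_components hY y.2 hx).2.1
    rw [hE y y.2 x hx, Matrix.zero_apply, mul_zero] at h1
    exact h1
  · have h1 := (H.curvature_components hY y.2 hx).2.2 j l
    rw [riemannUp_of_constant_curvature _ (det_gPlus_ne hx.1.ne'
      (H.det_ne y y.2 x (Ioo_subset_Ico_self hx))) (hR y y.2 x hx)] at h1
    refine h1.trans ?_
    simp

/-- The estimates in the definition of a Poincaré metric, as orders of vanishing. -/
lemma entries_mem_of_isBigO (H : IsCollarFamily Y a h) (hY : IsOpen Y) (ha : 0 < a) (hn : 2 < n)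
    (hE : ∀ y ∈ Y, ∀ A B, (fun x : ℝ => einsteinDefect h (y, x) A B)
      =O[𝓝[>] 0] fun x => x ^ (n - 2))
    (hT : ∀ y ∈ Y, (fun x : ℝ => metricTrace (gPlus h (y, x)) (einsteinDefect h (y, x)))
      =O[𝓝[>] 0] fun x => x ^ (n + 2)) :
    EntriesIn (ordIdeal (collarD hY a (Sum.inr ())) (bottomIdeal ha) n) (H.tan hY) ∧
    einNor (coordX _) (collarD hY a (Sum.inr ())) H.mat + (H.mat⁻¹ * H.tan hY).trace
      ∈ ordIdeal (collarD hY a (Sum.inr ())) (bottomIdeal ha) (n + 1) := by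
  refine ⟨fun j l => mem_ordIdeal_of_isBigO hY ha fun y hy => ?_,
    ordIdeal_mono (Nat.le_succ _) (mem_ordIdeal_of_isBigO (m := n + 2) hY ha fun y hy => ?_)⟩
  · have h1 : (fun x : ℝ => -(2 * x * x)) =O[𝓝[>] 0] fun x => x ^ 2 :=
      IsBigO.of_bound 2 (Eventually.of_forall fun x => by
        rw [norm_neg, mul_assoc, norm_mul, ← sq]; simp)
    have h2 := h1.mul (hE y hy (Sum.inl j) (Sum.inl l))
    simp only [← pow_add, Nat.add_sub_cancel' hn.le] at h2
    refine h2.congr' ?_ EventuallyEq.rfl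
    filter_upwards [Ioo_mem_nhdsGT ha] with x hx
    rw [smFn_apply (S := Y ×ˢ Ico (0 : ℝ) a) _ ⟨(y, x), hy, Ioo_subset_Ico_self hx⟩]
    exact ((H.curvature_components hY hy hx).1 j l).symm
  · refine ((hT y hy).const_mul_left (-2)).congr' ?_ EventuallyEq.rfl
    filter_upwards [Ioo_mem_nhdsGT ha] with x hx
    have hx0 : x ≠ 0 := hx.1.ne'
    have hxI := Ioo_subset_Ico_self hx
    obtain ⟨h1, h2, -⟩ := H.curvature_components hY hy hx
    rw [smFn_apply (S := Y ×ˢ Ico (0 : ℝ) a) _ ⟨(y, x), hy, hxI⟩, ← evalAt_apply, map_add, h2,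
      map_trace, Matrix.map_mul,
      map_inv_of_isUnit _ H.isUnit_det, H.map_mat, metricTrace,
      gPlus_inv hx0 (H.det_ne y hy x hxI)]
    have hs : ∀ i j, (h x y)⁻¹ i j = (h x y)⁻¹ j i := fun i j => by
      have := congrFun (congrFun (Matrix.transpose_nonsing_inv (h x y)) j) i
      rwa [H.symm y hy x hxI] at this
    have h3 : ((h x y)⁻¹
          * (H.tan hY).map (evalAt (S := Y ×ˢ Ico (0 : ℝ) a) ⟨(y, x), hy, hxI⟩)).trace
        = -(2 * x * x) * ∑ i, ∑ j, (h x y)⁻¹ i j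
          * einsteinDefect h (y, x) (Sum.inl i) (Sum.inl j) := by
      simp only [Matrix.trace, Matrix.diag_apply, Matrix.mul_apply, Matrix.map_apply, h1,
        Finset.mul_sum]
      rw [Finset.sum_comm]
      refine Finset.sum_congr rfl fun i _ => Finset.sum_congr rfl fun j _ => ?_
      rw [hs i j]; ring
    rw [h3]
    simp only [Fintype.sum_sum_type, Matrix.smul_apply, Matrix.fromBlocks_apply₁₁,
      Matrix.fromBlocks_apply₁₂, Matrix.fromBlocks_apply₂₁, Matrix.fromBlocks_apply₂₂,
      Matrix.zero_apply, smul_eq_mul, Finset.univ_unique, Finset.sum_singleton,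
      PUnit.default_eq_unit, Matrix.one_apply_eq, zero_mul, add_zero, Finset.sum_const_zero,
      zero_add, mul_assoc, ← Finset.mul_sum]
    ring

end IsCollarFamily

namespace IsFlatPatch

lemma contDiffOn_hypA (H : IsFlatPatch Y G f) (hn : 2 < n) (a : ℝ) (i j : Fin n) :
    ContDiffOn ℝ ∞ (fun z : Eu n × ℝ => hypA z.2 (schoutenEnd G z.1) i j)
      (Y ×ˢ Ico (0 : ℝ) a) := by
  simp only [hypA_apply]
  have hP : ContDiffOn ℝ ∞ (fun z : Eu n × ℝ => schoutenEnd G z.1 i j) (Y ×ˢ Ico (0 : ℝ) a) :=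
    (H.schoutenEnd_smooth hn i j).comp contDiff_fst.contDiffOn fun z hz => hz.1
  have hx : ContDiffOn ℝ ∞ (fun z : Eu n × ℝ => z.2) (Y ×ˢ Ico (0 : ℝ) a) :=
    contDiff_snd.contDiffOn
  exact contDiffOn_const.sub (((contDiffOn_const.mul hx).mul hx).mul hP)

lemma transpose_hypFamily (H : IsFlatPatch Y G f) (hn : 2 < n) {y : Eu n} (hy : y ∈ Y) (x : ℝ) :
    (hypFamily G x y)ᵀ = hypFamily G x y := by
  have h1 : (hypA x (schoutenEnd G y))ᵀ * G y = G y * hypA x (schoutenEnd G y) := by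
    have h2 := H.mul_schoutenEnd_symm hn hy
    rw [Matrix.transpose_mul, H.symm y hy] at h2
    simp only [hypA, Matrix.transpose_sub, Matrix.transpose_smul, Matrix.transpose_one,
      Matrix.sub_mul, Matrix.mul_sub, Matrix.smul_mul, Matrix.mul_smul, h2, Matrix.one_mul,
      Matrix.mul_one]
  rw [hypFamily, Matrix.transpose_mul, Matrix.transpose_mul, H.symm y hy, h1, ← Matrix.mul_assoc,
    h1]

/-- The hyperbolic family is a family of metrics as long as `1 - x² P / 2` is invertible. -/
lemma isCollarFamily_hyp (H : IsFlatPatch Y G f) (hn : 2 < n)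
    (hA : ∀ y ∈ Y, ∀ x ∈ Ico 0 a, 0 < (hypA x (schoutenEnd G y)).det) :
    IsCollarFamily Y a (hypFamily G) where
  smooth i j := by
    have hG : ∀ i j, ContDiffOn ℝ ∞ (fun z : Eu n × ℝ => G z.1 i j) (Y ×ˢ Ico (0 : ℝ) a) :=
      fun i j => (H.smooth i j).comp contDiff_fst.contDiffOn fun z hz => hz.1
    have hP := H.contDiffOn_hypA hn a
    simp only [hypFamily, Matrix.mul_apply]
    exact ContDiffOn.sum fun k _ => (ContDiffOn.sum fun l _ => (hG i l).mul (hP l k)).mul (hP k j)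
  symm y hy x _ := H.transpose_hypFamily hn hy x
  det_ne y hy x hx := by
    rw [hypFamily, Matrix.det_mul, Matrix.det_mul]
    have := (hA y hy x hx).ne'
    exact mul_ne_zero (mul_ne_zero (H.det_ne y hy) this) this

lemma hypFamily_constant_curvature (H : IsFlatPatch Y G f) (hn : 2 < n)
    (hA : ∀ y ∈ Y, ∀ x ∈ Ico 0 a, 0 < (hypA x (schoutenEnd G y)).det) {y : Eu n} (hy : y ∈ Y)
    {x : ℝ} (hx : x ∈ Ioo 0 a) (A B C F : Fin n ⊕ Unit) :
    riemann (stdVecPlus n) (gPlus (hypFamily G)) A B C F (y, x)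
      = -(gPlus (hypFamily G) (y, x) A C * gPlus (hypFamily G) (y, x) B F
        - gPlus (hypFamily G) (y, x) A F * gPlus (hypFamily G) (y, x) B C) :=
  H.riemann_hypFamily hn (O := Y ×ˢ Ioo (0 : ℝ) a) (H.isOpen.prod isOpen_Ioo) (fun _ hz => hz.1)
    (fun _ hz => hz.2.1) (fun z hz => (hA z.1 hz.1 z.2 (Ioo_subset_Ico_self hz.2)).ne')
    (z := (y, x)) ⟨hy, hx⟩ A B C F

variable (H : IsFlatPatch Y G f) (hn : 2 < n)
  (hA : ∀ y ∈ Y, ∀ x ∈ Ico 0 a, 0 < (hypA x (schoutenEnd G y)).det)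
  (hh : IsCollarFamily Y a h)

lemma agreeTo_one (h0 : ∀ y ∈ Y, h 0 y = G y) (ha : 0 < a) :
    AgreeTo (collarD H.isOpen a (Sum.inr ())) (bottomIdeal ha) (coordX _) 1 hh.mat
      (H.isCollarFamily_hyp hn hA).mat where
  pos := le_rfl
  deriv_x := collarD_coordX H.isOpen a
  x_mem := coordX_mem_bottomIdeal ha
  left := hh.isUnit_det
  right := (H.isCollarFamily_hyp hn hA).isUnit_det
  sub i j := by
    refine ⟨(mem_bottomIdeal ha).2 fun y => ?_, trivial⟩
    show h 0 y i j - hypFamily G 0 y i j = 0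
    rw [h0 y y.2, hypFamily]
    simp [hypA]

/-- A hyperbolic metric agrees with the explicit one to all orders. -/
lemma det_sub_det_mem_of_hyperbolic (h0 : ∀ y ∈ Y, h 0 y = G y) (ha : 0 < a)
    (hR : ∀ y ∈ Y, ∀ x ∈ Ioo 0 a, ∀ A B C F, riemann (stdVecPlus n) (gPlus h) A B C F (y, x)
      = -(gPlus h (y, x) A C * gPlus h (y, x) B F - gPlus h (y, x) A F * gPlus h (y, x) B C))
    (m : ℕ) : hh.mat.det - (H.isCollarFamily_hyp hn hA).mat.det
      ∈ ordIdeal (collarD H.isOpen a (Sum.inr ())) (bottomIdeal ha) m := by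
  have h1 := fun m => hh.entries_mem_of_constant_curvature H.isOpen ha hR m
  have h2 := fun m => (H.isCollarFamily_hyp hn hA).entries_mem_of_constant_curvature H.isOpen ha
    (fun y hy x hx => H.hypFamily_constant_curvature hn hA hy hx) m
  -- The radial equation says nothing in order `2`; the Einstein equation carries the induction past
  -- that order, because `2 < n`.
  have h3 := AgreeTo.of_einTan (D := fun i => collarD H.isOpen a (Sum.inl i))
    (fun i F hF => collarD_mem_bottomIdeal H.isOpen ha i F hF)
    (fun i F => collarD_comm H.isOpen ha _ _ F) (H.agreeTo_one hn hA hh h0 ha) (h1 _).1 (h2 _).1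
    (m := 3) (by norm_num) (by rw [Fintype.card_fin]; exact hn)
  have h4 : ∀ k, AgreeTo (collarD H.isOpen a (Sum.inr ())) (bottomIdeal ha) (coordX _) (3 + k)
      hh.mat (H.isCollarFamily_hyp hn hA).mat := by
    intro k
    induction k with
    | zero => exact h3
    | succ k ih => exact ih.succ_of_radialDefect (by omega) (h1 _).2.2 (h2 _).2.2
  exact ordIdeal_mono (by omega) (det_sub_det_mem (h4 m).sub)

/-- The volume form of a Poincaré metric agrees with that of the explicit hyperbolic metric up to
the order of the dimension: the metrics agree up to that order, excluded, and at that order so do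
the traces. -/
lemma det_sub_det_mem_of_poincare (h0 : ∀ y ∈ Y, h 0 y = G y) (ha : 0 < a)
    (hE : ∀ y ∈ Y, ∀ A B, (fun x : ℝ => einsteinDefect h (y, x) A B)
      =O[𝓝[>] 0] fun x => x ^ (n - 2))
    (hT : ∀ y ∈ Y, (fun x : ℝ => metricTrace (gPlus h (y, x)) (einsteinDefect h (y, x)))
      =O[𝓝[>] 0] fun x => x ^ (n + 2)) :
    hh.mat.det - (H.isCollarFamily_hyp hn hA).mat.det
      ∈ ordIdeal (collarD H.isOpen a (Sum.inr ())) (bottomIdeal ha) (n + 1) := by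
  obtain ⟨h1, h1'⟩ := hh.entries_mem_of_isBigO H.isOpen ha hn hE hT
  have h2 := fun m => (H.isCollarFamily_hyp hn hA).entries_mem_of_constant_curvature H.isOpen ha
    (fun y hy x hx => H.hypFamily_constant_curvature hn hA hy hx) m
  have hJ : ∀ i : Fin n, ∀ F ∈ bottomIdeal (Y := Y) ha,
      collarD H.isOpen a (Sum.inl i) F ∈ bottomIdeal ha :=
    fun i F hF => collarD_mem_bottomIdeal H.isOpen ha i F hF
  have hc : ∀ (i : Fin n) F, collarD H.isOpen a (Sum.inr ()) (collarD H.isOpen a (Sum.inl i) F)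
      = collarD H.isOpen a (Sum.inl i) (collarD H.isOpen a (Sum.inr ()) F) :=
    fun i F => collarD_comm H.isOpen ha _ _ F
  have hcard : Fintype.card (Fin n) = n := Fintype.card_fin n
  have h3 := AgreeTo.of_einTan (m := Fintype.card (Fin n)) hJ hc (H.agreeTo_one hn hA hh h0 ha)
    (by rw [hcard]; exact h1) (h2 _).1 (by omega) le_rfl
  have h4 := h3.trace_mem_of_einstein_trace
    (ric_sub_ric_mem (fun i F hF => derivation_mem_ordIdeal (hJ i) (hc i) hF) h3.left h3.right
      h3.sub) (h1.mono (ordIdeal_mono (by omega))) (by rw [hcard]; exact h1')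
    (Ideal.add_mem _ (h2 _).2.1 (((h2 _).1.mul_left _).trace_mem))
  have h5 := h3.det_sub_det_mem_succ h4
  rwa [hcard] at h5

/-- The coefficients of the volume form are determined by the determinant of the metric. -/
theorem volCoeff_eq_of_det_sub_det_mem (ha : 0 < a)
    (hpos : ∀ y ∈ Y, ∀ x ∈ Ico 0 a, 0 < (h x y).det / (G y).det) {m : ℕ}
    (hm : hh.mat.det - (H.isCollarFamily_hyp hn hA).mat.det
      ∈ ordIdeal (collarD H.isOpen a (Sum.inr ())) (bottomIdeal ha) m)
    {y : Eu n} (hy : y ∈ Y) {j : ℕ} (hj : j < m) :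
    volCoeff G h j y = iteratedDerivWithin j (fun x => (hypA x (schoutenEnd G y)).det) (Ici 0) 0
      / (Nat.factorial j : ℝ) := by
  have hGs : ContDiffOn ℝ ∞ (fun z : Eu n × ℝ => (G z.1).det) (Y ×ˢ Ico (0 : ℝ) a) :=
    (contDiffOn_det H.smooth).comp contDiff_fst.contDiffOn fun z hz => hz.1
  have hFs : ContDiffOn ℝ ∞ (fun z : Eu n × ℝ => √((h z.2 z.1).det / (G z.1).det))
      (Y ×ˢ Ico (0 : ℝ) a) :=
    ((contDiffOn_det hh.smooth).div hGs fun z hz => H.det_ne _ hz.1).sqrt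
      fun z hz => (hpos z.1 hz.1 z.2 hz.2).ne'
  have hKs : ContDiffOn ℝ ∞ (fun z : Eu n × ℝ => (hypA z.2 (schoutenEnd G z.1)).det)
      (Y ×ˢ Ico (0 : ℝ) a) := contDiffOn_det fun i j => H.contDiffOn_hypA hn a i j
  -- `F` and `K` are the volume ratios of the two families. The difference of the determinants is
  -- `(F - K) (F + K) det G`, with `(F + K) det G` invertible.
  set F := smMk _ hFs
  set K := smMk _ hKs
  have hu : IsUnit ((F + K) * smMk _ hGs) := isUnit_smoothAlg fun z => by
    have h1 := hpos z.1.1 z.2.1 z.1.2 z.2.2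
    have h2 := hA z.1.1 z.2.1 z.1.2 z.2.2
    exact mul_ne_zero (add_pos (Real.sqrt_pos.2 h1) h2).ne' (H.det_ne _ z.2.1)
  have hmul : (F - K) * ((F + K) * smMk _ hGs)
      = hh.mat.det - (H.isCollarFamily_hyp hn hA).mat.det := smoothAlg_ext fun z => by
    have h1 := (hpos z.1.1 z.2.1 z.1.2 z.2.2).le
    have hd := H.det_ne _ z.2.1
    have e1 : hh.mat.det.1 z = (h z.1.2 z.1.1).det := by
      rw [← evalAt_apply, AlgHom.map_det]; rfl
    have e2 : (H.isCollarFamily_hyp hn hA).mat.det.1 z = (hypFamily G z.1.2 z.1.1).det := by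
      rw [← evalAt_apply, AlgHom.map_det]; rfl
    show (√((h z.1.2 z.1.1).det / (G z.1.1).det) - (hypA z.1.2 (schoutenEnd G z.1.1)).det)
      * ((√((h z.1.2 z.1.1).det / (G z.1.1).det) + (hypA z.1.2 (schoutenEnd G z.1.1)).det)
        * (G z.1.1).det) = hh.mat.det.1 z - (H.isCollarFamily_hyp hn hA).mat.det.1 z
    rw [e1, e2, hypFamily, Matrix.det_mul, Matrix.det_mul]
    have h3 := Real.mul_self_sqrt h1
    have h4 : (h z.1.2 z.1.1).det
        = (h z.1.2 z.1.1).det / (G z.1.1).det * (G z.1.1).det := (div_mul_cancel₀ _ hd).symm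
    linear_combination (G z.1.1).det * h3 - h4
  have hFK : F - K ∈ ordIdeal (collarD H.isOpen a (Sum.inr ())) (bottomIdeal ha) m := by
    rw [← hmul] at hm
    exact (Ideal.mul_unit_mem_iff_mem _ hu).1 hm
  have h1 := iteratedDerivWithin_eq_of_sub_mem H.isOpen ha hFK ⟨y, hy⟩ hj
  have hI : (0 : ℝ) ∈ Ico 0 a := ⟨le_rfl, ha⟩
  rw [volCoeff]
  congr 1
  rw [iteratedDerivWithin_Ici_eq ha, iteratedDerivWithin_Ici_eq ha] at h1 ⊢
  have e1 := iteratedDerivWithin_congr (n := j)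
    (fun x hx => smFn_smMk _ hFs (x := (y, x)) ⟨hy, hx⟩) hI
  have e2 := iteratedDerivWithin_congr (n := j)
    (fun x hx => smFn_smMk _ hKs (x := (y, x)) ⟨hy, hx⟩) hI
  exact e1.symm.trans (h1.trans e2)

end IsFlatPatch

/-! ### Elementary symmetric functions of the eigenvalues -/

open Polynomial in
/-- The reversed characteristic polynomial `det (1 - t A)` is the generating function of the
elementary symmetric functions of the eigenvalues. -/
lemma coeff_charpolyRev {n : ℕ} (A : Matrix (Fin n) (Fin n) ℝ) (k : ℕ) :
    (A.charpolyRev.coeff k : ℂ) = if k ≤ n then (-1 : ℂ) ^ k * sigmaEig k A else 0 := by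
  have hdeg : A.charpoly.natDegree = n := by simp
  rw [← Matrix.reverse_charpoly, coeff_reverse, hdeg]
  split_ifs with hk
  · rw [revAt_le hk]
    have h1 : (A.charpoly.coeff (n - k) : ℂ)
        = (A.map (algebraMap ℝ ℂ)).charpoly.coeff (n - k) := by
      rw [Matrix.charpoly_map, coeff_map]; rfl
    have hdeg' : (A.map (algebraMap ℝ ℂ)).charpoly.natDegree = n := by simp
    rw [h1, coeff_eq_esymm_roots_of_card (IsAlgClosed.card_roots_eq_natDegree)
      (by rw [hdeg']; omega), hdeg', (Matrix.charpoly_monic _).leadingCoeff,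
      Nat.sub_sub_self hk, one_mul, sigmaEig]
  · rw [revAt_eq_self_of_lt (by omega), coeff_eq_zero_of_natDegree_lt (by omega),
      Complex.ofReal_zero]

open Polynomial in
lemma coeff_det_one_add_X_smul {n : ℕ} (A : Matrix (Fin n) (Fin n) ℝ) {k : ℕ} (hk : k ≤ n) :
    (((1 + (X : ℝ[X]) • A.map C).det.coeff k : ℝ) : ℂ) = sigmaEig k A := by
  have h1 : (1 + (X : ℝ[X]) • A.map C).det = A.charpolyRev.comp (C (-1) * X) := by
    rw [Matrix.charpolyRev, ← coe_compRingHom_apply, RingHom.map_det]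
    congr 1
    ext1 i j
    by_cases hij : i = j <;> simp [hij]
  rw [h1, comp_C_mul_X_coeff, Complex.ofReal_mul, coeff_charpolyRev, if_pos hk]
  push_cast
  rw [mul_right_comm, ← mul_pow]
  simp

open Polynomial in
lemma iteratedDerivWithin_polynomial (Q : ℝ[X]) (j : ℕ) :
    iteratedDerivWithin j (fun x => Q.eval x) (Ici 0) 0 / (j.factorial : ℝ) = Q.coeff j := by
  have h1 : ∀ (j : ℕ) (Q : ℝ[X]), iteratedDeriv j (fun x => Q.eval x)
      = fun x => (derivative^[j] Q).eval x := by
    intro j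
    induction j with
    | zero => intro Q; simp
    | succ j ih =>
      intro Q
      rw [iteratedDeriv_succ', Function.iterate_succ_apply, ← ih]
      congr 1
      funext x
      exact Q.deriv
  have h2 : ContDiff ℝ j (fun x => Q.eval x) := by simpa using Q.contDiff_aeval (𝕜 := ℝ) j
  rw [iteratedDerivWithin_eq_iteratedDeriv (uniqueDiffOn_Ici 0) h2.contDiffAt self_mem_Ici, h1]
  beta_reduce
  rw [← coeff_zero_eq_eval_zero, coeff_iterate_derivative, zero_add,
    Nat.descFactorial_self, nsmul_eq_mul]
  field_simp

open Polynomial in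
/-- The Taylor coefficients of `det (1 - x² A / 2)`. -/
lemma iteratedDerivWithin_det_hypA {n : ℕ} (A : Matrix (Fin n) (Fin n) ℝ) (k : ℕ) :
    ((iteratedDerivWithin (2 * k) (fun x => (hypA x A).det) (Ici 0) 0
      / ((2 * k).factorial : ℝ) : ℝ) : ℂ)
      = if k ≤ n then (-2 : ℂ) ^ (-(k : ℤ)) * sigmaEig k A else 0 := by
  set Q : ℝ[X] := expand ℝ 2 (A.charpolyRev.comp (C (1 / 2) * X)) with hQ
  have h1 : (fun x => (hypA x A).det) = fun x => Q.eval x := by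
    funext x
    rw [hQ, expand_eval, eval_comp, Matrix.charpolyRev, ← coe_evalRingHom, RingHom.map_det]
    congr 1
    ext i j
    simp [hypA_apply, Matrix.one_apply, apply_ite (eval _)]
    ring
  rw [h1, iteratedDerivWithin_polynomial, hQ, mul_comm 2, coeff_expand_mul two_pos,
    comp_C_mul_X_coeff, Complex.ofReal_mul, coeff_charpolyRev]
  split_ifs
  · have h2 : (-2 : ℂ) ^ (-(k : ℤ)) = (-1) ^ k * (1 / 2) ^ k := by
      rw [zpow_neg, zpow_natCast, ← mul_pow, ← inv_pow]; norm_num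
    rw [h2]
    push_cast
    ring
  · simp

/-! ### The Pfaffian -/

section Pfaffian

open Equiv Finset

lemma sum_epsSymbol {n : ℕ} (F : (Fin n → Fin n) → ℝ) :
    ∑ i, epsSymbol i * F i = ∑ σ : Perm (Fin n), ((Perm.sign σ : ℤ) : ℝ) * F σ := by
  classical
  have h1 : ∑ i with Function.Bijective i, epsSymbol i * F i = ∑ i, epsSymbol i * F i :=
    Finset.sum_filter_of_ne fun i _ hi => by
      by_contra h
      exact hi (by rw [epsSymbol, dif_neg h, zero_mul])
  rw [← h1]
  refine (Finset.sum_bij (fun (σ : Perm (Fin n)) _ => (σ : Fin n → Fin n)) ?_ ?_ ?_ ?_).symm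
  · exact fun σ _ => Finset.mem_filter.2 ⟨Finset.mem_univ _, σ.bijective⟩
  · exact fun σ _ τ _ h => DFunLike.coe_injective h
  · exact fun i hi => ⟨Equiv.ofBijective i (Finset.mem_filter.1 hi).2, Finset.mem_univ _, rfl⟩
  · intro σ _
    have : Equiv.ofBijective (σ : Fin n → Fin n) σ.bijective = σ := Equiv.ext fun _ => rfl
    rw [epsSymbol, dif_pos σ.bijective, this]

/-- Raising all indices multiplies the Levi-Civita symbol by the inverse determinant. -/
lemma volFormUp_eq {n : ℕ} (g : Matrix (Fin n) (Fin n) ℝ) (i : Fin n → Fin n) :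
    volFormUp g i = √|g.det| * g⁻¹.det * epsSymbol i := by
  have h1 : volFormUp g i = √|g.det| * (g⁻¹.submatrix i id).det := by
    have h2 : (g⁻¹.submatrix i id).det = ∑ k, epsSymbol k * ∏ a, g⁻¹ (i a) (k a) := by
      rw [← Matrix.det_transpose, Matrix.det_apply', sum_epsSymbol]
      rfl
    rw [h2, Finset.mul_sum]
    refine Finset.sum_congr rfl fun k _ => ?_
    rw [volForm]
    ring
  rw [h1, mul_assoc]
  congr 1
  by_cases h : Function.Bijective i
  · have := Matrix.det_permute (Equiv.ofBijective i h) g⁻¹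
    rw [epsSymbol, dif_pos h, mul_comm, ← this]
    rfl
  · rw [epsSymbol, dif_neg h, mul_zero]
    have h2 : ¬ Function.Injective i := fun hi => h (Finite.injective_iff_bijective.1 hi)
    simp only [Function.Injective, not_forall] at h2
    obtain ⟨a, b, hab, hne⟩ := h2
    exact Matrix.det_zero_of_row_eq hne (by ext c; simp [hab])

variable {α R : Type*} [Fintype α] [DecidableEq α] [CommRing R]

/-- The mixed discriminant, up to a factor `n!`, of a family of matrices indexed by the rows. -/
def mixedDisc (A : α → Matrix α α R) : R :=
  ∑ σ : Perm α, ∑ τ : Perm α,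
    ((Perm.sign σ : ℤ) : R) * ((Perm.sign τ : ℤ) : R) * ∏ a, A a (σ a) (τ a)

/-- Independent permutations of the row and the column positions act on a mixed discriminant by
their signs. -/
lemma mixedDisc_twist (A : α → Matrix α α R) (u v : Perm α) :
    ∑ σ : Perm α, ∑ τ : Perm α, ((Perm.sign σ : ℤ) : R) * ((Perm.sign τ : ℤ) : R)
      * ∏ a, A a (σ (u a)) (τ (v a))
      = ((Perm.sign u : ℤ) : R) * ((Perm.sign v : ℤ) : R) * mixedDisc A := by
  have hsq : ∀ u : Perm α, ((Perm.sign u : ℤ) : R) * ((Perm.sign u : ℤ) : R) = 1 := fun u => by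
    rw [← Int.cast_mul, Int.units_coe_mul_self, Int.cast_one]
  rw [mixedDisc, Finset.mul_sum]
  refine Fintype.sum_equiv (Equiv.mulRight u) _ _ fun σ => ?_
  rw [Finset.mul_sum]
  refine Fintype.sum_equiv (Equiv.mulRight v) _ _ fun τ => ?_
  simp only [Equiv.coe_mulRight, Perm.sign_mul, Units.val_mul, Int.cast_mul, Perm.mul_apply]
  linear_combination -(((Perm.sign σ : ℤ) : R) * ((Perm.sign τ : ℤ) : R)
    * ∏ a, A a (σ (u a)) (τ (v a))) * (hsq u + ((Perm.sign u : ℤ) : R) ^ 2 * hsq v)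

lemma mixedDisc_comp_perm (A : α → Matrix α α R) (u : Perm α) :
    mixedDisc (fun a => A (u a)) = mixedDisc A := by
  have h1 : mixedDisc (fun a => A (u a)) = ∑ σ : Perm α, ∑ τ : Perm α,
      ((Perm.sign σ : ℤ) : R) * ((Perm.sign τ : ℤ) : R) * ∏ a, A a (σ (u⁻¹ a)) (τ (u⁻¹ a)) := by
    rw [mixedDisc]
    refine Finset.sum_congr rfl fun σ _ => Finset.sum_congr rfl fun τ _ => ?_
    rw [← Equiv.prod_comp u (fun a => A a (σ (u⁻¹ a)) (τ (u⁻¹ a)))]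
    simp
  rw [h1, mixedDisc_twist, ← Int.cast_mul, Int.units_coe_mul_self, Int.cast_one, one_mul]

lemma mixedDisc_const (B : Matrix α α R) :
    mixedDisc (fun _ => B) = (Fintype.card α).factorial * B.det := by
  have h1 : ∀ σ : Perm α, ∑ τ : Perm α, ((Perm.sign σ : ℤ) : R) * ((Perm.sign τ : ℤ) : R)
      * ∏ a, B (σ a) (τ a) = B.det := by
    intro σ
    rw [← Matrix.det_transpose, Matrix.det_apply']
    refine Fintype.sum_equiv (Equiv.mulRight σ⁻¹) _ _ fun τ => ?_
    rw [← Equiv.prod_comp σ (fun i => Bᵀ ((Equiv.mulRight σ⁻¹ τ) i) i)]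
    simp only [Equiv.coe_mulRight, Perm.sign_mul, Perm.inv_def, Perm.sign_symm, Units.val_mul,
      Int.cast_mul, Perm.mul_apply, Equiv.symm_apply_apply, Matrix.transpose_apply]
    ring
  rw [mixedDisc, Finset.sum_congr rfl fun σ _ => h1 σ]
  simp [Fintype.card_perm]

open Polynomial in
/-- A mixed discriminant in which the matrix `P` occurs `k` times and `g` otherwise is determined
by the coefficient of `t^k` in `det (g + t P)`: it does not depend on the positions. -/
lemma choose_mul_mixedDisc (g P : Matrix α α R) (s : Finset α) :
    ((Fintype.card α).choose s.card : R) * mixedDisc (fun a => if a ∈ s then P else g)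
      = (Fintype.card α).factorial * (g.map C + (X : R[X]) • P.map C).det.coeff s.card := by
  have hpos : ∀ t : Finset α, t.card = s.card →
      mixedDisc (fun a => if a ∈ t then P else g)
        = mixedDisc (fun a => if a ∈ s then P else g) := by
    intro t ht
    let e : {a // a ∈ t} ≃ {a // a ∈ s} := Finset.equivOfCardEq ht
    rw [← mixedDisc_comp_perm (fun a => if a ∈ s then P else g) e.extendSubtype]
    congr 1
    funext a
    by_cases ha : a ∈ t
    · simp [ha, e.extendSubtype_mem a ha]
    · simp [ha, e.extendSubtype_not_mem a ha]
  have hexp : mixedDisc (fun _ : α => g.map C + (X : R[X]) • P.map C)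
      = ∑ t : Finset α, X ^ t.card * C (mixedDisc (fun a => if a ∈ t then P else g)) := by
    have hT : ∀ σ τ : Perm α, ((Perm.sign σ : ℤ) : R[X]) * ((Perm.sign τ : ℤ) : R[X])
        * ∏ a, (g.map C + (X : R[X]) • P.map C) (σ a) (τ a)
        = ∑ t : Finset α, X ^ t.card * C (((Perm.sign σ : ℤ) : R) * ((Perm.sign τ : ℤ) : R)
          * ∏ a, (if a ∈ t then P else g) (σ a) (τ a)) := by
      intro σ τ
      rw [add_comm (g.map C)]
      simp only [Matrix.add_apply, Fintype.prod_add, Finset.mul_sum]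
      refine Finset.sum_congr rfl fun t _ => ?_
      have e1 : ∏ a ∈ t, C ((if a ∈ t then P else g) (σ a) (τ a)) = ∏ a ∈ t, C (P (σ a) (τ a)) :=
        Finset.prod_congr rfl fun a ha => by rw [if_pos ha]
      have e2 : ∏ a ∈ tᶜ, C ((if a ∈ t then P else g) (σ a) (τ a))
          = ∏ a ∈ tᶜ, C (g (σ a) (τ a)) :=
        Finset.prod_congr rfl fun a ha => by rw [if_neg (Finset.mem_compl.1 ha)]
      rw [C_mul, map_prod, ← Finset.prod_mul_prod_compl t, e1, e2]
      simp only [Matrix.smul_apply, Matrix.map_apply, smul_eq_mul, Finset.prod_mul_distrib,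
        Finset.prod_const, C_mul, map_intCast]
      ring
    calc _ = ∑ σ : Perm α, ∑ τ : Perm α, ∑ t : Finset α, X ^ t.card
          * C (((Perm.sign σ : ℤ) : R) * ((Perm.sign τ : ℤ) : R)
            * ∏ a, (if a ∈ t then P else g) (σ a) (τ a)) :=
          Finset.sum_congr rfl fun σ _ => Finset.sum_congr rfl fun τ _ => hT σ τ
      _ = ∑ t : Finset α, ∑ σ : Perm α, ∑ τ : Perm α, X ^ t.card
          * C (((Perm.sign σ : ℤ) : R) * ((Perm.sign τ : ℤ) : R)
            * ∏ a, (if a ∈ t then P else g) (σ a) (τ a)) :=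
          (Finset.sum_congr rfl fun σ _ => Finset.sum_comm).trans Finset.sum_comm
      _ = _ := by simp only [mixedDisc, map_sum, Finset.mul_sum]
  rw [mixedDisc_const] at hexp
  have h2 := congrArg (fun Q : R[X] => Q.coeff s.card) hexp
  simp only [← C_eq_natCast, coeff_C_mul, finsetSum_coeff, coeff_mul_C, coeff_X_pow, ite_mul,
    one_mul, zero_mul] at h2
  rw [h2, ← Finset.sum_filter, Finset.sum_congr rfl fun t ht =>
    hpos t (Finset.mem_filter.1 ht).2.symm, Finset.sum_const, nsmul_eq_mul]
  congr 2
  rw [← Finset.card_univ, ← Finset.card_powersetCard]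
  congr 1
  ext t
  simp [Finset.mem_powersetCard, eq_comm]

/-- For an algebraic curvature tensor of the form `g ∧ P`, the contraction with two Levi-Civita
symbols is a mixed discriminant. -/
lemma sum_sign_prod_kulkarni_nomizu {m : ℕ} (e : Fin m × Fin 2 ≃ α) (g P : Matrix α α R)
    (K : α → α → α → α → R)
    (hK : ∀ i j k l, K i j k l = g i k * P j l + P i k * g j l - g i l * P j k - P i l * g j k) :
    ∑ σ : Perm α, ∑ τ : Perm α, ((Perm.sign σ : ℤ) : R) * ((Perm.sign τ : ℤ) : R)
      * ∏ l, K (σ (e (l, 0))) (σ (e (l, 1))) (τ (e (l, 0))) (τ (e (l, 1)))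
      = 4 ^ m * mixedDisc (fun a => if (e.symm a).2 = 1 then P else g) := by
  have huniv : (Finset.univ : Finset (Perm (Fin 2))) = {1, swap 0 1} := by decide
  have hne : (1 : Perm (Fin 2)) ≠ swap 0 1 := by decide
  have hK' : ∀ a b : Fin 2 → α, K (a 0) (a 1) (b 0) (b 1) = ∑ w : Perm (Fin 2) × Perm (Fin 2),
      ((Perm.sign w.1 : ℤ) : R) * ((Perm.sign w.2 : ℤ) : R)
        * (g (a (w.1 0)) (b (w.2 0)) * P (a (w.1 1)) (b (w.2 1))) := by
    intro a b
    rw [Fintype.sum_prod_type, huniv, Finset.sum_pair hne, Finset.sum_pair hne,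
      Finset.sum_pair hne, hK]
    simp
    ring
  let π : (Fin m → Perm (Fin 2)) → Perm α := fun c => e.permCongr (prodCongrRight c)
  have hπ : ∀ c l r, π c (e (l, r)) = e (l, c l r) := fun c l r => by
    simp [π, permCongr_apply]
  have hsign : ∀ c, ((Perm.sign (π c) : ℤ) : R) = ∏ l, ((Perm.sign (c l) : ℤ) : R) := fun c => by
    rw [Perm.sign_permCongr, Perm.sign_prodCongrRight]
    push_cast
    rfl
  have hterm : ∀ σ τ : Perm α,
      ∏ l, K (σ (e (l, 0))) (σ (e (l, 1))) (τ (e (l, 0))) (τ (e (l, 1)))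
      = ∑ c : Fin m → Perm (Fin 2) × Perm (Fin 2),
        ((Perm.sign (π fun l => (c l).1) : ℤ) : R) * ((Perm.sign (π fun l => (c l).2) : ℤ) : R)
        * ∏ a, (if (e.symm a).2 = 1 then P else g) (σ (π (fun l => (c l).1) a))
          (τ (π (fun l => (c l).2) a)) := by
    intro σ τ
    simp only [fun l => hK' (fun r => σ (e (l, r))) (fun r => τ (e (l, r)))]
    rw [Finset.prod_univ_sum, Fintype.piFinset_univ]
    refine Finset.sum_congr rfl fun c _ => ?_
    rw [Finset.prod_mul_distrib, Finset.prod_mul_distrib, hsign, hsign, ← Equiv.prod_comp e,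
      Fintype.prod_prod_type]
    simp [hπ, Fin.prod_univ_two]
  calc _ = ∑ c : Fin m → Perm (Fin 2) × Perm (Fin 2),
        ((Perm.sign (π fun l => (c l).1) : ℤ) : R) * ((Perm.sign (π fun l => (c l).2) : ℤ) : R)
        * ∑ σ : Perm α, ∑ τ : Perm α, ((Perm.sign σ : ℤ) : R) * ((Perm.sign τ : ℤ) : R)
        * ∏ a, (if (e.symm a).2 = 1 then P else g) (σ (π (fun l => (c l).1) a))
          (τ (π (fun l => (c l).2) a)) := by
        simp only [hterm, Finset.mul_sum]
        refine ((Finset.sum_congr rfl fun σ _ => Finset.sum_comm).trans Finset.sum_comm).trans ?_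
        refine Finset.sum_congr rfl fun c _ => Finset.sum_congr rfl fun σ _ =>
          Finset.sum_congr rfl fun τ _ => ?_
        ring
    _ = ∑ c : Fin m → Perm (Fin 2) × Perm (Fin 2),
        mixedDisc (fun a => if (e.symm a).2 = 1 then P else g) := by
        refine Finset.sum_congr rfl fun c _ => ?_
        rw [mixedDisc_twist]
        have hsq : ∀ u : Perm α, ((Perm.sign u : ℤ) : R) * ((Perm.sign u : ℤ) : R) = 1 :=
          fun u => by rw [← Int.cast_mul, Int.units_coe_mul_self, Int.cast_one]
        linear_combination (mixedDisc (fun a => if (e.symm a).2 = 1 then P else g)) *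
          (((Perm.sign (π fun l => (c l).2) : ℤ) : R) ^ 2 * hsq (π fun l => (c l).1)
            + hsq (π fun l => (c l).2))
    _ = _ := by
        rw [Finset.sum_const, nsmul_eq_mul]
        simp [Fintype.card_perm]

open Polynomial in
/-- The Pfaffian of a metric whose curvature tensor is the Kulkarni-Nomizu product of the metric
`g` and `g A`. -/
theorem pfaffian_eq_of_kulkarni_nomizu {n q : ℕ} (hn : Even n)
    {G : Eu n → Matrix (Fin n) (Fin n) ℝ} {y : Eu n} (hdet : (G y).det ≠ 0)
    (hsign : (G y).det = (-1) ^ q * |(G y).det|) {A : Matrix (Fin n) (Fin n) ℝ}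
    (hR : ∀ i j k l, riemann (stdVec n) G i j k l y
      = G y i k * (G y * A) j l + (G y * A) i k * G y j l
        - G y i l * (G y * A) j k - (G y * A) i l * G y j k) :
    (pfaffian q G y : ℂ) = (Nat.factorial (n / 2) : ℂ) * sigmaEig (n / 2) A := by
  set m := n / 2 with hm
  have hnm : m * 2 = n := Nat.div_mul_cancel hn.two_dvd
  let e : Fin m × Fin 2 ≃ Fin n := finProdFinEquiv.trans (finCongr hnm)
  have he0 : ∀ l : Fin m, e (l, 0) = ⟨2 * l, by omega⟩ := fun l => Fin.ext (by simp [e])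
  have he1 : ∀ l : Fin m, e (l, 1) = ⟨2 * l + 1, by omega⟩ := fun l =>
    Fin.ext (by simp [e, add_comm])
  set d := (G y).det with hd
  set s : Finset (Fin n) := Finset.univ.filter fun a => (e.symm a).2 = 1 with hs
  have hcard : s.card = m := by
    rw [hs, ← Fintype.card_subtype]
    refine (Fintype.card_congr ?_).trans (Fintype.card_fin m)
    exact
      { toFun := fun a => (e.symm a.1).1
        invFun := fun l => ⟨e (l, 1), by simp⟩
        left_inv := fun a => Subtype.ext (by
          have h1 : e.symm a.1 = ((e.symm a.1).1, 1) := Prod.ext rfl a.2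
          show e ((e.symm a.1).1, 1) = a.1
          rw [← h1, Equiv.apply_symm_apply])
        right_inv := fun l => by simp }
  set c := (1 + (X : ℝ[X]) • A.map C).det.coeff m with hc
  have hdetX : ((G y).map C + (X : ℝ[X]) • (G y * A).map C).det.coeff m = d * c := by
    have h1 : (G y).map C + (X : ℝ[X]) • (G y * A).map C
        = (G y).map C * (1 + (X : ℝ[X]) • A.map C) := by
      rw [Matrix.mul_add, Matrix.mul_one, Matrix.mul_smul, Matrix.map_mul]
    have h2 : ((G y).map C).det = C d := ((C : ℝ →+* ℝ[X]).map_det (G y)).symm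
    rw [h1, Matrix.det_mul, h2, coeff_C_mul]
  have hmixed : mixedDisc (fun a => if (e.symm a).2 = 1 then G y * A else G y)
      = (m.factorial : ℝ) ^ 2 * (d * c) := by
    have h1 := choose_mul_mixedDisc (G y) (G y * A) s
    rw [hcard, hdetX, Fintype.card_fin] at h1
    have h2 : (n.choose m : ℝ) * (m.factorial : ℝ) ^ 2 = n.factorial := by
      have h3 := Nat.choose_mul_factorial_mul_factorial (n := n) (k := m) (by omega)
      rw [show n - m = m by omega] at h3
      rw [← h3]
      push_cast
      ring
    have h4 : (n.choose m : ℝ) ≠ 0 := by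
      exact_mod_cast (Nat.choose_pos (by omega)).ne'
    have h5 : mixedDisc (fun a => if (e.symm a).2 = 1 then G y * A else G y)
        = mixedDisc (fun a => if a ∈ s then G y * A else G y) := by
      simp [hs]
    rw [h5]
    refine mul_left_cancel₀ h4 ?_
    rw [h1, ← h2]
    ring
  have hsum : ∑ i : Fin n → Fin n, ∑ j : Fin n → Fin n, volFormUp (G y) i * volFormUp (G y) j *
      ∏ l : Fin m, riemann (stdVec n) G (i ⟨2 * l, by omega⟩) (i ⟨2 * l + 1, by omega⟩)
          (j ⟨2 * l, by omega⟩) (j ⟨2 * l + 1, by omega⟩) y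
      = |d| * d⁻¹ ^ 2 * (4 ^ m * ((m.factorial : ℝ) ^ 2 * (d * c))) := by
    rw [← hmixed, ← sum_sign_prod_kulkarni_nomizu e (G y) (G y * A)
      (fun i j k l => riemann (stdVec n) G i j k l y) hR]
    have h1 : (G y)⁻¹.det = d⁻¹ := by rw [Matrix.det_nonsing_inv, Ring.inverse_eq_inv']
    have h2 : √|d| * √|d| = |d| := Real.mul_self_sqrt (abs_nonneg d)
    simp only [volFormUp_eq, h1, ← hd, he0, he1]
    calc _ = ∑ i, epsSymbol i * ∑ j, epsSymbol j * (|d| * d⁻¹ ^ 2 * ∏ l : Fin m,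
          riemann (stdVec n) G (i ⟨2 * l, by omega⟩) (i ⟨2 * l + 1, by omega⟩)
            (j ⟨2 * l, by omega⟩) (j ⟨2 * l + 1, by omega⟩) y) := by
          refine Finset.sum_congr rfl fun i _ => ?_
          rw [Finset.mul_sum]
          refine Finset.sum_congr rfl fun j _ => ?_
          rw [show |d| * d⁻¹ ^ 2 = √|d| * d⁻¹ * (√|d| * d⁻¹) by linear_combination -d⁻¹ ^ 2 * h2]
          ring
      _ = _ := by
          rw [sum_epsSymbol, Finset.mul_sum]
          refine Finset.sum_congr rfl fun σ _ => ?_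
          rw [sum_epsSymbol, Finset.mul_sum, Finset.mul_sum]
          refine Finset.sum_congr rfl fun τ _ => ?_
          ring
  have hreal : pfaffian q G y = m.factorial * c := by
    have h1 : ((-1 : ℝ) ^ q) * ((-1) ^ q) = 1 := by
      rw [← mul_pow]; norm_num
    have h2 : (2 : ℝ) ^ n = 4 ^ m := by
      rw [← hnm, mul_comm m 2, pow_mul]; norm_num
    have h3 : (m.factorial : ℝ) ≠ 0 := by positivity
    have h4 : (-1 : ℝ) ^ q * |d| = d := hsign.symm
    rw [pfaffian, hsum, h2]
    have h5 : (-1 : ℝ) ^ q / (4 ^ m * (m.factorial : ℝ))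
        * (|d| * d⁻¹ ^ 2 * (4 ^ m * ((m.factorial : ℝ) ^ 2 * (d * c))))
        = ((-1 : ℝ) ^ q * |d|) * (d⁻¹ ^ 2 * d) * (m.factorial * c) := by
      field_simp
    rw [h5, h4]
    field_simp
  rw [hreal, Complex.ofReal_mul, hc, coeff_det_one_add_X_smul A (by omega)]
  simp

end Pfaffian

/-! ### Curvature of a conformally flat metric at a point -/

section Locality

variable {ι E : Type*} [Fintype ι] [DecidableEq ι] [NormedAddCommGroup E] [NormedSpace ℝ E]

/-- The curvature tensor depends only on the metric near the point. -/
lemma riemann_congr {S : Set E} (hS : IsOpen S) (e : ι → E) {G G' : E → Matrix ι ι ℝ}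
    (h : EqOn G G' S) {z : E} (hz : z ∈ S) (i j k l : ι) :
    riemann e G i j k l z = riemann e G' i j k l z := by
  have hD : ∀ {f f' : E → ℝ}, EqOn f f' S → ∀ i, ∀ z ∈ S, partialD e f i z = partialD e f' i z := by
    intro f f' hf i z hz
    rw [partialD, partialD, Filter.EventuallyEq.fderiv_eq (hf.eventuallyEq_of_mem (hS.mem_nhds hz))]
  have hG : ∀ i j, EqOn (fun z => G z i j) (fun z => G' z i j) S := fun i j z hz =>
    congrFun (congrFun (h hz) i) j
  have hC : ∀ k i j, EqOn (christoffel e G k i j) (christoffel e G' k i j) S := by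
    intro k i j z hz
    simp only [christoffel, h hz, hD (hG _ _) _ z hz]
  have hU : ∀ m, riemannUp e G m j k l z = riemannUp e G' m j k l z := fun m => by
    simp only [riemannUp, hD (hC _ _ _) _ z hz, hC _ _ _ hz]
  simp only [riemann, hU, h hz]

end Locality

variable {n : ℕ}

/-- The curvature tensor of a conformally flat metric is the Kulkarni-Nomizu product of the metric
and its Schouten tensor. -/
lemma IsFlatPatch.riemann_eq {Y : Set (Eu n)} {G : Eu n → Matrix (Fin n) (Fin n) ℝ}
    {f : Eu n → ℝ} (H : IsFlatPatch Y G f) (hn : 2 < n) {y : Eu n} (hy : y ∈ Y) (i j k l : Fin n) :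
    riemann (stdVec n) G i j k l y
      = G y i k * (G y * schoutenEnd G y) j l + (G y * schoutenEnd G y) i k * G y j l
        - G y i l * (G y * schoutenEnd G y) j k - (G y * schoutenEnd G y) i l * G y j k := by
  have hS : ∀ i j, G y i j = G y j i := fun i j => congrFun (congrFun (H.symm y hy) j) i
  have h1 : evalAt (⟨y, hy⟩ : Y) ((smMat G H.smooth * curv (baseD H.isOpen)
      (chr (baseD H.isOpen) (smMat G H.smooth)) k l) i j)
      = (G y * (curv (baseD H.isOpen) (chr (baseD H.isOpen) (smMat G H.smooth)) k l).map
        (evalAt (⟨y, hy⟩ : Y))) i j := by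
    rw [← smMat_map G H.smooth ⟨y, hy⟩, ← Matrix.map_mul]; rfl
  have h2 : ∀ i j, evalAt (⟨y, hy⟩ : Y) ((smMat G H.smooth * H.schoutenMat) i j)
      = (G y * schoutenEnd G y) i j := fun i j => by
    rw [← H.map_schoutenMat hn ⟨y, hy⟩, ← smMat_map G H.smooth ⟨y, hy⟩, ← Matrix.map_mul]; rfl
  have h3 : ∀ i j, evalAt (⟨y, hy⟩ : Y) (H.schoutenMat i j) = schoutenEnd G y i j := fun i j => by
    rw [← H.map_schoutenMat hn ⟨y, hy⟩]; rfl
  have h4 : ∀ i j, evalAt (⟨y, hy⟩ : Y) (smMat G H.smooth i j) = G y i j := fun i j => rfl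
  have h5 : ∀ i j, evalAt (⟨y, hy⟩ : Y) ((1 : Matrix (Fin n) (Fin n) (smoothAlg Y)) i j)
      = (1 : Matrix (Fin n) (Fin n) ℝ) i j := fun i j => by
    simp [Matrix.one_apply, apply_ite (evalAt (⟨y, hy⟩ : Y))]
  have h6 : ∀ i k, ∑ m, G y i m * (1 : Matrix (Fin n) (Fin n) ℝ) m k = G y i k := fun i k => by
    rw [← Matrix.mul_apply, Matrix.mul_one]
  rw [riemann_eq_curv H.isOpen (stdVec n) (fun y => smMat_map G H.smooth y) H.isUnit_det i j k l
    ⟨y, hy⟩]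
  refine h1.trans ?_
  simp only [Matrix.mul_apply (M := G y) (N := (curv _ _ k l).map _), Matrix.map_apply,
    H.isSchouten.curvature, map_add, map_sub, map_mul, h2, h3, h4, h5]
  have e : ∀ m, G y i m * ((1 : Matrix (Fin n) (Fin n) ℝ) m k * (G y * schoutenEnd G y) j l
      - (1 : Matrix (Fin n) (Fin n) ℝ) m l * (G y * schoutenEnd G y) j k
      + schoutenEnd G y m k * G y l j - schoutenEnd G y m l * G y k j)
      = G y i m * (1 : Matrix (Fin n) (Fin n) ℝ) m k * (G y * schoutenEnd G y) j l
        - G y i m * (1 : Matrix (Fin n) (Fin n) ℝ) m l * (G y * schoutenEnd G y) j k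
        + G y i m * schoutenEnd G y m k * G y l j - G y i m * schoutenEnd G y m l * G y k j :=
    fun m => by ring
  simp only [e, Finset.sum_add_distrib, Finset.sum_sub_distrib, ← Finset.sum_mul, h6,
    ← Matrix.mul_apply (M := G y) (N := schoutenEnd G y)]
  rw [hS l j, hS k j]
  ring

/-! ### Metrics on manifolds in a chart -/

/-- A function that is continuous up to `x = 0` and positive at a boundary point is positive on a
smaller collar. -/
lemma exists_collar_forall_pos {Y : Set (Eu n)} (hY : IsOpen Y) {y : Eu n} (hy : y ∈ Y) {a : ℝ}
    (ha : 0 < a) {F : Eu n × ℝ → ℝ} (hF : ContinuousOn F (Y ×ˢ Ico (0 : ℝ) a))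
    (hpos : 0 < F (y, 0)) :
    ∃ Y' ⊆ Y, IsOpen Y' ∧ y ∈ Y' ∧ ∃ a', 0 < a' ∧ a' ≤ a ∧
      ∀ z ∈ Y', ∀ x ∈ Ico 0 a', 0 < F (z, x) := by
  have h1 : ∀ᶠ z in 𝓝[Y ×ˢ Ico (0 : ℝ) a] (y, (0 : ℝ)), 0 < F z :=
    (hF (y, 0) ⟨hy, le_rfl, ha⟩).eventually_const_lt hpos
  rw [nhdsWithin_prod_eq, hY.nhdsWithin_eq hy, Filter.eventually_prod_iff] at h1
  obtain ⟨p, hp, q, hq, hpq⟩ := h1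
  obtain ⟨Y', hY', hYo, hyY⟩ := eventually_nhds_iff.1 hp
  have hq' : ∀ᶠ x in 𝓝[≥] (0 : ℝ), q x := by
    rwa [nhdsWithin_Ico_eq_nhdsGE ha] at hq
  obtain ⟨b, hb, hbq⟩ := mem_nhdsGE_iff_exists_Ico_subset.1 hq'
  refine ⟨Y' ∩ Y, inter_subset_right, hYo.inter hY, ⟨hyY, hy⟩, min a b, lt_min ha hb,
    min_le_left _ _, fun z hz x hx => ?_⟩
  exact hpq (hY' z hz.1) (hbq ⟨hx.1, hx.2.trans_le (min_le_right _ _)⟩)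

section Charts

variable {M : Type*} [TopologicalSpace M] [ChartedSpace (Eu n) M]
  {φ : OpenPartialHomeomorph M (Eu n)}

lemma mdifferentiable_of_mem_maximalAtlas (hφ : φ ∈ IsManifold.maximalAtlas (𝓡 n) ∞ M) :
    φ.MDifferentiable (𝓡 n) (𝓡 n) :=
  ⟨(contMDiffOn_of_mem_maximalAtlas hφ).mdifferentiableOn (by simp),
    (contMDiffOn_symm_of_mem_maximalAtlas hφ).mdifferentiableOn (by simp)⟩

lemma mfderiv_symm_apply_mfderiv (hφ : φ ∈ IsManifold.maximalAtlas (𝓡 n) ∞ M) {m : M}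
    (hm : m ∈ φ.source) (v : TangentSpace (𝓡 n) m) :
    mfderiv (𝓡 n) (𝓡 n) φ.symm (φ m) (mfderiv (𝓡 n) (𝓡 n) φ m v) = v :=
  congrArg (fun L => L v) ((mdifferentiable_of_mem_maximalAtlas hφ).symm_comp_deriv hm)

lemma mfderiv_apply_mfderiv_symm (hφ : φ ∈ IsManifold.maximalAtlas (𝓡 n) ∞ M) {y : Eu n}
    (hy : y ∈ φ.target) (v : Eu n) :
    mfderiv (𝓡 n) (𝓡 n) φ (φ.symm y) (mfderiv (𝓡 n) (𝓡 n) φ.symm y v) = v :=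
  congrArg (fun L => L v) ((mdifferentiable_of_mem_maximalAtlas hφ).comp_symm_deriv hy)

end Charts

/-! ### Components of bilinear forms in a chart -/

section Components

variable {n p q : ℕ} {M : Type*} [TopologicalSpace M] [ChartedSpace (Eu n) M]
  {φ : OpenPartialHomeomorph M (Eu n)}

lemma sum_smul_stdVec (v : Eu n) : ∑ i, v i • stdVec n i = v := by
  ext j
  simp [stdVec, Finset.sum_apply, Pi.single_apply]

lemma bilin_mfderiv_symm (b : BilinField n M) (y u v : Eu n) :
    b (φ.symm y) (mfderiv (𝓡 n) (𝓡 n) φ.symm y u) (mfderiv (𝓡 n) (𝓡 n) φ.symm y v)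
      = ∑ i, ∑ j, comps φ b y i j * u i * v j := by
  set L : Eu n →L[ℝ] TangentSpace (𝓡 n) (φ.symm y) := mfderiv (𝓡 n) (𝓡 n) φ.symm y with hL
  have h1 : ∀ i j, comps φ b y i j = b (φ.symm y) (L (stdVec n i)) (L (stdVec n j)) :=
    fun i j => rfl
  have h2 : ∀ v, L v = ∑ i, v i • L (stdVec n i) := fun v => by
    conv_lhs => rw [← sum_smul_stdVec v]
    rw [map_sum]
    simp only [map_smul]
  change b (φ.symm y) (L u) (L v) = _
  rw [h2 u, h2 v]
  simp only [map_sum, map_smul, sum_apply, smul_apply,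
    smul_eq_mul, Finset.mul_sum, h1]
  rw [Finset.sum_comm]
  exact Finset.sum_congr rfl fun i _ => Finset.sum_congr rfl fun j _ => by ring

lemma comps_transpose {b : BilinField n M} {y : Eu n}
    (hs : ∀ v w, b (φ.symm y) v w = b (φ.symm y) w v) : (comps φ b y)ᵀ = comps φ b y := by
  ext i j
  exact hs _ _

lemma det_comps_ne_zero (hφ : φ ∈ IsManifold.maximalAtlas (𝓡 n) ∞ M) {b : BilinField n M} {y : Eu n}
    (hy : y ∈ φ.target) (hb : ∀ v, (∀ w, b (φ.symm y) v w = 0) → v = 0) :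
    (comps φ b y).det ≠ 0 := by
  intro h0
  obtain ⟨v, hv, hv0⟩ := Matrix.exists_vecMul_eq_zero_iff.2 h0
  have hy' : φ.symm y ∈ φ.source := φ.map_target hy
  set v' : Eu n := WithLp.toLp 2 v with hv'
  have h1 : mfderiv (𝓡 n) (𝓡 n) φ.symm y v' = 0 := by
    refine hb _ fun w => ?_
    have hw : ∃ w' : Eu n, mfderiv (𝓡 n) (𝓡 n) φ.symm y w' = w := by
      have := mfderiv_symm_apply_mfderiv hφ hy' w
      rw [φ.right_inv hy] at this
      exact ⟨_, this⟩
    obtain ⟨w', rfl⟩ := hw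
    rw [bilin_mfderiv_symm, Finset.sum_comm]
    refine Finset.sum_eq_zero fun j _ => ?_
    have h2 : ∑ i, v i * comps φ b y i j = 0 := congrFun hv0 j
    rw [← Finset.sum_mul]
    have h3 : ∑ i, comps φ b y i j * v' i = 0 := by
      rw [← h2]
      exact Finset.sum_congr rfl fun i _ => mul_comm _ _
    rw [h3, zero_mul]
  have h2 := mfderiv_apply_mfderiv_symm hφ hy v'
  rw [h1, map_zero] at h2
  exact hv (by rw [show v = v'.ofLp from rfl, ← h2]; rfl)

/-- The determinant of a metric of signature `(p, q)` has the sign `(-1)^q`. -/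
lemma det_comps_sign {g : PseudoMetric n M} (hsig : g.HasSignature p q) (y : Eu n) :
    (comps φ g.val y).det = (-1) ^ q * |(comps φ g.val y).det| := by
  obtain ⟨b, hb⟩ := hsig (φ.symm y)
  set L : Eu n →L[ℝ] TangentSpace (𝓡 n) (φ.symm y) := mfderiv (𝓡 n) (𝓡 n) φ.symm y with hL
  have hcard : Fintype.card (Fin p ⊕ Fin q) = n := by
    rw [← Module.finrank_eq_card_basis b]
    exact finrank_euclideanSpace_fin
  let e : Fin p ⊕ Fin q ≃ Fin n := Fintype.equivOfCardEq (by rw [hcard, Fintype.card_fin])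
  let ε : Fin p ⊕ Fin q → ℝ := Sum.elim (fun _ => 1) (fun _ => -1)
  let C : Matrix (Fin n) (Fin n) ℝ := Matrix.of fun s i => b.repr (L (stdVec n i)) (e.symm s)
  have h1 : comps φ g.val y = Cᵀ * Matrix.diagonal (fun s => ε (e.symm s)) * C := by
    ext i j
    change g.val (φ.symm y) (L (stdVec n i)) (L (stdVec n j)) = _
    conv_lhs => rw [← b.sum_repr (L (stdVec n i)), ← b.sum_repr (L (stdVec n j))]
    simp only [map_sum, map_smul, sum_apply, smul_apply,
      smul_eq_mul, hb, mul_ite, mul_zero, Finset.sum_ite_eq', Finset.mem_univ, if_true]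
    rw [Matrix.mul_apply, ← Equiv.sum_comp e]
    refine Finset.sum_congr rfl fun s _ => ?_
    simp only [C, ε, Matrix.mul_diagonal, Matrix.transpose_apply, Matrix.of_apply,
      Equiv.symm_apply_apply]
    ring
  have h2 : (comps φ g.val y).det = (-1) ^ q * C.det ^ 2 := by
    rw [h1, Matrix.det_mul, Matrix.det_mul, Matrix.det_transpose, Matrix.det_diagonal,
      Equiv.prod_comp e.symm ε, Fintype.prod_sum_type]
    simp [ε]
    ring
  have h3 : |(comps φ g.val y).det| = C.det ^ 2 := by
    rw [h2, abs_mul, abs_pow, abs_neg, abs_one, one_pow, one_mul, abs_of_nonneg (sq_nonneg _)]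
  rw [h3, h2]

end Components

/-! ### The coefficients of the volume form on a manifold -/

section Manifold

variable {n : ℕ} {M : Type*} [TopologicalSpace M] [ChartedSpace (Eu n) M]
  {φ : OpenPartialHomeomorph M (Eu n)} {g : PseudoMetric n M}

lemma exists_isFlatPatch (hflat : g.IsConformallyFlat)
    (hφ : φ ∈ IsManifold.maximalAtlas (𝓡 n) ∞ M) {m : M} (hm : m ∈ φ.source) :
    ∃ Y ⊆ φ.target, φ m ∈ Y ∧ ∃ f, IsFlatPatch Y (comps φ g.val) f := by
  obtain ⟨V, hV, hmV, f, hf, hR⟩ := hflat m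
  refine ⟨φ.target ∩ φ.symm ⁻¹' V, inter_subset_left,
    ⟨φ.map_source hm, by rwa [mem_preimage, φ.left_inv hm]⟩, fun z => f (φ.symm z), ?_⟩
  exact
    { isOpen := φ.isOpen_inter_preimage_symm hV
      smooth := fun i j => (g.smooth φ hφ i j).mono inter_subset_left
      symm := fun y _ => comps_transpose (g.symm _)
      det_ne := fun y hy => det_comps_ne_zero hφ hy.1 (g.nondegenerate _)
      smooth_factor := contMDiffOn_iff_contDiffOn.1
        (hf.comp ((contMDiffOn_symm_of_mem_maximalAtlas hφ).mono inter_subset_left)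
          fun y hy => hy.2)
      flat := fun y hy => hR φ hφ y hy.1 hy.2 }

section Family

variable {U : Set M} {a : ℝ} {gx : ℝ → BilinField n M}

lemma IsMetricFamily.symm_mem (H : IsMetricFamily g φ U a gx) {y : Eu n} (hy : y ∈ φ '' U) :
    φ.symm y ∈ U := by
  obtain ⟨m, hm, rfl⟩ := hy
  rwa [φ.left_inv (H.subset hm)]

lemma IsMetricFamily.isCollarFamily (H : IsMetricFamily g φ U a gx) :
    IsCollarFamily (φ '' U) a (fun x => comps φ (gx x)) where
  smooth := H.smooth
  symm y hy x hx := comps_transpose (H.symm x hx _ (H.symm_mem hy))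
  det_ne y hy x hx := by
    have hyt : y ∈ φ.target := by
      obtain ⟨m, hm, rfl⟩ := hy
      exact φ.map_source (H.subset hm)
    exact det_comps_ne_zero H.chart_mem hyt (H.nondegenerate x hx _ (H.symm_mem hy))

lemma IsMetricFamily.comps_zero (H : IsMetricFamily g φ U a gx) {y : Eu n} (hy : y ∈ φ '' U) :
    comps φ (gx 0) y = comps φ g.val y := by
  ext i j
  rw [comps, comps, Matrix.of_apply, Matrix.of_apply, H.initial _ (H.symm_mem hy)]

/-- Near every boundary point there is a collar on which the metric is conformally flat and both
the family and the explicit hyperbolic family have positive volume ratio. -/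
lemma IsMetricFamily.exists_collar (H : IsMetricFamily g φ U a gx) (hn : 2 < n)
    (hflat : g.IsConformallyFlat) {m : M} (hm : m ∈ U) :
    ∃ Y ⊆ φ '' U, φ m ∈ Y ∧ ∃ b, 0 < b ∧ b ≤ a ∧ ∃ f, IsFlatPatch Y (comps φ g.val) f ∧
      (∀ y ∈ Y, ∀ x ∈ Ico 0 b, 0 < (hypA x (schoutenEnd (comps φ g.val) y)).det) ∧
      (∀ y ∈ Y, ∀ x ∈ Ico 0 b, 0 < (comps φ (gx x) y).det / (comps φ g.val y).det) ∧
      IsCollarFamily Y b (fun x => comps φ (gx x)) := by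
  obtain ⟨Y₀, -, hmY₀, f, hf⟩ := exists_isFlatPatch hflat H.chart_mem (H.subset hm)
  have hUo : IsOpen (φ '' U) := φ.isOpen_image_of_subset_source H.isOpen H.subset
  have hmU : φ m ∈ φ '' U := mem_image_of_mem φ hm
  have hf₁ := hf.mono (hf.isOpen.inter hUo) inter_subset_left
  set Y₁ := Y₀ ∩ φ '' U
  have hc1 : ContinuousOn (fun z : Eu n × ℝ => (hypA z.2 (schoutenEnd (comps φ g.val) z.1)).det)
      (Y₁ ×ˢ Ico (0 : ℝ) a) :=
    (contDiffOn_det fun i j => hf₁.contDiffOn_hypA hn a i j).continuousOn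
  have hc2 : ContinuousOn (fun z : Eu n × ℝ => (comps φ (gx z.2) z.1).det / (comps φ g.val z.1).det)
      (Y₁ ×ˢ Ico (0 : ℝ) a) := by
    refine ContinuousOn.div ?_ ?_ fun z hz => hf₁.det_ne _ hz.1
    · exact (contDiffOn_det H.smooth).continuousOn.mono (prod_mono inter_subset_right Subset.rfl)
    · exact (contDiffOn_det hf₁.smooth).continuousOn.comp continuousOn_fst fun z hz => hz.1
  -- One collar serves both ratios: they equal `1` at `(φ m, 0)`, so their minimum is positive near
  -- that point.
  have hF := hc1.inf hc2
  obtain ⟨Y, hYY, hYo, hmY, b, hb, hba, hpos⟩ := exists_collar_forall_pos hf₁.isOpen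
    ⟨hmY₀, hmU⟩ H.pos hF (by
      show 0 < min _ _
      refine lt_min ?_ ?_
      · simp [hypA]
      · rw [H.comps_zero hmU, div_self (hf₁.det_ne _ ⟨hmY₀, hmU⟩)]
        exact one_pos)
  have hYU : Y ⊆ φ '' U := hYY.trans inter_subset_right
  have hC := H.isCollarFamily
  refine ⟨Y, hYU, hmY, b, hb, hba, f, hf₁.mono hYo hYY,
    fun y hy x hx => (lt_min_iff.1 (hpos y hy x hx)).1,
    fun y hy x hx => (lt_min_iff.1 (hpos y hy x hx)).2, ?_⟩
  have hI : Ico 0 b ⊆ Ico 0 a := Ico_subset_Ico_right hba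
  exact
    { smooth := fun i j => (hC.smooth i j).mono (prod_mono hYU hI)
      symm := fun y hy x hx => hC.symm y (hYU hy) x (hI hx)
      det_ne := fun y hy x hx => hC.det_ne y (hYU hy) x (hI hx) }

/-- The volume form of a hyperbolic metric has the Taylor coefficients of `det (1 - x² P / 2)`, in
all orders. -/
theorem volCoeff_of_isHyperbolicMetric (hn : 2 < n) (hflat : g.IsConformallyFlat)
    (H : IsHyperbolicMetric g φ U a gx) {m : M} (hm : m ∈ U) (k : ℕ) :
    (volCoeff (comps φ g.val) (fun x => comps φ (gx x)) (2 * k) (φ m) : ℂ) =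
      if k ≤ n then (-2 : ℂ) ^ (-(k : ℤ)) * sigmaEig k (schoutenEnd (comps φ g.val) (φ m))
      else 0 := by
  obtain ⟨Y, hYU, hmY, b, hb, hba, f, hf, hA, hpos, hC⟩ := H.exists_collar hn hflat hm
  have h1 := hf.det_sub_det_mem_of_hyperbolic hn hA hC (fun y hy => H.comps_zero (hYU hy)) hb
    (fun y hy x hx A B C F => by
      obtain ⟨m', hm', rfl⟩ := hYU hy
      exact H.curvature m' hm' x ⟨hx.1, hx.2.trans_le hba⟩ A B C F) (2 * k + 1)
  rw [hf.volCoeff_eq_of_det_sub_det_mem hn hA hC hb hpos h1 hmY (Nat.lt_succ_self _)]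
  exact iteratedDerivWithin_det_hypA _ k

/-- The volume form of a Poincaré metric has the Taylor coefficients of `det (1 - x² P / 2)` up to
and including order `n`. -/
theorem volCoeff_of_isPoincareMetric (hn : 2 < n) (hflat : g.IsConformallyFlat)
    (H : IsPoincareMetric g φ U a gx) {m : M} (hm : m ∈ U) {k : ℕ} (hk : k ≤ n / 2) :
    (volCoeff (comps φ g.val) (fun x => comps φ (gx x)) (2 * k) (φ m) : ℂ) =
      (-2 : ℂ) ^ (-(k : ℤ)) * sigmaEig k (schoutenEnd (comps φ g.val) (φ m)) := by
  obtain ⟨Y, hYU, hmY, b, hb, hba, f, hf, hA, hpos, hC⟩ := H.exists_collar hn hflat hm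
  have h1 := hf.det_sub_det_mem_of_poincare hn hA hC (fun y hy => H.comps_zero (hYU hy)) hb
    (fun y hy A B => by
      obtain ⟨m', hm', rfl⟩ := hYU hy
      exact H.einstein m' hm' A B)
    (fun y hy => by
      obtain ⟨m', hm', rfl⟩ := hYU hy
      exact H.trace m' hm')
  rw [hf.volCoeff_eq_of_det_sub_det_mem hn hA hC hb hpos h1 hmY (by omega),
    iteratedDerivWithin_det_hypA, if_pos (by omega)]

end Family

theorem pfaffian_of_isConformallyFlat {p q : ℕ} (hn : 2 < n) (hsig : g.HasSignature p q)
    (hflat : g.IsConformallyFlat) (he : Even n) (hφ : φ ∈ IsManifold.maximalAtlas (𝓡 n) ∞ M) {m : M}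
    (hm : m ∈ φ.source) :
    (pfaffian q (comps φ g.val) (φ m) : ℂ) =
      (Nat.factorial (n / 2) : ℂ) * sigmaEig (n / 2) (schoutenEnd (comps φ g.val) (φ m)) := by
  obtain ⟨Y, -, hmY, f, hf⟩ := exists_isFlatPatch hflat hφ hm
  exact pfaffian_eq_of_kulkarni_nomizu he (hf.det_ne _ hmY) (det_comps_sign hsig _)
    (hf.riemann_eq hn hmY)

/-! ### Existence of hyperbolic metrics -/

/-- The differential of the chart `φ` at `m`, with values in the model space. -/
def chartDeriv (φ : OpenPartialHomeomorph M (Eu n)) (m : M) : TangentSpace (𝓡 n) m →L[ℝ] Eu n :=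
  mfderiv (𝓡 n) (𝓡 n) φ m

lemma chartDeriv_mfderiv_symm (hφ : φ ∈ IsManifold.maximalAtlas (𝓡 n) ∞ M) {y : Eu n}
    (hy : y ∈ φ.target) (v : Eu n) :
    chartDeriv φ (φ.symm y) (mfderiv (𝓡 n) (𝓡 n) φ.symm y v) = v :=
  mfderiv_apply_mfderiv_symm hφ hy v

lemma mfderiv_symm_chartDeriv (hφ : φ ∈ IsManifold.maximalAtlas (𝓡 n) ∞ M) {m : M}
    (hm : m ∈ φ.source) (v : TangentSpace (𝓡 n) m) :
    mfderiv (𝓡 n) (𝓡 n) φ.symm (φ m) (chartDeriv φ m v) = v :=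
  mfderiv_symm_apply_mfderiv hφ hm v

lemma chartDeriv_surjective (hφ : φ ∈ IsManifold.maximalAtlas (𝓡 n) ∞ M) {m : M}
    (hm : m ∈ φ.source) : Function.Surjective (chartDeriv φ m) := by
  obtain ⟨y, hy, rfl⟩ : ∃ y ∈ φ.target, φ.symm y = m := ⟨φ m, φ.map_source hm, φ.left_inv hm⟩
  exact fun u => ⟨_, chartDeriv_mfderiv_symm hφ hy u⟩

lemma chartDeriv_injective (hφ : φ ∈ IsManifold.maximalAtlas (𝓡 n) ∞ M) {m : M}
    (hm : m ∈ φ.source) : Function.Injective (chartDeriv φ m) := fun v w h => by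
  have h1 := mfderiv_symm_chartDeriv hφ hm v
  rw [h] at h1
  exact h1.symm.trans (mfderiv_symm_chartDeriv hφ hm w)

/-- The field of bilinear forms whose components in the chart `φ` are `h`. -/
def fieldOfComps (φ : OpenPartialHomeomorph M (Eu n)) (h : Eu n → Matrix (Fin n) (Fin n) ℝ) :
    BilinField n M := fun m =>
  ∑ i, ∑ j, h (φ m) i j • ((EuclideanSpace.proj (𝕜 := ℝ) i : Eu n →L[ℝ] ℝ).comp
    (chartDeriv φ m)).smulRight ((EuclideanSpace.proj (𝕜 := ℝ) j : Eu n →L[ℝ] ℝ).comp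
      (chartDeriv φ m))

lemma fieldOfComps_apply (h : Eu n → Matrix (Fin n) (Fin n) ℝ) (m : M)
    (v w : TangentSpace (𝓡 n) m) :
    fieldOfComps φ h m v w
      = ∑ i, ∑ j, h (φ m) i j * chartDeriv φ m v i * chartDeriv φ m w j := by
  simp only [fieldOfComps, sum_apply, smul_apply, ContinuousLinearMap.smulRight_apply,
    smul_eq_mul, mul_assoc]
  rfl

lemma comps_fieldOfComps (hφ : φ ∈ IsManifold.maximalAtlas (𝓡 n) ∞ M)
    (h : Eu n → Matrix (Fin n) (Fin n) ℝ) {y : Eu n} (hy : y ∈ φ.target) :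
    comps φ (fieldOfComps φ h) y = h y := by
  ext i j
  have h1 : h (φ (φ.symm y)) = h y := by rw [φ.right_inv hy]
  rw [comps, Matrix.of_apply, fieldOfComps_apply, h1, chartDeriv_mfderiv_symm hφ hy,
    chartDeriv_mfderiv_symm hφ hy]
  simp [stdVec]

lemma fieldOfComps_comps (hφ : φ ∈ IsManifold.maximalAtlas (𝓡 n) ∞ M) (b : BilinField n M) {m : M}
    (hm : m ∈ φ.source) : fieldOfComps φ (comps φ b) m = b m := by
  have h0 : ∀ m', m' = m → ∀ u v : Eu n, b m' u v = b m u v := by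
    rintro _ rfl u v
    rfl
  refine ContinuousLinearMap.ext fun v => ContinuousLinearMap.ext fun w => ?_
  have h1 := bilin_mfderiv_symm (φ := φ) b (φ m) (chartDeriv φ m v) (chartDeriv φ m w)
  rw [fieldOfComps_apply, ← h1]
  rw [mfderiv_symm_chartDeriv hφ hm, mfderiv_symm_chartDeriv hφ hm]
  exact h0 _ (φ.left_inv hm) v w

/-- The explicit family `g (1 - x² P / 2)²` near `m`, transported from the chart to the manifold. -/
theorem exists_isHyperbolicMetric (hn : 2 < n) (hflat : g.IsConformallyFlat)
    (hφ : φ ∈ IsManifold.maximalAtlas (𝓡 n) ∞ M) {m : M} (hm : m ∈ φ.source) :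
    ∃ (U : Set M) (a : ℝ) (gx : ℝ → BilinField n M), m ∈ U ∧ IsHyperbolicMetric g φ U a gx := by
  obtain ⟨Y₀, hY₀, hmY₀, f, hf⟩ := exists_isFlatPatch hflat hφ hm
  obtain ⟨Y, hYY, hYo, hmY, a, ha, -, hpos⟩ := exists_collar_forall_pos hf.isOpen hmY₀ one_pos
    (F := fun z => (hypA z.2 (schoutenEnd (comps φ g.val) z.1)).det)
    (contDiffOn_det fun i j => hf.contDiffOn_hypA hn 1 i j).continuousOn (by simp [hypA])
  have hf' := hf.mono hYo hYY
  have hYt : Y ⊆ φ.target := hYY.trans hY₀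
  have hC := hf'.isCollarFamily_hyp hn hpos
  set gx : ℝ → BilinField n M := fun x => fieldOfComps φ (hypFamily (comps φ g.val) x) with hgx
  have hcomps : ∀ x, ∀ y ∈ Y, comps φ (gx x) y = hypFamily (comps φ g.val) x y := fun x y hy =>
    comps_fieldOfComps hφ _ (hYt hy)
  have himage : φ '' (φ.source ∩ φ ⁻¹' Y) = Y := by
    refine Subset.antisymm (image_subset_iff.2 fun _ h => h.2) fun y hy => ?_
    exact ⟨φ.symm y, ⟨φ.map_target (hYt hy), by rwa [mem_preimage, φ.right_inv (hYt hy)]⟩,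
      φ.right_inv (hYt hy)⟩
  refine ⟨φ.source ∩ φ ⁻¹' Y, a, gx, ⟨hm, hmY⟩, ?_⟩
  exact
    { chart_mem := hφ
      isOpen := φ.isOpen_inter_preimage hYo
      subset := inter_subset_left
      pos := ha
      symm := fun x _ m' hm' v w => by
        have hs : ∀ i j, hypFamily (comps φ g.val) x (φ m') i j
            = hypFamily (comps φ g.val) x (φ m') j i := fun i j =>
          congrFun (congrFun (hf'.transpose_hypFamily hn hm'.2 x) j) i
        rw [hgx]
        beta_reduce
        rw [fieldOfComps_apply, fieldOfComps_apply, Finset.sum_comm]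
        refine Finset.sum_congr rfl fun i _ => Finset.sum_congr rfl fun j _ => ?_
        rw [hs j i]
        ring
      nondegenerate := fun x hx m' hm' v hv => by
        have h1 : (chartDeriv φ m' v).ofLp ᵥ* hypFamily (comps φ g.val) x (φ m') = 0 := by
          ext j
          obtain ⟨w, hw⟩ := chartDeriv_surjective hφ hm'.1 (stdVec n j)
          have h2 := hv w
          simp only [hgx, fieldOfComps_apply, hw, stdVec, PiLp.single_apply, mul_ite, mul_one,
            mul_zero, Finset.sum_ite_eq', Finset.mem_univ, if_true] at h2
          rw [Matrix.vecMul, Pi.zero_apply, ← h2]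
          exact Finset.sum_congr rfl fun i _ => mul_comm _ _
        have h2 := Matrix.eq_zero_of_vecMul_eq_zero (hC.det_ne _ hm'.2 x hx) h1
        refine chartDeriv_injective hφ hm'.1 ?_
        rw [map_zero]
        ext i
        exact congrFun h2 i
      smooth := fun i j => by
        rw [himage]
        exact (hC.smooth i j).congr fun z hz => by rw [hcomps _ _ hz.1]
      initial := fun m' hm' => by
        rw [← fieldOfComps_comps hφ g.val hm'.1]
        have h1 : hypFamily (comps φ g.val) 0 = comps φ g.val := by
          funext y
          simp [hypFamily, hypA]
        rw [hgx]
        beta_reduce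
        rw [h1]
      curvature := fun m' hm' x hx A B C F => by
        have h1 : EqOn (gPlus fun x => comps φ (gx x)) (gPlus (hypFamily (comps φ g.val)))
            (Y ×ˢ Ioo (0 : ℝ) a) := fun z hz => by
          rw [gPlus, gPlus, hcomps _ _ hz.1]
        have hz : (φ m', x) ∈ Y ×ˢ Ioo (0 : ℝ) a := ⟨hm'.2, hx⟩
        rw [riemann_congr (hYo.prod isOpen_Ioo) _ h1 hz, h1 hz]
        exact hf'.hypFamily_constant_curvature hn hpos hm'.2 hx A B C F }

end Manifold

end ConformallyFlatVolume

end

open ConformallyFlatVolume in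
theorem mainTheorem2 {n p q : ℕ} (hn : 2 < n)
    {M : Type*} [TopologicalSpace M] [ChartedSpace (EuclideanSpace ℝ (Fin n)) M]
    [IsManifold (𝓡 n) ∞ M]
    (g : PseudoMetric n M) (hsig : g.HasSignature p q) (hflat : g.IsConformallyFlat) :
    -- near every point there is a hyperbolic `g₊`
    (∀ φ ∈ IsManifold.maximalAtlas (𝓡 n) ∞ M, ∀ m ∈ φ.source,
      ∃ (U : Set M) (a : ℝ) (gx : ℝ → BilinField n M),
        m ∈ U ∧ IsHyperbolicMetric g φ U a gx) ∧
    -- the coefficients of all orders, in all dimensions `n > 2`, from any hyperbolic `g₊`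
    (∀ φ U a gx, IsHyperbolicMetric g φ U a gx → ∀ m ∈ U, ∀ k : ℕ,
      (volCoeff (comps φ g.val) (fun x => comps φ (gx x)) (2 * k) (φ m) : ℂ) =
        if k ≤ n then (-2 : ℂ) ^ (-(k : ℤ)) * sigmaEig k (schoutenEnd (comps φ g.val) (φ m))
        else 0) ∧
    -- the coefficients of order at most `n`, for even `n`, from any Poincaré metric
    (Even n → ∀ φ U a gx, IsPoincareMetric g φ U a gx → ∀ m ∈ U, ∀ k ≤ n / 2,
      (volCoeff (comps φ g.val) (fun x => comps φ (gx x)) (2 * k) (φ m) : ℂ) =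
        (-2 : ℂ) ^ (-(k : ℤ)) * sigmaEig k (schoutenEnd (comps φ g.val) (φ m))) ∧
    -- the Pfaffian of a conformally flat metric
    (Even n → ∀ φ ∈ IsManifold.maximalAtlas (𝓡 n) ∞ M, ∀ m ∈ φ.source,
      (pfaffian q (comps φ g.val) (φ m) : ℂ) =
        (Nat.factorial (n / 2) : ℂ) * sigmaEig (n / 2) (schoutenEnd (comps φ g.val) (φ m))) ∧
    -- the coefficient of order `n` in terms of the Pfaffian
    (Even n → ∀ φ U a gx, IsPoincareMetric g φ U a gx ∨ IsHyperbolicMetric g φ U a gx → ∀ m ∈ U,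
      volCoeff (comps φ g.val) (fun x => comps φ (gx x)) n (φ m) =
        (-2 : ℝ) ^ (-((n / 2 : ℕ) : ℤ)) * (Nat.factorial (n / 2) : ℝ)⁻¹
          * pfaffian q (comps φ g.val) (φ m)) := by
  have hhyp : ∀ φ U a gx, IsHyperbolicMetric g φ U a gx → ∀ m ∈ U, ∀ k : ℕ,
      (volCoeff (comps φ g.val) (fun x => comps φ (gx x)) (2 * k) (φ m) : ℂ) =
        if k ≤ n then (-2 : ℂ) ^ (-(k : ℤ)) * sigmaEig k (schoutenEnd (comps φ g.val) (φ m))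
        else 0 :=
    fun φ U a gx H m hm k => volCoeff_of_isHyperbolicMetric hn hflat H hm k
  have hpoi : ∀ φ U a gx, IsPoincareMetric g φ U a gx → ∀ m ∈ U, ∀ k ≤ n / 2,
      (volCoeff (comps φ g.val) (fun x => comps φ (gx x)) (2 * k) (φ m) : ℂ) =
        (-2 : ℂ) ^ (-(k : ℤ)) * sigmaEig k (schoutenEnd (comps φ g.val) (φ m)) :=
    fun φ U a gx H m hm k hk => volCoeff_of_isPoincareMetric hn hflat H hm hk
  refine ⟨fun φ hφ m hm => exists_isHyperbolicMetric hn hflat hφ hm, hhyp, fun _ => hpoi,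
    fun he φ hφ m hm => pfaffian_of_isConformallyFlat hn hsig hflat he hφ hm,
    fun he φ U a gx H m hm => ?_⟩
  have hfam : IsMetricFamily g φ U a gx :=
    H.elim (fun H => H.toIsMetricFamily) fun H => H.toIsMetricFamily
  have hpf := pfaffian_of_isConformallyFlat hn hsig hflat he hfam.chart_mem (hfam.subset hm)
  have hvol : (volCoeff (comps φ g.val) (fun x => comps φ (gx x)) n (φ m) : ℂ) =
      (-2 : ℂ) ^ (-((n / 2 : ℕ) : ℤ))
        * sigmaEig (n / 2) (schoutenEnd (comps φ g.val) (φ m)) := by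
    have hk : 2 * (n / 2) = n := Nat.mul_div_cancel' he.two_dvd
    rcases H with H | H
    · have h := hpoi φ U a gx H m hm (n / 2) le_rfl
      rwa [hk] at h
    · have h := hhyp φ U a gx H m hm (n / 2)
      rwa [hk, if_pos (Nat.div_le_self n 2)] at h
  have hfac : (Nat.factorial (n / 2) : ℂ) ≠ 0 := Nat.cast_ne_zero.2 (Nat.factorial_ne_zero _)
  apply Complex.ofReal_injective
  rw [hvol]
  push_cast
  rw [hpf, mul_assoc, inv_mul_cancel_left₀ hfac]
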